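/- There are two tasks and two players. A bid is a vector $x=(x_1,x_2,x_{12})\in\mathbb R_{\ge 0}^3$ giving the costs of the bundles $1$, $2$, $12$ of tasks (the empty bundle costs $x_\emptyset=0$). Let $B>0$, $\epsilon>0$ and $$V=\{x: 0\le x_1,x_2\le x_{12}\},\quad V_{\mathrm{submod}}=\{x\in V: x_{12}\le x_1+x_2\},\quad V_\epsilon=\{x\in V: |x_{12}-x_1-x_2|<\epsilon\},$$ $$V_{+,B}=\{x: 0\le x_1,x_2<B,\ x_{12}=x_1+x_2\}.$$ Let $V^*\in\{V,V_{\mathrm{submod}},V_\epsilon,V_{\mathrm{submod}}\cap V_\epsilon\}$. Let $A$ be an allocation on $V^*\times V_{+,B}$ that always allocates both tasks: on bids $(t,s)$ the $t$-player receives the bundle $A(t,s)\in\{\emptyset,1,2,12\}$ and the $s$-player receives the complement $\overline{A(t,s)}$. Assume that $A$ is weakly monotone: for all $t,t'\in V^*$ and $s,s'\in V_{+,B}$, $$t(A(t,s))-t(A(t',s))\le t'(A(t,s))-t'(A(t',s)),$$ $$s(\overline{A(t,s)})-s(\overline{A(t,s')})\le s'(\overline{A(t,s)})-s'(\overline{A(t,s')}).$$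 Assume also that for every $s\in V_{+,B}$ the region $R_\emptyset(s)$, i.e. the interior relative to $V^*$ of $\{t\in V^*: A(t,s)=\emptyset\}$, is nonempty. Call a bid $x$ positive if $0<x_1<x_{12}$ and $0<x_2<x_{12}$ (for additive bids: $x_1,x_2>0$). Then, on the set of all pairs of positive bids $t\in V^*$, $s\in V_{+,B}$, the allocation $A$ is of at least one of the following types. Below, constants $\gamma=(\gamma_\emptyset,\gamma_1,\gamma_2,\gamma_{12})$ satisfy $\gamma_\emptyset\in\mathbb R$ and $\gamma_1,\gamma_2,\gamma_{12}\in\mathbb R\cup\{\infty\}$; "increasing" means non-decreasing; and where an increasing function $\xi$ has a jump at $x$, "critical value given by $\xi(x)$" means a critical value that may depend on $s$ but lies between $\xi(x^-)$ and $\xi(x^+)$. 1. A relaxed affine minimizer, that is, there are $\mu_t,\mu_s>0$ and $\gamma$ such that either * (affine minimizer) $A(t,s)$ always minimizes $\mu_t\, t_\alpha+\mu_s\, s_{\bar\alpha}+\gamma_\alpha$ over $\alpha\in\{\emptyset,1,2,12\}$; or * (affine minimizer with bundling tail) $D:=\min(\gamma_1,\gamma_2)-\gamma_\emptyset$ is finite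 and positive, and there is an increasing $\xi:[0,D]\to[0,\infty)$ with $\xi(D)=\min(\gamma_1,\gamma_2)-\gamma_{12}$, such that $A(t,s)$ minimizes the same objective whenever $\mu_s(s_1+s_2)>D$; and whenever $\mu_s(s_1+s_2)\le D$, the $t$-player receives $\emptyset$ or $12$, with critical value $c$ given by $\xi(\mu_s(s_1+s_2))$: he receives $\emptyset$ if $\mu_t t_{12}>c$ and $12$ if $\mu_t t_{12}<c$ (at $D$ we put $\xi(D^+)=\xi(D)$). 2. A one-dimensional mechanism: for some bundle $\alpha\in\{1,2,12\}$ the $t$-player only ever receives $\emptyset$ or $\alpha$, and there is an increasing nonnegative function $\xi$ of $s_\alpha$ such that, with critical value $c$ given by $\xi(s_\alpha)$, he receives $\emptyset$ if $t_\alpha>c$ and $\alpha$ if $t_\alpha<c$ (for $\alpha=12$: a bundling mechanism). 3. A constant mechanism: up to tie-breaking the allocation does not depend on $s$, i.e. there are $\mu_t>0$ and $\gamma$ such that $A(t,s)$ always minimizes $\mu_t t_\alpha+\gamma_\alpha$ over $\alpha\in\{\emptyset,1,2,12\}$. -/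

import Mathlib

open Set Topology

/-- The four bundles of the two tasks. -/
inductive Bundle
  | empty
  | one
  | two
  | both

/-- The tasks that are not in the bundle. -/
def Bundle.compl : Bundle → Bundle
  | .empty => .both
  | .one => .two
  | .two => .one
  | .both => .empty

/-- A bid is a vector `(x₁, x₂, x₁₂)`. -/
abbrev Bid : Type := ℝ × ℝ × ℝ

/-- The cost of a bundle under the bid `(x₁, x₂, x₁₂)`; the empty bundle costs `0`. -/
def cost (x : Bid) : Bundle → ℝ
  | .empty => 0
  | .one => x.1
  | .two => x.2.1
  | .both => x.2.2

/-- All monotone valuations. -/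
def monotoneVals : Set Bid :=
  {x | 0 ≤ x.1 ∧ 0 ≤ x.2.1 ∧ x.1 ≤ x.2.2 ∧ x.2.1 ≤ x.2.2}

/-- All submodular (for two tasks: subadditive) monotone valuations. -/
def submodVals : Set Bid :=
  {x | x ∈ monotoneVals ∧ x.2.2 ≤ x.1 + x.2.1}

/-- All `ε`-additive monotone valuations. -/
def epsAddVals (ε : ℝ) : Set Bid :=
  {x | x ∈ monotoneVals ∧ x.2.2 ∈ Ioo (x.1 + x.2.1 - ε) (x.1 + x.2.1 + ε)}

/-- All additive valuations with both single-task costs in `[0, B)`. -/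
def boundedAddVals (B : ℝ) : Set Bid :=
  {x | x.1 ∈ Ico 0 B ∧ x.2.1 ∈ Ico 0 B ∧ x.2.2 = x.1 + x.2.1}

/-- The valuations in `D` for which every task has positive marginal cost:
`0 < x₁ < x₁₂` and `0 < x₂ < x₁₂`. For an additive valuation this says `x₁ > 0` and `x₂ > 0`. -/
def positivePart (D : Set Bid) : Set Bid :=
  {x | x ∈ D ∧ 0 < x.1 ∧ 0 < x.2.1 ∧ x.1 < x.2.2 ∧ x.2.1 < x.2.2}

/-- An allocation in which both tasks are always allocated: `A t s` is the bundle of the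
`t`-player, and the `s`-player receives `(A t s).compl`. Only its values on the domain under
consideration matter. -/
abbrev Allocation : Type := Bid → Bid → Bundle

/-- Weak monotonicity, for both players, on the domain `T × S`. -/
def IsWMON (T S : Set Bid) (A : Allocation) : Prop :=
  (∀ s ∈ S, ∀ t ∈ T, ∀ t' ∈ T,
    cost t (A t s) - cost t (A t' s) ≤ cost t' (A t s) - cost t' (A t' s)) ∧
  (∀ t ∈ T, ∀ s ∈ S, ∀ s' ∈ S,
    cost s (A t s).compl - cost s (A t s').compl ≤
      cost s' (A t s).compl - cost s' (A t s').compl)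

/-- The region `R_α(s)`: the interior, relative to `T`, of the set of all `t ∈ T` for which the
`t`-player receives `α`. -/
def region (T : Set Bid) (A : Allocation) (α : Bundle) (s : Bid) : Set Bid :=
  {t | t ∈ T ∧ ∀ᶠ t' in 𝓝[T] t, A t' s = α}

/-- Admissible additive constants of an affine minimizer. The constant of the empty bundle is
finite and no constant is `-∞`: otherwise the `t`-player could never receive the empty bundle, or
the minimization would be between equal infinite values. -/
def AdmissibleConstants (γ : Bundle → EReal) : Prop :=
  γ .empty ≠ ⊤ ∧ ∀ α, γ α ≠ ⊥

/-- The objective `μₜ t(α) + μₛ s(αᶜ) + γ_α`. -/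
noncomputable def affineCost (μt μs : ℝ) (γ : Bundle → EReal) (t s : Bid) (α : Bundle) : EReal :=
  ((μt * cost t α + μs * cost s α.compl : ℝ) : EReal) + γ α

/-- `α` minimizes the objective (ties are broken arbitrarily). -/
def MinimizesAffineCost (μt μs : ℝ) (γ : Bundle → EReal) (t s : Bid) (α : Bundle) : Prop :=
  ∀ β, affineCost μt μs γ t s α ≤ affineCost μt μs γ t s β

/-- Affine minimizers on `T × S`. -/
def IsAffineMinimizer (T S : Set Bid) (A : Allocation) : Prop :=
  ∃ (μt μs : ℝ) (γ : Bundle → EReal), 0 < μt ∧ 0 < μs ∧ AdmissibleConstants γ ∧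
    ∀ t ∈ T, ∀ s ∈ S, MinimizesAffineCost μt μs γ t s (A t s)

/-- For `ξ` increasing on `I`: the number `c` lies between the one-sided limits `ξ(x⁻)` and
`ξ(x⁺)`. So `c = ξ x` where `ξ` is continuous, and `c` has some freedom where `ξ` jumps. -/
def BetweenLimits (ξ : ℝ → ℝ) (I : Set ℝ) (x c : ℝ) : Prop :=
  (∀ y ∈ I, y < x → ξ y ≤ c) ∧ (∀ y ∈ I, x < y → c ≤ ξ y)

/-- For this `s`, only `∅` and `α` are allocated to the `t`-player, with critical value `c` for
`μ * t(α)`. -/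
def HasCriticalValue (T : Set Bid) (A : Allocation) (α : Bundle) (μ : ℝ) (s : Bid) (c : ℝ) :
    Prop :=
  ∀ t ∈ T, (A t s = .empty ∨ A t s = α) ∧
    (c < μ * cost t α → A t s = .empty) ∧ (μ * cost t α < c → A t s = α)

/-- Relaxed affine minimizers with a bundling tail on the nonempty interval `[0, D)`, where
`D = min(γ₁, γ₂) - γ_∅`. On the tail the critical value for `μₜ t₁₂` is given by an increasing
function `ξ` of `μₛ (s₁ + s₂)` with `ξ(D) = min(γ₁, γ₂) - γ₁₂`. Where `ξ` jumps (possibly at the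
end `D` of the tail, where `ξ(D)` is the upper limit), the critical value may depend on `s`. -/
def IsAffineMinimizerWithTail (T S : Set Bid) (A : Allocation) : Prop :=
  ∃ (μt μs : ℝ) (γ : Bundle → EReal) (D : ℝ) (ξ : ℝ → ℝ),
    0 < μt ∧ 0 < μs ∧ AdmissibleConstants γ ∧
    0 < D ∧ (D : EReal) = min (γ .one) (γ .two) - γ .empty ∧
    MonotoneOn ξ (Icc 0 D) ∧ (∀ x ∈ Icc 0 D, 0 ≤ ξ x) ∧
    ((ξ D : ℝ) : EReal) = min (γ .one) (γ .two) - γ .both ∧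
    (∀ s ∈ S, D < μs * (s.1 + s.2.1) →
      ∀ t ∈ T, MinimizesAffineCost μt μs γ t s (A t s)) ∧
    (∀ s ∈ S, μs * (s.1 + s.2.1) ≤ D →
      ∃ c, BetweenLimits ξ (Icc 0 D) (μs * (s.1 + s.2.1)) c ∧ c ≤ ξ D ∧
        HasCriticalValue T A .both μt s c)

/-- Relaxed affine minimizers: affine minimizers, possibly with a bundling tail. -/
def IsRelaxedAffineMinimizer (T S : Set Bid) (A : Allocation) : Prop :=
  IsAffineMinimizer T S A ∨ IsAffineMinimizerWithTail T S A

/-- One-dimensional mechanisms: the `t`-player only ever receives `∅` or one fixed bundle `α`, and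
the critical value for `t(α)` is given by an increasing nonnegative function `ξ` of `s(α)`; where
`ξ` jumps, the critical value may depend on `s`. For `α = {1, 2}` these are the bundling
mechanisms. -/
def IsOneDimensional (T S : Set Bid) (A : Allocation) : Prop :=
  ∃ (α : Bundle) (ξ : ℝ → ℝ), α ≠ .empty ∧
    MonotoneOn ξ ((fun s => cost s α) '' S) ∧
    (∀ x ∈ (fun s => cost s α) '' S, 0 ≤ ξ x) ∧
    ∀ s ∈ S, ∃ c, BetweenLimits ξ ((fun s => cost s α) '' S) (cost s α) c ∧
      HasCriticalValue T A α 1 s c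

/-- Constant mechanisms: up to the breaking of ties, the allocation does not depend on the bid of
the `s`-player, that is, it is an affine minimizer with multiplicative constant `0` for the
`s`-player. -/
def IsConstantMechanism (T S : Set Bid) (A : Allocation) : Prop :=
  ∃ (μt : ℝ) (γ : Bundle → EReal), 0 < μt ∧ AdmissibleConstants γ ∧
    ∀ t ∈ T, ∀ s ∈ S, MinimizesAffineCost μt 0 γ t s (A t s)

/-! For a fixed bid `s`, weak monotonicity of the `t`-player yields prices `(f₁, f₂, f₁₂)`, with
price `0` for `∅`, such that `A t s` minimizes cost minus price (`exists_isPrice`). A bid that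
receives `∅` keeps the defining suprema finite. The allocation is thereby encoded, up to ties, by
three functions of the additive bid `(x, y)`.

Weak monotonicity of the `s`-player turns every boundary between two regions into a monotonicity
(`criticalValues_of_isPrice`): `f₁` increases with `x` and `f₂` with `y` (boundaries of `∅` with `1`
and `2`), `f₁₂ - f₂` with `x` and `f₁₂ - f₁` with `y` (boundaries of `12` with `2` and `1`), `f₁₂`
with `x + y` (`∅` and `12`), and `f₁ - f₂` with `x - y` (`1` and `2`). The last four hold only where
the domain meets the boundary.

Linearity comes from the last two, which compare increments of a function of `x` with increments of
a function of `y`. A monotone function is differentiable somewhere, and the comparison carries its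
slope at that single point to all points of both functions (`exists_common_slope`).

If `f₁₂ < f₁ + f₂` with a uniform gap on some rectangle, the boundary of `1` and `2` makes `f₁` and
`f₂` affine with a common slope; the gap spreads to all bids at which both prices are positive, and
the marginal prices determine `f₁₂` (`exists_agreesAt_of_gap`). Otherwise `f₁₂ ≥ f₁ + f₂` up to
small errors on a dense set; the thickness `ε` of the domain absorbs the errors, and the boundary of
`∅` and `12` makes `f₁₂ - f₂` and `f₂` affine with a common slope on the strip where `f₂ > 0`
(`exists_stripData`). Off the strips only `∅` and `12` remain, and `f₁₂` is compared with strip bids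
of nearly the same sum `x + y`. Sums too small to occur on a strip may leave `f₁₂` undetermined:
this is the bundling tail. If no such pair of functions can be compared, at most one nonempty bundle
is allocated to positive bids. Slope `0` gives the constant mechanisms. -/

/-! ### Affine functions on intervals -/

theorem le_affine_of_forall_right {l c x b w : ℝ} (hx : x < b)
    (h : ∀ z ∈ Ioo x b, w ≤ l * z + c) : w ≤ l * x + c := by
  have hc : Filter.Tendsto (fun z => l * z + c) (𝓝[>] x) (𝓝 (l * x + c)) := by
    apply Filter.Tendsto.mono_left _ nhdsWithin_le_nhds
    exact Continuous.tendsto (by fun_prop) x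
  refine ge_of_tendsto hc ?_
  filter_upwards [Ioo_mem_nhdsGT hx] with z hz using h z hz

theorem le_affine_of_forall_left {l c x a w : ℝ} (hx : a < x)
    (h : ∀ z ∈ Ioo a x, w ≤ l * z + c) : w ≤ l * x + c := by
  have hc : Filter.Tendsto (fun z => l * z + c) (𝓝[<] x) (𝓝 (l * x + c)) := by
    apply Filter.Tendsto.mono_left _ nhdsWithin_le_nhds
    exact Continuous.tendsto (by fun_prop) x
  refine ge_of_tendsto hc ?_
  filter_upwards [Ioo_mem_nhdsLT hx] with z hz using h z hz

theorem affine_le_of_forall_left {l c x a w : ℝ} (hx : a < x)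
    (h : ∀ z ∈ Ioo a x, l * z + c ≤ w) : l * x + c ≤ w := by
  have := le_affine_of_forall_left (l := -l) (c := -c) (w := -w) hx
    (fun z hz => by have := h z hz; linarith)
  linarith

theorem affine_unique {l c l' c' a b : ℝ} (hab : a < b)
    (h : ∀ x ∈ Ioo a b, l * x + c = l' * x + c') : l = l' ∧ c = c' := by
  have h1 := h (a + (b - a) / 3) ⟨by linarith, by linarith⟩
  have h2 := h (a + 2 * (b - a) / 3) ⟨by linarith, by linarith⟩
  have h3 : (l - l') * ((b - a) / 3) = 0 := by linarith
  have h4 : l - l' = 0 := by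
    rcases mul_eq_zero.1 h3 with h | h
    · exact h
    · linarith
  have h5 : l = l' := by linarith
  subst h5
  exact ⟨rfl, by linarith⟩

/-- A positive number below two given positive numbers whose product with `l` is small. -/
theorem exists_small {l e : ℝ} (he : 0 < e) (hl : 0 ≤ l) (m : ℝ) (hm : 0 < m) :
    ∃ h, 0 < h ∧ h < m ∧ l * h < e := by
  refine ⟨min (m / 2) (e / (l + 1) / 2), by positivity, ?_, ?_⟩
  · exact (min_le_left _ _).trans_lt (by linarith)
  · have h1 : min (m / 2) (e / (l + 1) / 2) ≤ e / (l + 1) / 2 := min_le_right _ _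
    have h2 : (l + 1) * (e / (l + 1)) = e := by field_simp
    have h3 : 0 < e / (l + 1) := by positivity
    nlinarith

/-- The hypothesis forces `θ z - l * z` to have derivative `0` everywhere on the interval. -/
theorem affine_of_uniform_slope {a b l : ℝ} {θ : ℝ → ℝ}
    (h : ∀ η > 0, ∃ δ > 0, ∀ y ∈ Ioo a b, ∀ y' ∈ Ioo a b, y < y' → y' - y < δ →
      |θ y' - θ y - l * (y' - y)| ≤ η * (y' - y)) :
    ∃ c, ∀ y ∈ Ioo a b, θ y = l * y + c := by
  have hd : ∀ y ∈ Ioo a b, HasDerivAt (fun z => θ z - l * z) 0 y := by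
    intro y hy
    rw [hasDerivAt_iff_isLittleO, Asymptotics.isLittleO_iff]
    intro η hη
    obtain ⟨δ, hδ, H⟩ := h η hη
    filter_upwards [Ioo_mem_nhds hy.1 hy.2,
      Ioo_mem_nhds (show y - δ < y by linarith) (show y < y + δ by linarith)] with z hz hz'
    simp only [smul_zero, sub_zero, Real.norm_eq_abs]
    rcases lt_trichotomy y z with hyz | rfl | hyz
    · have := H y hy z hz hyz (by linarith [hz'.2])
      rw [abs_of_pos (sub_pos.2 hyz)]
      convert this using 2
      ring
    · simp
    · have := H z hz y hy hyz (by linarith [hz'.1])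
      rw [abs_sub_comm z y, abs_of_pos (sub_pos.2 hyz), abs_sub_comm]
      convert this using 2
      ring
  obtain ⟨c, hc⟩ := IsOpen.exists_is_const_of_deriv_eq_zero isOpen_Ioo isPreconnected_Ioo
    (fun y hy => (hd y hy).differentiableAt.differentiableWithinAt) (fun y hy => (hd y hy).deriv)
  exact ⟨c, fun y hy => by have := hc y hy; linarith⟩

/-- A monotone function is differentiable almost everywhere, and the interval has positive measure.
-/
theorem MonotoneOn.exists_hasDerivAt_Ioo {a b : ℝ} (hab : a < b) {φ : ℝ → ℝ}
    (hφ : MonotoneOn φ (Ioo a b)) : ∃ x ∈ Ioo a b, ∃ l, HasDerivAt φ l x := by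
  have h := hφ.ae_differentiableWithinAt measurableSet_Ioo
  rw [MeasureTheory.ae_restrict_iff' measurableSet_Ioo] at h
  have hne : MeasureTheory.volume (Ioo a b) ≠ 0 := by
    simp [hab]
  obtain ⟨x, hx, hx'⟩ : ∃ x ∈ Ioo a b, DifferentiableWithinAt ℝ φ (Ioo a b) x := by
    by_contra hcon
    push Not at hcon
    apply hne
    refine MeasureTheory.measure_mono_null ?_ h
    intro x hx hx'
    exact hcon x hx (hx' hx)
  exact ⟨x, hx, _, (hx'.differentiableAt (Ioo_mem_nhds hx.1 hx.2)).hasDerivAt⟩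

/-- Two monotone functions whose small increments over intervals of comparable length compare are
affine with the same slope. -/
theorem exists_common_slope {a b c d κ : ℝ} (hab : a < b) (hcd : c < d) (hκ : 0 < κ)
    {φ ψ : ℝ → ℝ} (hφ : MonotoneOn φ (Ioo a b))
    (h₁ : ∀ x ∈ Ioo a b, ∀ x' ∈ Ioo a b, ∀ y ∈ Ioo c d, ∀ y' ∈ Ioo c d, x < x' →
      x' - x < y' - y → ψ y' - ψ y < κ → φ x' - φ x ≤ ψ y' - ψ y)
    (h₂ : ∀ x ∈ Ioo a b, ∀ x' ∈ Ioo a b, ∀ y ∈ Ioo c d, ∀ y' ∈ Ioo c d, y < y' →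
      y' - y < x' - x → φ x' - φ x < κ → ψ y' - ψ y ≤ φ x' - φ x) :
    ∃ l : ℝ, 0 ≤ l ∧ ∃ c₁ c₂, (∀ x ∈ Ioo a b, φ x = l * x + c₁) ∧
      ∀ y ∈ Ioo c d, ψ y = l * y + c₂ := by
  -- The increments of `φ` at this one point control all short increments of `ψ`, and these in turn
  -- control all short increments of `φ`.
  obtain ⟨x₀, hx₀, l, hl⟩ := hφ.exists_hasDerivAt_Ioo hab
  have E : ∀ η > 0, ∃ δ > 0, ∀ h, 0 < h → h < δ → x₀ + h ∈ Ioo a b ∧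
      |φ (x₀ + h) - φ x₀ - l * h| ≤ η * h := by
    intro η hη
    rw [hasDerivAt_iff_isLittleO, Asymptotics.isLittleO_iff] at hl
    obtain ⟨δ, hδ, H⟩ := Metric.eventually_nhds_iff.1 (hl hη)
    refine ⟨min δ (b - x₀), lt_min hδ (by linarith [hx₀.2]), fun h h0 hh => ?_⟩
    have h3 := hh.trans_le (min_le_left _ _)
    have h4 := hh.trans_le (min_le_right _ _)
    refine ⟨⟨by linarith [hx₀.1], by linarith⟩, ?_⟩
    have := H (y := x₀ + h) (by simpa [abs_of_pos h0] using h3)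
    simp only [add_sub_cancel_left, smul_eq_mul, Real.norm_eq_abs, abs_of_pos h0] at this
    rwa [mul_comm l h]
  obtain ⟨δ₀, hδ₀, E₀⟩ := E 1 one_pos
  obtain ⟨δ₁, hδ₁, hδ₁₀, hδ₁κ⟩ := exists_small hκ (show 0 ≤ |l| + 1 by positivity) δ₀ hδ₀
  have small : ∀ h, 0 < h → h < δ₁ → φ (x₀ + h) - φ x₀ < κ := by
    intro h h0 hh
    have h1 := (abs_le.1 (E₀ h h0 (by linarith)).2).2
    have h2 : l * h ≤ |l| * h := mul_le_mul_of_nonneg_right (le_abs_self l) h0.le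
    have h3 : (|l| + 1) * h ≤ (|l| + 1) * δ₁ := by gcongr
    linarith
  obtain ⟨c₂, hc₂⟩ : ∃ c₂, ∀ y ∈ Ioo c d, ψ y = l * y + c₂ := by
    apply affine_of_uniform_slope
    intro η hη
    obtain ⟨δ, hδ, Eη⟩ := E η hη
    refine ⟨min δ δ₁, lt_min hδ hδ₁, fun y hy y' hy' hyy' hlt => ?_⟩
    have hlδ := hlt.trans_le (min_le_left _ _)
    have hlδ₁ := hlt.trans_le (min_le_right _ _)
    have up : ∀ h ∈ Ioo (y' - y) (min δ δ₁), ψ y' - ψ y ≤ φ (x₀ + h) - φ x₀ := by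
      intro h hh
      have hh1 := hh.2.trans_le (min_le_left _ _)
      have hh2 := hh.2.trans_le (min_le_right _ _)
      have h0 : 0 < h := by linarith [hh.1]
      exact h₂ x₀ hx₀ (x₀ + h) (Eη h h0 hh1).1 y hy y' hy' hyy' (by linarith [hh.1])
        (small h h0 hh2)
    rw [abs_le]
    constructor
    · have : (l - η) * (y' - y) + 0 ≤ ψ y' - ψ y := by
        apply affine_le_of_forall_left (sub_pos.2 hyy')
        intro h hh
        have hE := Eη h hh.1 (by linarith [hh.2])
        have h1 := (abs_le.1 hE.2).1
        have hm : (y' - y + min δ δ₁) / 2 ∈ Ioo (y' - y) (min δ δ₁) :=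
          ⟨by linarith, by linarith⟩
        -- The side condition of `h₁` on `ψ` comes from the upper bound `up`, at a length where the
        -- increment of `φ` is already below `κ`.
        have hκ' : ψ y' - ψ y < κ := (up _ hm).trans_lt
          (small _ (by linarith [hm.1]) (hm.2.trans_le (min_le_right _ _)))
        have h2 := h₁ x₀ hx₀ (x₀ + h) hE.1 y hy y' hy' (by linarith [hh.1]) (by linarith [hh.2])
          hκ'
        linarith
      linarith
    · have : ψ y' - ψ y ≤ (l + η) * (y' - y) + 0 := by
        apply le_affine_of_forall_right hlt
        intro h hh
        have hE := Eη h (by linarith [hh.1]) (hh.2.trans_le (min_le_left _ _))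
        have h1 := (abs_le.1 hE.2).2
        have h2 := up h hh
        linarith
      linarith
  obtain ⟨c₁, hc₁⟩ : ∃ c₁, ∀ x ∈ Ioo a b, φ x = l * x + c₁ := by
    apply affine_of_uniform_slope
    intro η hη
    obtain ⟨δ, hδ, hδd, hδκ⟩ := exists_small hκ (abs_nonneg l) ((d - c) / 2) (by linarith)
    refine ⟨δ, hδ, fun x hx x' hx' hxx' hlt => ?_⟩
    have key : ∀ h, 0 < h → h ≤ δ → ∃ y ∈ Ioo c d, ∃ y' ∈ Ioo c d, y < y' ∧ y' - y = h ∧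
        ψ y' - ψ y = l * h ∧ l * h < κ := by
      intro h h0 hh
      have h1 : (c + d) / 2 - h / 2 ∈ Ioo c d := ⟨by linarith, by linarith⟩
      have h2 : (c + d) / 2 + h / 2 ∈ Ioo c d := ⟨by linarith, by linarith⟩
      refine ⟨_, h1, _, h2, by linarith, by ring, by rw [hc₂ _ h1, hc₂ _ h2]; ring, ?_⟩
      have h3 : l * h ≤ |l| * h := mul_le_mul_of_nonneg_right (le_abs_self l) h0.le
      have h4 : |l| * h ≤ |l| * δ := by gcongr
      linarith
    have up : φ x' - φ x ≤ l * (x' - x) + 0 := by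
      apply le_affine_of_forall_right hlt
      intro h hh
      obtain ⟨y, hy, y', hy', hyy', hyh, hψ, hlk⟩ := key h (by linarith [hh.1]) hh.2.le
      have := h₁ x hx x' hx' y hy y' hy' hxx' (by linarith [hh.1]) (by linarith)
      linarith
    have lo : l * (x' - x) + 0 ≤ φ x' - φ x := by
      apply affine_le_of_forall_left (sub_pos.2 hxx')
      intro h hh
      obtain ⟨y, hy, y', hy', hyy', hyh, hψ, hlk⟩ := key h hh.1 (by linarith [hh.2])
      obtain ⟨-, -, -, -, -, -, -, hlk'⟩ := key (x' - x) (by linarith) hlt.le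
      have := h₂ x hx x' hx' y hy y' hy' hyy' (by linarith [hh.2]) (by linarith)
      linarith
    rw [show φ x' - φ x - l * (x' - x) = 0 by linarith, abs_zero]
    exact mul_nonneg hη.le (by linarith)
  refine ⟨l, ?_, c₁, c₂, hc₁, hc₂⟩
  have m1 : a + (b - a) / 3 ∈ Ioo a b := ⟨by linarith, by linarith⟩
  have m2 : a + 2 * (b - a) / 3 ∈ Ioo a b := ⟨by linarith, by linarith⟩
  have := hφ m1 m2 (by linarith)
  rw [hc₁ _ m1, hc₁ _ m2] at this
  by_contra hneg
  push Not at hneg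
  nlinarith

/-- The two-variable form: `u` depends essentially on the first and `v` on the second
coordinate. -/
theorem exists_common_slope₂ {a b c d κ : ℝ} (hab : a < b) (hcd : c < d) (hκ : 0 < κ)
    {u v : ℝ → ℝ → ℝ}
    (hu : ∀ x ∈ Ioo a b, ∀ y ∈ Ioo c d, ∀ x' ∈ Ioo a b, ∀ y' ∈ Ioo c d, x < x' →
      u x y ≤ u x' y')
    (hv : ∀ x ∈ Ioo a b, ∀ y ∈ Ioo c d, ∀ x' ∈ Ioo a b, ∀ y' ∈ Ioo c d, y < y' →
      v x y ≤ v x' y')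
    (h₁ : ∀ p ∈ Ioo a b, ∀ q ∈ Ioo c d, ∀ x ∈ Ioo a b, ∀ x' ∈ Ioo a b, ∀ y ∈ Ioo c d,
      ∀ y' ∈ Ioo c d, x < x' → x' - x < y' - y → v p y' - v p y < κ →
        u x' q - u x q ≤ v p y' - v p y)
    (h₂ : ∀ p ∈ Ioo a b, ∀ q ∈ Ioo c d, ∀ x ∈ Ioo a b, ∀ x' ∈ Ioo a b, ∀ y ∈ Ioo c d,
      ∀ y' ∈ Ioo c d, y < y' → y' - y < x' - x → u x' q - u x q < κ →
        v p y' - v p y ≤ u x' q - u x q) :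
    ∃ l : ℝ, 0 ≤ l ∧ ∃ c₁ c₂, ∀ x ∈ Ioo a b, ∀ y ∈ Ioo c d,
      u x y = l * x + c₁ ∧ v x y = l * y + c₂ := by
  have hp : (a + b) / 2 ∈ Ioo a b := ⟨by linarith, by linarith⟩
  have hq : (c + d) / 2 ∈ Ioo c d := ⟨by linarith, by linarith⟩
  obtain ⟨l, hl, c₁, c₂, hc₁, hc₂⟩ := exists_common_slope (φ := fun x => u x ((c + d) / 2))
    (ψ := fun y => v ((a + b) / 2) y) hab hcd hκ
    (fun x hx x' hx' hxx' => by
      rcases hxx'.eq_or_lt with rfl | h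
      · exact le_rfl
      · exact hu _ hx _ hq _ hx' _ hq h)
    (h₁ _ hp _ hq) (h₂ _ hp _ hq)
  -- By `hu` and `hv`, values off the central slices are squeezed between slice values at
  -- neighbouring points; the slices are continuous.
  refine ⟨l, hl, c₁, c₂, fun x hx y hy => ⟨le_antisymm ?_ ?_, le_antisymm ?_ ?_⟩⟩
  · refine le_affine_of_forall_right hx.2 fun z hz => ?_
    have hz' : z ∈ Ioo a b := ⟨hx.1.trans hz.1, hz.2⟩
    exact hc₁ z hz' ▸ hu x hx y hy z hz' _ hq hz.1
  · refine affine_le_of_forall_left hx.1 fun z hz => ?_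
    have hz' : z ∈ Ioo a b := ⟨hz.1, hz.2.trans hx.2⟩
    exact hc₁ z hz' ▸ hu z hz' _ hq x hx y hy hz.2
  · refine le_affine_of_forall_right hy.2 fun z hz => ?_
    have hz' : z ∈ Ioo c d := ⟨hy.1.trans hz.1, hz.2⟩
    exact hc₂ z hz' ▸ hv x hx y hy _ hp z hz' hz.1
  · refine affine_le_of_forall_left hy.1 fun z hz => ?_
    have hz' : z ∈ Ioo c d := ⟨hz.1, hz.2.trans hy.2⟩
    exact hc₂ z hz' ▸ hv _ hp z hz' x hx y hy hz.2

/-! ### Critical values as functions of the additive bid -/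

/-- The monotonicity properties of the critical values `f₁, f₂, f₁₂` for the bundles of the
`t`-player, as functions of the additive bid `(x, y)` of the `s`-player. -/
structure CriticalValues (B ε : ℝ) (f₁ f₂ f₁₂ : ℝ → ℝ → ℝ) : Prop where
  B_pos : 0 < B
  ε_pos : 0 < ε
  nonneg₁ : ∀ x ∈ Ioo 0 B, ∀ y ∈ Ioo 0 B, 0 ≤ f₁ x y
  nonneg₂ : ∀ x ∈ Ioo 0 B, ∀ y ∈ Ioo 0 B, 0 ≤ f₂ x y
  le₁ : ∀ x ∈ Ioo 0 B, ∀ y ∈ Ioo 0 B, f₁ x y ≤ f₁₂ x y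
  le₂ : ∀ x ∈ Ioo 0 B, ∀ y ∈ Ioo 0 B, f₂ x y ≤ f₁₂ x y
  mono₁ : ∀ x ∈ Ioo 0 B, ∀ y ∈ Ioo 0 B, ∀ x' ∈ Ioo 0 B, ∀ y' ∈ Ioo 0 B, x < x' →
    f₁ x y ≤ f₁ x' y'
  mono₂ : ∀ x ∈ Ioo 0 B, ∀ y ∈ Ioo 0 B, ∀ x' ∈ Ioo 0 B, ∀ y' ∈ Ioo 0 B, y < y' →
    f₂ x y ≤ f₂ x' y'
  -- The side conditions provide bids with a small cost of the other task on both sides of the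
  -- boundary.
  marginal₁ : ∀ x ∈ Ioo 0 B, ∀ y ∈ Ioo 0 B, ∀ x' ∈ Ioo 0 B, ∀ y' ∈ Ioo 0 B, x < x' →
    f₁ x y < f₁₂ x y → 0 < f₂ x' y' → f₁₂ x y - f₂ x y ≤ f₁₂ x' y' - f₂ x' y'
  marginal₂ : ∀ x ∈ Ioo 0 B, ∀ y ∈ Ioo 0 B, ∀ x' ∈ Ioo 0 B, ∀ y' ∈ Ioo 0 B, y < y' →
    f₂ x y < f₁₂ x y → 0 < f₁ x' y' → f₁₂ x y - f₁ x y ≤ f₁₂ x' y' - f₁ x' y'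
  -- The bounds with `ε` provide a bid of excess in `[0, ε)` that receives `12` at `(x, y)` and `∅`
  -- at `(x', y')` if the conclusion fails. Such bids lie in all four domains.
  mono₁₂ : ∀ x ∈ Ioo 0 B, ∀ y ∈ Ioo 0 B, ∀ x' ∈ Ioo 0 B, ∀ y' ∈ Ioo 0 B, x + y < x' + y' →
    f₁ x y < f₁₂ x y → f₂ x y < f₁₂ x y →
    f₁ x' y' + f₂ x y < f₁₂ x y + ε → f₂ x' y' + f₁ x y < f₁₂ x y + ε →
    f₁ x y + f₂ x y < f₁₂ x y + ε → f₁ x' y' + f₂ x' y' < f₁₂ x' y' + ε →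
    f₁₂ x y ≤ f₁₂ x' y'
  -- The side conditions make a rectangle of additive bids meet a strip of cost differences, as in
  -- `exists_diff_mem`.
  diff : ∀ x ∈ Ioo 0 B, ∀ y ∈ Ioo 0 B, ∀ x' ∈ Ioo 0 B, ∀ y' ∈ Ioo 0 B, y' - x' < y - x →
    f₁₂ x y - f₁ x y < f₂ x' y' → f₁₂ x' y' - f₂ x' y' < f₁ x y →
    f₁₂ x' y' - f₂ x' y' - f₂ x' y' < f₁ x y - f₂ x y →
    f₁ x' y' - f₂ x' y' < f₁ x y - (f₁₂ x y - f₁ x y) →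
    f₁ x y - f₂ x y ≤ f₁ x' y' - f₂ x' y'

theorem CriticalValues.swap {B ε : ℝ} {f₁ f₂ f₁₂ : ℝ → ℝ → ℝ}
    (h : CriticalValues B ε f₁ f₂ f₁₂) :
    CriticalValues B ε (fun x y => f₂ y x) (fun x y => f₁ y x) (fun x y => f₁₂ y x) where
  B_pos := h.B_pos
  ε_pos := h.ε_pos
  nonneg₁ x hx y hy := h.nonneg₂ y hy x hx
  nonneg₂ x hx y hy := h.nonneg₁ y hy x hx
  le₁ x hx y hy := h.le₂ y hy x hx
  le₂ x hx y hy := h.le₁ y hy x hx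
  mono₁ x hx y hy x' hx' y' hy' := h.mono₂ y hy x hx y' hy' x' hx'
  mono₂ x hx y hy x' hx' y' hy' := h.mono₁ y hy x hx y' hy' x' hx'
  marginal₁ x hx y hy x' hx' y' hy' := h.marginal₂ y hy x hx y' hy' x' hx'
  marginal₂ x hx y hy x' hx' y' hy' := h.marginal₁ y hy x hx y' hy' x' hx'
  mono₁₂ x hx y hy x' hx' y' hy' h0 h1 h2 h3 h4 h5 h6 :=
    h.mono₁₂ y hy x hx y' hy' x' hx' (by linarith) h2 h1 h4 h3 (by linarith) (by linarith)
  diff x hx y hy x' hx' y' hy' h0 h1 h2 h3 h4 := by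
    have := h.diff y' hy' x' hx' y hy x hx (by linarith) h2 h1 (by linarith) (by linarith)
    linarith

/-- `f` equals `z + c` where the bundle is active, and is never below it; if there is no constant
(`o = none`) the bundle is never active. -/
def Agrees (o : Option ℝ) (z f : ℝ) (active : Prop) : Prop :=
  (active → ∃ c ∈ o, f = z + c) ∧ ∀ c ∈ o, z + c ≤ f

/-- At `(x, y)` the critical values are those of an affine minimizer. -/
def AgreesAt (l : ℝ) (o₁ o₂ o₁₂ : Option ℝ) (f₁ f₂ f₁₂ : ℝ → ℝ → ℝ) (x y : ℝ) : Prop :=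
  Agrees o₁ (l * x) (f₁ x y) (0 < f₁ x y) ∧ Agrees o₂ (l * y) (f₂ x y) (0 < f₂ x y) ∧
    Agrees o₁₂ (l * (x + y)) (f₁₂ x y) (f₁ x y < f₁₂ x y ∧ f₂ x y < f₁₂ x y)

theorem agreesAt_swap {l : ℝ} {o₁ o₂ o₁₂ : Option ℝ} {f₁ f₂ f₁₂ : ℝ → ℝ → ℝ} {x y : ℝ}
    (h : AgreesAt l o₁ o₂ o₁₂ (fun x y => f₂ y x) (fun x y => f₁ y x) (fun x y => f₁₂ y x) y x) :
    AgreesAt l o₂ o₁ o₁₂ f₁ f₂ f₁₂ x y := by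
  obtain ⟨h1, h2, h3⟩ := h
  refine ⟨h2, h1, ?_, ?_⟩
  · rintro ⟨h4, h5⟩
    rw [add_comm x y]
    exact h3.1 ⟨h5, h4⟩
  · rw [add_comm x y]
    exact h3.2

/-- The threshold is the same for every `y` because the hypothesis compares arbitrary second
coordinates. Inserting `B` covers the case in which `P` never holds. -/
theorem exists_threshold {a B c d : ℝ} (haB : a ≤ B) {P : ℝ → ℝ → Prop}
    (h : ∀ x ∈ Ioo a B, ∀ y ∈ Ioo c d, ∀ x' ∈ Ioo a B, ∀ y' ∈ Ioo c d, x < x' →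
      P x y → P x' y') :
    ∃ p ∈ Icc a B, ∀ x ∈ Ioo a B, ∀ y ∈ Ioo c d, (x < p → ¬ P x y) ∧ (p < x → P x y) := by
  set S : Set ℝ := insert B {x | x ∈ Ioo a B ∧ ∃ y ∈ Ioo c d, P x y}
  have hbd : a ∈ lowerBounds S := by
    rintro x (rfl | ⟨hx, -⟩)
    · exact haB
    · exact hx.1.le
  refine ⟨sInf S, ⟨le_csInf ⟨B, mem_insert _ _⟩ hbd, csInf_le ⟨a, hbd⟩ (mem_insert _ _)⟩,
    fun x hx y hy => ⟨fun hlt hP => ?_, fun hlt => ?_⟩⟩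
  · exact absurd (csInf_le ⟨a, hbd⟩ (mem_insert_of_mem _ ⟨hx, y, hy, hP⟩)) (not_le.2 hlt)
  · obtain ⟨z, hz, hzx⟩ := exists_lt_of_csInf_lt ⟨B, mem_insert _ _⟩ hlt
    rcases hz with rfl | ⟨hz, w, hw, hP⟩
    · exact absurd hx.2 (not_lt.2 hzx.le)
    · exact h z hz w hw x hx y hy hzx hP

namespace CriticalValues

variable {B ε : ℝ} {f₁ f₂ f₁₂ : ℝ → ℝ → ℝ}

theorem exists_threshold₁ (h : CriticalValues B ε f₁ f₂ f₁₂) :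
    ∃ a ∈ Icc 0 B, ∀ x ∈ Ioo 0 B, ∀ y ∈ Ioo 0 B, (x < a → f₁ x y = 0) ∧ (a < x → 0 < f₁ x y) := by
  obtain ⟨a, ha, H⟩ := exists_threshold (P := fun x y => 0 < f₁ x y) (c := 0) (d := B) h.B_pos.le
    (fun x hx y hy x' hx' y' hy' hlt hP => hP.trans_le (h.mono₁ x hx y hy x' hx' y' hy' hlt))
  refine ⟨a, ha, fun x hx y hy => ⟨fun hlt => ?_, (H x hx y hy).2⟩⟩
  exact le_antisymm (not_lt.1 ((H x hx y hy).1 hlt)) (h.nonneg₁ x hx y hy)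

theorem exists_threshold₂ (h : CriticalValues B ε f₁ f₂ f₁₂) :
    ∃ a ∈ Icc 0 B, ∀ x ∈ Ioo 0 B, ∀ y ∈ Ioo 0 B, (y < a → f₂ x y = 0) ∧ (a < y → 0 < f₂ x y) := by
  obtain ⟨a, ha, H⟩ := h.swap.exists_threshold₁
  exact ⟨a, ha, fun x hx y hy => H y hy x hx⟩

/-- `mono₁` ignores the second coordinate, so `f₁ x y` is squeezed between values at neighbouring
first coordinates inside the rectangle. -/
theorem extend_affine₁ (h : CriticalValues B ε f₁ f₂ f₁₂) {p q r s l c : ℝ} (hp : 0 ≤ p)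
    (hq : q ≤ B) (hr : 0 ≤ r) (hs : s ≤ B) (hrs : r < s)
    (hf : ∀ x ∈ Ioo p q, ∀ y ∈ Ioo r s, f₁ x y = l * x + c) :
    ∀ x ∈ Ioo p q, ∀ y ∈ Ioo 0 B, f₁ x y = l * x + c := by
  intro x hx y hy
  have hx' : x ∈ Ioo 0 B := ⟨by linarith [hx.1], by linarith [hx.2]⟩
  have hm : (r + s) / 2 ∈ Ioo r s := ⟨by linarith, by linarith⟩
  have hm' : (r + s) / 2 ∈ Ioo 0 B := ⟨by linarith [hm.1], by linarith [hm.2]⟩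
  apply le_antisymm
  · refine le_affine_of_forall_right hx.2 fun z hz => ?_
    rw [← hf z ⟨hx.1.trans hz.1, hz.2⟩ _ hm]
    exact h.mono₁ x hx' y hy z ⟨hx'.1.trans hz.1, by linarith [hz.2]⟩ _ hm' hz.1
  · refine affine_le_of_forall_left hx.1 fun z hz => ?_
    rw [← hf z ⟨hz.1, hz.2.trans hx.2⟩ _ hm]
    exact h.mono₁ z ⟨by linarith [hz.1], hz.2.trans hx'.2⟩ _ hm' x hx' y hy hz.2

theorem extend_affine₂ (h : CriticalValues B ε f₁ f₂ f₁₂) {p q r s l c : ℝ} (hp : 0 ≤ p)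
    (hq : q ≤ B) (hr : 0 ≤ r) (hs : s ≤ B) (hpq : p < q)
    (hf : ∀ x ∈ Ioo p q, ∀ y ∈ Ioo r s, f₂ x y = l * y + c) :
    ∀ x ∈ Ioo 0 B, ∀ y ∈ Ioo r s, f₂ x y = l * y + c :=
  fun x hx y hy => h.swap.extend_affine₁ hr hs hp hq hpq (fun y hy x hx => hf x hx y hy) y hy x hx

/-! ### The case in which the bundles `1` and `2` compete -/

/-- As `y - x < y' - x'`, `diff` says that `f₁ - f₂` is at most as large at `(x', y')` as at `(x,
y)`. The gap `κ` provides its side conditions. -/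
theorem increments_of_gap (h : CriticalValues B ε f₁ f₂ f₁₂) {p q r s κ : ℝ} (hp : 0 ≤ p)
    (hq : q ≤ B) (hr : 0 ≤ r) (hs : s ≤ B) (hκ₀ : 0 < κ)
    (hk : ∀ x ∈ Ioo p q, ∀ y ∈ Ioo r s, f₁₂ x y + κ ≤ f₁ x y + f₂ x y) :
    ∀ w ∈ Ioo p q, ∀ z ∈ Ioo r s, ∀ x ∈ Ioo p q, ∀ x' ∈ Ioo p q, ∀ y ∈ Ioo r s,
      ∀ y' ∈ Ioo r s, x < x' → x' - x < y' - y → f₂ w y' - f₂ w y < κ →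
        f₁ x' z - f₁ x z ≤ f₂ w y' - f₂ w y := by
  intro w hw z hz x hx x' hx' y hy y' hy' hxx' hlt hκ
  have QX : ∀ {x}, x ∈ Ioo p q → x ∈ Ioo 0 B :=
    fun hx => ⟨by linarith [hx.1], by linarith [hx.2]⟩
  have QY : ∀ {y}, y ∈ Ioo r s → y ∈ Ioo 0 B :=
    fun hx => ⟨by linarith [hx.1], by linarith [hx.2]⟩
  -- Shifting the points by `δ` makes the coordinates strictly comparable, so that the values at
  -- height `z` and abscissa `w` can be inserted.
  obtain ⟨δ, hδ, hδ'⟩ := exists_between (show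
    0 < min (y' - y - (x' - x)) (min (q - x') (x - p)) / 4 from
      div_pos (lt_min (by linarith) (lt_min (by linarith [hx'.2]) (by linarith [hx.1])))
        (by norm_num))
  have d1 := min_le_left (y' - y - (x' - x)) (min (q - x') (x - p))
  have d2 := (min_le_right (y' - y - (x' - x)) (min (q - x') (x - p))).trans (min_le_left _ _)
  have d3 := (min_le_right (y' - y - (x' - x)) (min (q - x') (x - p))).trans (min_le_right _ _)
  have X' : x' + δ ∈ Ioo p q := ⟨by linarith [hx'.1], by linarith⟩
  have X : x - δ ∈ Ioo p q := ⟨by linarith, by linarith [hx.2]⟩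
  have Y' : y' - δ ∈ Ioo r s := ⟨by linarith [hy.1], by linarith [hy'.2]⟩
  have Y : y + δ ∈ Ioo r s := ⟨by linarith [hy.1], by linarith [hy'.2]⟩
  have k' := hk _ X' _ Y'
  have k := hk _ X _ Y
  have m1 := h.mono₁ _ (QX hx') _ (QY hz) _ (QX X') _ (QY Y') (by linarith)
  have m2 := h.mono₁ _ (QX X) _ (QY Y) _ (QX hx) _ (QY hz) (by linarith)
  have m3 := h.mono₂ _ (QX X') _ (QY Y') _ (QX hw) _ (QY hy') (by linarith)
  have m4 := h.mono₂ _ (QX hw) _ (QY hy) _ (QX X) _ (QY Y) (by linarith)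
  have m5 := h.mono₁ _ (QX X) _ (QY Y) _ (QX X') _ (QY Y') (by linarith)
  have := h.diff _ (QX X') _ (QY Y') _ (QX X) _ (QY Y) (by linarith) (by linarith) (by linarith)
    (by linarith) (by linarith)
  linarith

theorem affine_of_gap (h : CriticalValues B ε f₁ f₂ f₁₂) {p q r s κ : ℝ} (hp : 0 ≤ p)
    (hpq : p < q) (hq : q ≤ B) (hr : 0 ≤ r) (hrs : r < s) (hs : s ≤ B) (hκ : 0 < κ)
    (hk : ∀ x ∈ Ioo p q, ∀ y ∈ Ioo r s, f₁₂ x y + κ ≤ f₁ x y + f₂ x y) :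
    ∃ l : ℝ, 0 ≤ l ∧ ∃ c₁ c₂, (∀ x ∈ Ioo p q, ∀ y ∈ Ioo 0 B, f₁ x y = l * x + c₁) ∧
      ∀ x ∈ Ioo 0 B, ∀ y ∈ Ioo r s, f₂ x y = l * y + c₂ := by
  have QX : ∀ {x}, x ∈ Ioo p q → x ∈ Ioo 0 B :=
    fun hx => ⟨by linarith [hx.1], by linarith [hx.2]⟩
  have QY : ∀ {y}, y ∈ Ioo r s → y ∈ Ioo 0 B :=
    fun hx => ⟨by linarith [hx.1], by linarith [hx.2]⟩
  obtain ⟨l, hl, c₁, c₂, H⟩ := exists_common_slope₂ (u := f₁) (v := f₂) hpq hrs hκ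
    (fun x hx y hy x' hx' y' hy' => h.mono₁ x (QX hx) y (QY hy) x' (QX hx') y' (QY hy'))
    (fun x hx y hy x' hx' y' hy' => h.mono₂ x (QX hx) y (QY hy) x' (QX hx') y' (QY hy'))
    (h.increments_of_gap hp hq hr hs hκ hk)
    (fun w hw z hz x hx x' hx' y hy y' hy' => h.swap.increments_of_gap hr hs hp hq hκ
      (fun y hy x hx => by have := hk x hx y hy; linarith) z hz w hw y hy y' hy' x hx x' hx')
  exact ⟨l, hl, c₁, c₂, h.extend_affine₁ hp hq hr hs hrs fun x hx y hy => (H x hx y hy).1,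
    h.extend_affine₂ hp hq hr hs hpq fun x hx y hy => (H x hx y hy).2⟩

/-- By `marginal₂`, `f₁₂ - f₁` is at most its value at rectangle points of slightly larger `y`,
where it is at most `f₂ - κ`; and `f₂` is continuous in `y`. Where `f₁₂ = f₂`, `marginal₂` says
nothing, whence the second alternative. -/
theorem gap_on_strip (h : CriticalValues B ε f₁ f₂ f₁₂) {p q r s κ l c : ℝ} (hp : 0 ≤ p)
    (hpq : p < q) (hq : q ≤ B) (hr : 0 ≤ r) (hs : s ≤ B) (hκ : 0 < κ)
    (hk : ∀ x ∈ Ioo p q, ∀ y ∈ Ioo r s, f₁₂ x y + κ ≤ f₁ x y + f₂ x y)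
    (hf : ∀ x ∈ Ioo 0 B, ∀ y ∈ Ioo r s, f₂ x y = l * y + c) :
    ∀ x ∈ Ioo 0 B, ∀ y ∈ Ioo r s, f₁₂ x y + κ ≤ f₁ x y + f₂ x y ∨ f₁₂ x y ≤ f₂ x y := by
  intro x hx y hy
  have QX : ∀ {x}, x ∈ Ioo p q → x ∈ Ioo 0 B :=
    fun hx => ⟨by linarith [hx.1], by linarith [hx.2]⟩
  have QY : ∀ {y}, y ∈ Ioo r s → y ∈ Ioo 0 B :=
    fun hx => ⟨by linarith [hx.1], by linarith [hx.2]⟩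
  rcases (h.le₂ x hx y (QY hy)).eq_or_lt with h1 | h1
  · exact Or.inr h1.symm.le
  left
  have hw : (p + q) / 2 ∈ Ioo p q := ⟨by linarith, by linarith⟩
  suffices f₁₂ x y - f₁ x y ≤ l * y + (c - κ) by rw [hf x hx y hy]; linarith
  refine le_affine_of_forall_right hy.2 fun z hz => ?_
  have hz' : z ∈ Ioo r s := ⟨hy.1.trans hz.1, hz.2⟩
  have k := hk _ hw _ hz'
  have h2 := h.le₂ _ (QX hw) _ (QY hz')
  have h3 := h.marginal₂ x hx y (QY hy) _ (QX hw) z (QY hz') hz.1 h1 (by linarith)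
  rw [hf _ (QX hw) z hz'] at k
  linarith

/-- Where `f₁₂ ≤ f₂`, the gap is at least `f₁`, and `f₁` is bounded below by its positive value
between `a` and `a'`. -/
theorem extend_gap (h : CriticalValues B ε f₁ f₂ f₁₂) {p q r s κ a a' : ℝ} (hp : 0 ≤ p)
    (hpq : p < q) (hq : q ≤ B) (hr : 0 ≤ r) (hrs : r < s) (hs : s ≤ B) (hκ : 0 < κ)
    (hk : ∀ x ∈ Ioo p q, ∀ y ∈ Ioo r s, f₁₂ x y + κ ≤ f₁ x y + f₂ x y)
    (ha : ∀ x ∈ Ioo 0 B, ∀ y ∈ Ioo 0 B, a < x → 0 < f₁ x y) (ha0 : 0 ≤ a) (haa' : a < a')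
    (ha' : a' < B) :
    ∃ κ' > 0, ∀ x ∈ Ioo a' B, ∀ y ∈ Ioo r s, f₁₂ x y + κ' ≤ f₁ x y + f₂ x y := by
  obtain ⟨l, -, c₁, c₂, -, hf⟩ := h.affine_of_gap hp hpq hq hr hrs hs hκ hk
  have hX : (a + a') / 2 ∈ Ioo 0 B := ⟨by linarith, by linarith⟩
  have hY : (r + s) / 2 ∈ Ioo 0 B := ⟨by linarith, by linarith⟩
  have pos := ha _ hX _ hY (by linarith)
  refine ⟨min κ (f₁ ((a + a') / 2) ((r + s) / 2)), lt_min hκ pos, fun x hx y hy => ?_⟩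
  have hx' : x ∈ Ioo 0 B := ⟨by linarith [hx.1], hx.2⟩
  have hy' : y ∈ Ioo 0 B := ⟨by linarith [hy.1], by linarith [hy.2]⟩
  have e1 := min_le_left κ (f₁ ((a + a') / 2) ((r + s) / 2))
  have e2 := min_le_right κ (f₁ ((a + a') / 2) ((r + s) / 2))
  have e3 := h.mono₁ _ hX _ hY x hx' y hy' (by linarith [hx.1])
  rcases h.gap_on_strip hp hpq hq hr hs hκ hk hf x hx' y hy with h1 | h1 <;> linarith

/-- If the bundles `1` and `2` compete somewhere, then the positive critical values are affine. -/
theorem affine_of_exists_gap (h : CriticalValues B ε f₁ f₂ f₁₂) {p q r s κ a b : ℝ} (hp : 0 ≤ p)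
    (hpq : p < q) (hq : q ≤ B) (hr : 0 ≤ r) (hrs : r < s) (hs : s ≤ B) (hκ : 0 < κ)
    (hk : ∀ x ∈ Ioo p q, ∀ y ∈ Ioo r s, f₁₂ x y + κ ≤ f₁ x y + f₂ x y)
    (ha : ∀ x ∈ Ioo 0 B, ∀ y ∈ Ioo 0 B, a < x → 0 < f₁ x y) (ha0 : 0 ≤ a) (haB : a < B)
    (hb : ∀ x ∈ Ioo 0 B, ∀ y ∈ Ioo 0 B, b < y → 0 < f₂ x y) (hb0 : 0 ≤ b) (hbB : b < B) :
    (∀ x ∈ Ioo a B, ∀ y ∈ Ioo b B, f₁₂ x y < f₁ x y + f₂ x y) ∧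
    ∃ l : ℝ, 0 ≤ l ∧ ∃ c₁ c₂, (∀ x ∈ Ioo a B, ∀ y ∈ Ioo 0 B, f₁ x y = l * x + c₁) ∧
      ∀ x ∈ Ioo 0 B, ∀ y ∈ Ioo b B, f₂ x y = l * y + c₂ := by
  -- The gap spreads along the strip `r < y < s` and then, with the tasks exchanged, across it. Its
  -- size may tend to `0` at the thresholds.
  have key : ∀ a' ∈ Ioo a B, ∀ b' ∈ Ioo b B, ∃ κ' > 0, ∀ x ∈ Ioo a' B, ∀ y ∈ Ioo b' B,
      f₁₂ x y + κ' ≤ f₁ x y + f₂ x y := by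
    intro a' ha' b' hb'
    obtain ⟨κ₁, hκ₁, hk₁⟩ := h.extend_gap hp hpq hq hr hrs hs hκ hk ha ha0 ha'.1 ha'.2
    obtain ⟨κ₂, hκ₂, hk₂⟩ := h.swap.extend_gap hr hrs hs (by linarith [ha'.1]) ha'.2 le_rfl hκ₁
      (fun y hy x hx => by have := hk₁ x hx y hy; linarith)
      (fun y hy x hx => hb x hx y hy) hb0 hb'.1 hb'.2
    exact ⟨κ₂, hκ₂, fun x hx y hy => by have := hk₂ y hy x hx; linarith⟩
  have aff : ∀ a' ∈ Ioo a B, ∀ b' ∈ Ioo b B, ∃ l : ℝ, 0 ≤ l ∧ ∃ c₁ c₂,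
      (∀ x ∈ Ioo a' B, ∀ y ∈ Ioo 0 B, f₁ x y = l * x + c₁) ∧
      ∀ x ∈ Ioo 0 B, ∀ y ∈ Ioo b' B, f₂ x y = l * y + c₂ := by
    intro a' ha' b' hb'
    obtain ⟨κ', hκ', hk'⟩ := key a' ha' b' hb'
    exact h.affine_of_gap (by linarith [ha'.1]) ha'.2 le_rfl (by linarith [hb'.1]) hb'.2 le_rfl
      hκ' hk'
  have hB2 : B / 2 ∈ Ioo 0 B := ⟨by linarith [h.B_pos], by linarith [h.B_pos]⟩
  refine ⟨fun x hx y hy => ?_, ?_⟩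
  · obtain ⟨κ', hκ', hk'⟩ := key ((a + x) / 2) ⟨by linarith [hx.1], by linarith [hx.1, hx.2]⟩
      ((b + y) / 2) ⟨by linarith [hy.1], by linarith [hy.1, hy.2]⟩
    have := hk' x ⟨by linarith [hx.1], hx.2⟩ y ⟨by linarith [hy.1], hy.2⟩
    linarith
  · have hA : (a + B) / 2 ∈ Ioo a B := ⟨by linarith, by linarith⟩
    have hB : (b + B) / 2 ∈ Ioo b B := ⟨by linarith, by linarith⟩
    obtain ⟨l, hl, c₁, c₂, h1, h2⟩ := aff _ hA _ hB
    refine ⟨l, hl, c₁, c₂, fun x hx y hy => ?_, fun x hx y hy => ?_⟩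
    -- The affine forms obtained for different `a'` overlap near `B`, so they coincide.
    · obtain ⟨l', -, c₁', c₂', h1', h2'⟩ := aff ((a + x) / 2)
        ⟨by linarith [hx.1], by linarith [hx.1, hx.2]⟩ _ hB
      obtain ⟨rfl, rfl⟩ := affine_unique (a := max ((a + B) / 2) ((a + x) / 2)) (b := B)
        (l := l) (c := c₁) (l' := l') (c' := c₁')
        (max_lt (by linarith) (by linarith [hx.1, hx.2])) (fun z hz => by
          rw [← h1 z ⟨(le_max_left _ _).trans_lt hz.1, hz.2⟩ _ hB2,
            ← h1' z ⟨(le_max_right _ _).trans_lt hz.1, hz.2⟩ _ hB2])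
      exact h1' x ⟨by linarith [hx.1], hx.2⟩ y hy
    · obtain ⟨l', -, c₁', c₂', h1', h2'⟩ := aff _ hA ((b + y) / 2)
        ⟨by linarith [hy.1], by linarith [hy.1, hy.2]⟩
      obtain ⟨rfl, rfl⟩ := affine_unique (a := max ((b + B) / 2) ((b + y) / 2)) (b := B)
        (l := l) (c := c₂) (l' := l') (c' := c₂')
        (max_lt (by linarith) (by linarith [hy.1, hy.2])) (fun z hz => by
          rw [← h2 _ hB2 z ⟨(le_max_left _ _).trans_lt hz.1, hz.2⟩,
            ← h2' _ hB2 z ⟨(le_max_right _ _).trans_lt hz.1, hz.2⟩])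
      exact h2' x hx y ⟨by linarith [hy.1], hy.2⟩

end CriticalValues

namespace CriticalValues

variable {B ε : ℝ} {f₁ f₂ f₁₂ : ℝ → ℝ → ℝ}

/-- A jump of `f₁` at `a` contradicts `diff`: passing from `a - e / 4` to `a + e / 4` raises `f₁` by
more than `l * e`, while raising the second coordinate by `e` raises `f₂` by only `l * e`. -/
theorem threshold_le_of_gap (h : CriticalValues B ε f₁ f₂ f₁₂) {p q r s κ a l c₁ c₂ : ℝ}
    (hp : 0 ≤ p) (hpq : p < q) (hq : q ≤ B) (hr : 0 ≤ r) (hrs : r < s) (hs : s ≤ B) (hκ : 0 < κ)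
    (hk : ∀ x ∈ Ioo p q, ∀ y ∈ Ioo r s, f₁₂ x y + κ ≤ f₁ x y + f₂ x y) (hl : 0 ≤ l)
    (hf₂ : ∀ x ∈ Ioo 0 B, ∀ y ∈ Ioo r s, f₂ x y = l * y + c₂) (ha0 : 0 < a) (haB : a < B)
    (ha : ∀ x ∈ Ioo 0 B, ∀ y ∈ Ioo 0 B, x < a → f₁ x y = 0)
    (hf₁ : ∀ x ∈ Ioo a B, ∀ y ∈ Ioo 0 B, f₁ x y = l * x + c₁) : l * a + c₁ ≤ 0 := by
  by_contra! hj
  obtain ⟨e, he, he'⟩ := exists_small (lt_min hκ hj) hl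
    (min ((s - r) / 2) (min a (B - a))) (lt_min (by linarith) (lt_min ha0 (by linarith)))
  obtain ⟨he1, he2⟩ := he'
  have d1 := he1.trans_le (min_le_left _ _)
  have d2 := he1.trans_le ((min_le_right _ _).trans (min_le_left _ _))
  have d3 := he1.trans_le ((min_le_right _ _).trans (min_le_right _ _))
  have k1 := he2.trans_le (min_le_left _ _)
  have k2 := he2.trans_le (min_le_right _ _)
  have hlh : 0 ≤ l * e := mul_nonneg hl he.le
  have hx : a + e / 4 ∈ Ioo 0 B := ⟨by linarith, by linarith⟩
  have hx' : a - e / 4 ∈ Ioo 0 B := ⟨by linarith, by linarith⟩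
  have hy' : (r + s) / 2 ∈ Ioo r s := ⟨by linarith, by linarith⟩
  have hy : (r + s) / 2 + e ∈ Ioo r s := ⟨by linarith, by linarith⟩
  have Y' : (r + s) / 2 ∈ Ioo 0 B := ⟨by linarith, by linarith⟩
  have Y : (r + s) / 2 + e ∈ Ioo 0 B := ⟨by linarith, by linarith⟩
  have hw : (p + q) / 2 ∈ Ioo p q := ⟨by linarith, by linarith⟩
  have W : (p + q) / 2 ∈ Ioo 0 B := ⟨by linarith, by linarith⟩
  have e1 := hf₁ _ ⟨by linarith, hx.2⟩ _ Y
  have e1' := ha _ hx' _ Y' (by linarith)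
  have e2 := hf₂ _ hx _ hy
  have e2' := hf₂ _ hx' _ hy'
  have hpos : 0 < l * ((r + s) / 2) + c₂ := by
    have := hk _ hw _ hy'
    rw [hf₂ _ W _ hy'] at this
    linarith [h.le₁ _ W _ Y']
  have gap : f₁₂ (a + e / 4) ((r + s) / 2 + e) + l * e <
      f₁ (a + e / 4) ((r + s) / 2 + e) + f₂ (a + e / 4) ((r + s) / 2 + e) := by
    rcases h.gap_on_strip hp hpq hq hr hs hκ hk hf₂ _ hx _ hy with h1 | h1 <;> linarith
  have g1 := h.marginal₁ _ hx' _ Y' _ hx _ Y (by linarith)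
    (by linarith [h.le₂ _ hx' _ Y']) (by linarith)
  have := h.diff _ hx _ Y _ hx' _ Y' (by linarith) (by linarith) (by linarith) (by linarith)
    (by linarith)
  linarith

/-- If the bundles `1` and `2` compete somewhere, then the mechanism is affine. -/
theorem exists_agreesAt_of_gap (h : CriticalValues B ε f₁ f₂ f₁₂) {p q r s κ : ℝ}
    (hp : 0 ≤ p) (hpq : p < q) (hq : q ≤ B) (hr : 0 ≤ r) (hrs : r < s) (hs : s ≤ B) (hκ : 0 < κ)
    (hk : ∀ x ∈ Ioo p q, ∀ y ∈ Ioo r s, f₁₂ x y + κ ≤ f₁ x y + f₂ x y) :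
    ∃ l : ℝ, 0 ≤ l ∧ ∃ o₁ o₂ o₁₂, ∀ x ∈ Ioo 0 B, ∀ y ∈ Ioo 0 B,
      AgreesAt l o₁ o₂ o₁₂ f₁ f₂ f₁₂ x y := by
  obtain ⟨a, ⟨ha0, -⟩, ha⟩ := h.exists_threshold₁
  obtain ⟨b, ⟨hb0, -⟩, hb⟩ := h.exists_threshold₂
  have hw : (p + q) / 2 ∈ Ioo p q := ⟨by linarith, by linarith⟩
  have W : (p + q) / 2 ∈ Ioo 0 B := ⟨by linarith, by linarith⟩
  have hz : (r + s) / 2 ∈ Ioo r s := ⟨by linarith, by linarith⟩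
  have Z : (r + s) / 2 ∈ Ioo 0 B := ⟨by linarith, by linarith⟩
  have hkm := hk _ hw _ hz
  have haB : a < B := by
    by_contra! hcon
    have := (ha _ W _ Z).1 (W.2.trans_le hcon)
    linarith [h.le₂ _ W _ Z]
  have hbB : b < B := by
    by_contra! hcon
    have := (hb _ W _ Z).1 (Z.2.trans_le hcon)
    linarith [h.le₁ _ W _ Z]
  obtain ⟨gap, l, hl, c₁, c₂, hf₁, hf₂⟩ := h.affine_of_exists_gap hp hpq hq hr hrs hs hκ hk
    (fun x hx y hy => (ha x hx y hy).2) ha0 haB (fun x hx y hy => (hb x hx y hy).2) hb0 hbB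
  have hr' : ∀ y ∈ Ioo r s, y ∈ Ioo b B := fun y hy => by
    have Y : y ∈ Ioo 0 B := ⟨by linarith [hy.1], by linarith [hy.2]⟩
    refine ⟨?_, Y.2⟩
    by_contra! hcon
    have hy' : (r + y) / 2 ∈ Ioo r s := ⟨by linarith [hy.1], by linarith [hy.1, hy.2]⟩
    have Y' : (r + y) / 2 ∈ Ioo 0 B := ⟨by linarith [hy.1], by linarith [hy.1, hy.2]⟩
    have h1 := (hb _ W _ Y').1 (by linarith [hy.1])
    have h2 := hk _ hw _ hy'
    linarith [h.le₁ _ W _ Y']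
  have hp' : ∀ x ∈ Ioo p q, x ∈ Ioo a B := fun x hx => by
    have X : x ∈ Ioo 0 B := ⟨by linarith [hx.1], by linarith [hx.2]⟩
    refine ⟨?_, X.2⟩
    by_contra! hcon
    have hx' : (p + x) / 2 ∈ Ioo p q := ⟨by linarith [hx.1], by linarith [hx.1, hx.2]⟩
    have X' : (p + x) / 2 ∈ Ioo 0 B := ⟨by linarith [hx.1], by linarith [hx.1, hx.2]⟩
    have h1 := (ha _ X' _ Z).1 (by linarith [hx.1])
    have h2 := hk _ hx' _ hz
    linarith [h.le₂ _ X' _ Z]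
  have hla : 0 < a → l * a + c₁ ≤ 0 := fun ha1 =>
    h.threshold_le_of_gap hp hpq hq hr hrs hs hκ hk hl (fun x hx y hy => hf₂ x hx y (hr' y hy)) ha1
      haB (fun x hx y hy => (ha x hx y hy).1) hf₁
  have hlb : 0 < b → l * b + c₂ ≤ 0 := fun hb1 =>
    h.swap.threshold_le_of_gap hr hrs hs hp hpq hq hκ
      (fun y hy x hx => by have := hk x hx y hy; linarith) hl
      (fun y hy x hx => hf₁ x (hp' x hx) y hy) hb1 hbB
      (fun y hy x hx => (hb x hx y hy).1) (fun y hy x hx => hf₂ x hx y hy)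
  have zero₁ : ∀ x ∈ Ioo 0 B, ∀ y ∈ Ioo 0 B, x ≤ a → f₁ x y = 0 ∧ l * x + c₁ ≤ 0 := by
    intro x hx y hy hxa
    have h1 := hla (hx.1.trans_le hxa)
    have h2 : l * x ≤ l * a := mul_le_mul_of_nonneg_left hxa hl
    refine ⟨le_antisymm ?_ (h.nonneg₁ x hx y hy), by linarith⟩
    refine le_trans (le_affine_of_forall_right haB fun z hz => ?_) h1
    have hz' : z ∈ Ioo 0 B := ⟨by linarith [hz.1], hz.2⟩
    rw [← hf₁ z hz y hy]
    exact h.mono₁ x hx y hy z hz' y hy (by linarith [hz.1])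
  have zero₂ : ∀ x ∈ Ioo 0 B, ∀ y ∈ Ioo 0 B, y ≤ b → f₂ x y = 0 ∧ l * y + c₂ ≤ 0 := by
    intro x hx y hy hyb
    have h1 := hlb (hy.1.trans_le hyb)
    have h2 : l * y ≤ l * b := mul_le_mul_of_nonneg_left hyb hl
    refine ⟨le_antisymm ?_ (h.nonneg₂ x hx y hy), by linarith⟩
    refine le_trans (le_affine_of_forall_right hbB fun z hz => ?_) h1
    have hz' : z ∈ Ioo 0 B := ⟨by linarith [hz.1], hz.2⟩
    rw [← hf₂ x hx z hz]
    exact h.mono₂ x hx y hy x hx z hz' (by linarith [hz.1])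
  have A₁ : ∀ x ∈ Ioo 0 B, ∀ y ∈ Ioo 0 B, Agrees (some c₁) (l * x) (f₁ x y) (0 < f₁ x y) := by
    intro x hx y hy
    rcases le_or_gt x a with hxa | hxa
    · obtain ⟨h1, h2⟩ := zero₁ x hx y hy hxa
      refine ⟨fun hpos => absurd hpos (by rw [h1]; exact lt_irrefl _), fun c hc => ?_⟩
      obtain rfl := Option.mem_some.1 hc
      rwa [h1]
    · have h1 := hf₁ x ⟨hxa, hx.2⟩ y hy
      exact ⟨fun _ => ⟨c₁, rfl, h1⟩, fun c hc => by obtain rfl := Option.mem_some.1 hc; exact h1.ge⟩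
  have A₂ : ∀ x ∈ Ioo 0 B, ∀ y ∈ Ioo 0 B, Agrees (some c₂) (l * y) (f₂ x y) (0 < f₂ x y) := by
    intro x hx y hy
    rcases le_or_gt y b with hyb | hyb
    · obtain ⟨h1, h2⟩ := zero₂ x hx y hy hyb
      refine ⟨fun hpos => absurd hpos (by rw [h1]; exact lt_irrefl _), fun c hc => ?_⟩
      obtain rfl := Option.mem_some.1 hc
      rwa [h1]
    · have h1 := hf₂ x hx y ⟨hyb, hy.2⟩
      exact ⟨fun _ => ⟨c₂, rfl, h1⟩, fun c hc => by obtain rfl := Option.mem_some.1 hc; exact h1.ge⟩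
  -- For `x ≤ a`, `marginal₁` and the gap bound `f₁₂ - f₂` by `f₁` just to the right of `a`, hence
  -- by `0`.
  have active₁ : ∀ x ∈ Ioo 0 B, ∀ y ∈ Ioo 0 B, f₁ x y < f₁₂ x y → f₂ x y < f₁₂ x y → a < x := by
    intro x hx y hy h1 h2
    by_contra! hxa
    have hm : (b + B) / 2 ∈ Ioo b B := ⟨by linarith, by linarith⟩
    have M : (b + B) / 2 ∈ Ioo 0 B := ⟨by linarith, by linarith⟩
    have : f₁₂ x y - f₂ x y ≤ l * a + c₁ := by
      refine le_affine_of_forall_right haB fun z hz => ?_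
      have hz' : z ∈ Ioo 0 B := ⟨by linarith [hz.1], hz.2⟩
      have h3 := h.marginal₁ x hx y hy z hz' _ M (by linarith [hz.1]) h1
        ((hb _ hz' _ M).2 hm.1)
      have h4 := gap z hz _ hm
      rw [← hf₁ z hz _ M]
      linarith
    linarith [hla (hx.1.trans_le hxa)]
  have active₂ : ∀ x ∈ Ioo 0 B, ∀ y ∈ Ioo 0 B, f₁ x y < f₁₂ x y → f₂ x y < f₁₂ x y → b < y := by
    intro x hx y hy h1 h2
    by_contra! hyb
    have hm : (a + B) / 2 ∈ Ioo a B := ⟨by linarith, by linarith⟩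
    have M : (a + B) / 2 ∈ Ioo 0 B := ⟨by linarith, by linarith⟩
    have : f₁₂ x y - f₁ x y ≤ l * b + c₂ := by
      refine le_affine_of_forall_right hbB fun z hz => ?_
      have hz' : z ∈ Ioo 0 B := ⟨by linarith [hz.1], hz.2⟩
      have h3 := h.marginal₂ x hx y hy _ M z hz' (by linarith [hz.1]) h2
        ((ha _ M _ hz').2 hm.1)
      have h4 := gap _ hm z hz
      rw [← hf₂ _ M z hz]
      linarith
    linarith [hlb (hy.1.trans_le hyb)]
  -- The defect `f₁ + f₂ - f₁₂` is maximal at every active point, hence constant on the active set;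
  -- this determines the constant of `12`. The two marginal monotonicities are chained through `(z,
  -- v + (x - z))`, with `z` tending to `x` from below.
  have lower : ∀ u ∈ Ioo a B, ∀ v ∈ Ioo b B, f₁ u v < f₁₂ u v → f₂ u v < f₁₂ u v →
      ∀ x ∈ Ioo a B, ∀ y ∈ Ioo b B,
        f₁ x y + f₂ x y - f₁₂ x y ≤ f₁ u v + f₂ u v - f₁₂ u v := by
    intro u hu v hv h1 h2 x hx y hy
    have X : x ∈ Ioo 0 B := ⟨by linarith [hx.1], hx.2⟩
    have Y : y ∈ Ioo 0 B := ⟨by linarith [hy.1], hy.2⟩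
    have U : u ∈ Ioo 0 B := ⟨by linarith [hu.1], hu.2⟩
    have V : v ∈ Ioo 0 B := ⟨by linarith [hv.1], hv.2⟩
    have : 2 * l * x + (c₁ - (f₁ u v + f₂ u v - f₁₂ u v) - l * x) ≤ f₁₂ x y - f₂ x y := by
      refine affine_le_of_forall_left (a := max a (x - (B - v)))
        (max_lt hx.1 (by linarith [hv.2])) fun z hz => ?_
      have z1 := (le_max_left _ _).trans_lt hz.1
      have z2 := (le_max_right _ _).trans_lt hz.1
      have hz' : z ∈ Ioo a B := ⟨z1, hz.2.trans hx.2⟩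
      have Z' : z ∈ Ioo 0 B := ⟨by linarith, hz.2.trans hx.2⟩
      have hv' : v + (x - z) ∈ Ioo b B := ⟨by linarith [hv.1, hz.2], by linarith⟩
      have V' : v + (x - z) ∈ Ioo 0 B := ⟨by linarith [hv'.1], hv'.2⟩
      have h3 := h.marginal₂ u U v V z Z' _ V' (by linarith [hz.2]) h2 ((ha z Z' _ V').2 z1)
      have h4 := h.marginal₁ z Z' _ V' x X y Y hz.2 (by linarith) ((hb x X y Y).2 hy.1)
      have e1 := hf₂ u U v hv
      have e2 := hf₂ z Z' _ hv'
      have e3 := hf₁ z hz' _ V'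
      linarith
    have e1 := hf₁ x hx y Y
    linarith
  refine ⟨l, hl, some c₁, some c₂, ?_⟩
  by_cases hact : ∃ u ∈ Ioo a B, ∃ v ∈ Ioo b B, f₁ u v < f₁₂ u v ∧ f₂ u v < f₁₂ u v
  · obtain ⟨u, hu, v, hv, h1, h2⟩ := hact
    refine ⟨some (c₁ + c₂ - (f₁ u v + f₂ u v - f₁₂ u v)), fun x hx y hy =>
      ⟨A₁ x hx y hy, A₂ x hx y hy, ?_, fun c hc => ?_⟩⟩
    · rintro ⟨h3, h4⟩
      have hx' : x ∈ Ioo a B := ⟨active₁ x hx y hy h3 h4, hx.2⟩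
      have hy' : y ∈ Ioo b B := ⟨active₂ x hx y hy h3 h4, hy.2⟩
      have h5 := lower u hu v hv h1 h2 x hx' y hy'
      have h6 := lower x hx' y hy' h3 h4 u hu v hv
      have e1 := hf₁ x hx' y hy
      have e2 := hf₂ x hx y hy'
      exact ⟨_, rfl, by linarith⟩
    · obtain rfl := Option.mem_some.1 hc
      have hgap := gap u hu v hv
      have l1 := h.le₁ x hx y hy
      have l2 := h.le₂ x hx y hy
      have b1 := (A₁ x hx y hy).2 c₁ rfl
      have b2 := (A₂ x hx y hy).2 c₂ rfl
      rcases le_or_gt x a with hxa | hxa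
      · linarith [zero₁ x hx y hy hxa]
      rcases le_or_gt y b with hyb | hyb
      · linarith [zero₂ x hx y hy hyb]
      linarith [lower u hu v hv h1 h2 x ⟨hxa, hx.2⟩ y ⟨hyb, hy.2⟩]
  · refine ⟨none, fun x hx y hy => ⟨A₁ x hx y hy, A₂ x hx y hy, ?_, by simp⟩⟩
    rintro ⟨h3, h4⟩
    exact absurd ⟨x, ⟨active₁ x hx y hy h3 h4, hx.2⟩, y, ⟨active₂ x hx y hy h3 h4, hy.2⟩, h3, h4⟩
      hact

end CriticalValues

/-! ### The case in which the bundles `1` and `2` do not compete -/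

/-- The bundles `1` and `2` do not compete: up to arbitrarily small errors, the critical values are
superadditive on a dense set. -/
def NoGap (B : ℝ) (f₁ f₂ f₁₂ : ℝ → ℝ → ℝ) : Prop :=
  ∀ p q r s η, 0 ≤ p → p < q → q ≤ B → 0 ≤ r → r < s → s ≤ B → 0 < η →
    ∃ x ∈ Ioo p q, ∃ y ∈ Ioo r s, f₁ x y + f₂ x y ≤ f₁₂ x y + η

theorem NoGap.swap {B : ℝ} {f₁ f₂ f₁₂ : ℝ → ℝ → ℝ} (h : NoGap B f₁ f₂ f₁₂) :
    NoGap B (fun x y => f₂ y x) (fun x y => f₁ y x) (fun x y => f₁₂ y x) := by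
  intro p q r s η hp hpq hq hr hrs hs hη
  obtain ⟨x, hx, y, hy, hxy⟩ := h r s p q η hr hrs hs hp hpq hq hη
  exact ⟨y, hy, x, hx, by linarith⟩

/-- The critical values on the strip where `f₂` is positive. -/
structure StripData (B : ℝ) (f₁ f₂ f₁₂ : ℝ → ℝ → ℝ) (l c d b β : ℝ) : Prop where
  l_nonneg : 0 ≤ l
  b_nonneg : 0 ≤ b
  b_lt : b < B
  β_nonneg : 0 ≤ β
  β_lt : β < B
  eq₂ : ∀ x ∈ Ioo 0 B, ∀ y ∈ Ioo b B, f₂ x y = l * y + c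
  pos₂ : ∀ x ∈ Ioo 0 B, ∀ y ∈ Ioo b B, 0 < f₂ x y
  zero₂ : ∀ x ∈ Ioo 0 B, ∀ y ∈ Ioo 0 B, y ≤ b → f₂ x y = 0
  threshold : 0 < b → l * b + c ≤ 0
  eq₁₂ : ∀ x ∈ Ioo β B, ∀ y ∈ Ioo b B, f₁₂ x y = l * (x + y) + (c + d)
  pos₁₂ : ∀ x ∈ Ioo β B, ∀ y ∈ Ioo b B, f₂ x y < f₁₂ x y
  zero₁₂ : ∀ x ∈ Ioo 0 B, ∀ y ∈ Ioo b B, x ≤ β → f₁₂ x y = f₂ x y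
  threshold₁₂ : 0 < β → l * β + d ≤ 0

namespace CriticalValues

variable {B ε : ℝ} {f₁ f₂ f₁₂ : ℝ → ℝ → ℝ}

/-- If `f₁ = f₁₂` at `(x, y)`, then `marginal₂` makes `f₁₂ - f₁` nonpositive at a suitable point
with larger first and smaller second coordinate, where the absence of a gap makes it at least `f₂ -
η > 0`. -/
theorem lt_of_noGap (h : CriticalValues B ε f₁ f₂ f₁₂) (hM : NoGap B f₁ f₂ f₁₂) {b : ℝ}
    (hb0 : 0 ≤ b) (hb : ∀ x ∈ Ioo 0 B, ∀ y ∈ Ioo b B, 0 < f₂ x y) :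
    ∀ x ∈ Ioo 0 B, ∀ y ∈ Ioo b B, f₁ x y < f₁₂ x y := by
  intro x hx y hy
  by_contra! hcon
  have Y : y ∈ Ioo 0 B := ⟨by linarith [hy.1], hy.2⟩
  have hf₁ : 0 < f₁ x y := by linarith [hb x hx y hy, h.le₂ x hx y Y]
  have hm : (b + y) / 2 ∈ Ioo b B := ⟨by linarith [hy.1], by linarith [hy.1, hy.2]⟩
  have M : (b + y) / 2 ∈ Ioo 0 B := ⟨by linarith [hy.1], hm.2⟩
  have hf₂ := hb x hx _ hm
  obtain ⟨η, hη, hη'⟩ := exists_between (lt_min hf₁ hf₂)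
  have e1 := hη'.trans_le (min_le_left _ _)
  have e2 := hη'.trans_le (min_le_right _ _)
  obtain ⟨x', hx', y', hy', hk⟩ := hM x B ((b + y) / 2) y η hx.1.le hx.2 le_rfl M.1.le
    (by linarith [hy.1]) hy.2.le hη
  have X' : x' ∈ Ioo 0 B := ⟨hx.1.trans hx'.1, hx'.2⟩
  have Y' : y' ∈ Ioo 0 B := ⟨M.1.trans hy'.1, hy'.2.trans hy.2⟩
  have m1 := h.mono₁ x hx y Y x' X' y' Y' hx'.1
  have m2 := h.mono₂ x hx _ M x' X' y' Y' hy'.1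
  have := h.marginal₂ x' X' y' Y' x hx y Y hy'.2 (by linarith) hf₁
  linarith

/-- `f₁₂` is the sum of `f₁₂ - f₂`, essentially a function of `x`, and `f₂`, essentially a function
of `y`. As `x' + y < x + y'`, `mono₁₂` compares these sums near `(x', y)` and `(x, y')`. Its `ε` is
spent on a failure of superadditivity of at most `ε / 4` and an increment of `f₂` below `ε / 2`. -/
theorem increments_of_noGap₁ (h : CriticalValues B ε f₁ f₂ f₁₂) (hM : NoGap B f₁ f₂ f₁₂)
    {b β : ℝ} (hb0 : 0 ≤ b) (hβ0 : 0 ≤ β)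
    (hu : ∀ x ∈ Ioo β B, ∀ y ∈ Ioo b B, ∀ x' ∈ Ioo β B, ∀ y' ∈ Ioo b B, x < x' →
      f₁₂ x y - f₂ x y ≤ f₁₂ x' y' - f₂ x' y')
    (hlt₁ : ∀ x ∈ Ioo β B, ∀ y ∈ Ioo b B, f₁ x y < f₁₂ x y)
    (hlt₂ : ∀ x ∈ Ioo β B, ∀ y ∈ Ioo b B, f₂ x y < f₁₂ x y) :
    ∀ w ∈ Ioo β B, ∀ z ∈ Ioo b B, ∀ x ∈ Ioo β B, ∀ x' ∈ Ioo β B, ∀ y ∈ Ioo b B,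
      ∀ y' ∈ Ioo b B, x < x' → x' - x < y' - y → f₂ w y' - f₂ w y < ε / 2 →
        (f₁₂ x' z - f₂ x' z) - (f₁₂ x z - f₂ x z) ≤ f₂ w y' - f₂ w y := by
  intro w hw z hz x hx x' hx' y hy y' hy' hxx' hlt hκ
  have hε := h.ε_pos
  have QX : ∀ {x}, x ∈ Ioo β B → x ∈ Ioo 0 B := fun hx => ⟨by linarith [hx.1], hx.2⟩
  have QY : ∀ {y}, y ∈ Ioo b B → y ∈ Ioo 0 B := fun hx => ⟨by linarith [hx.1], hx.2⟩
  obtain ⟨δ, hδ, hδ'⟩ := exists_between (show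
    0 < min (y' - y - (x' - x)) (min (B - x') (x - β)) / 4 from
      div_pos (lt_min (by linarith) (lt_min (by linarith [hx'.2]) (by linarith [hx.1])))
        (by norm_num))
  have d1 := min_le_left (y' - y - (x' - x)) (min (B - x') (x - β))
  have d2 := (min_le_right (y' - y - (x' - x)) (min (B - x') (x - β))).trans (min_le_left _ _)
  have d3 := (min_le_right (y' - y - (x' - x)) (min (B - x') (x - β))).trans (min_le_right _ _)
  obtain ⟨u, hu', v, hv, hk⟩ := hM x' (x' + δ) y (y + δ) (ε / 4) (QX hx').1.le (by linarith)
    (by linarith) (QY hy).1.le (by linarith) (by linarith [hy'.2]) (by linarith)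
  obtain ⟨u', hu'', v', hv', hk'⟩ := hM (x - δ) x (y' - δ) y' (ε / 4) (by linarith)
    (by linarith) hx.2.le (by linarith [hy.1]) (by linarith) hy'.2.le (by linarith)
  have U : u ∈ Ioo β B := ⟨by linarith [hx'.1, hu'.1], by linarith [hu'.2]⟩
  have V : v ∈ Ioo b B := ⟨by linarith [hy.1, hv.1], by linarith [hv.2, hy'.2]⟩
  have U' : u' ∈ Ioo β B := ⟨by linarith [hu''.1], by linarith [hx.2, hu''.2]⟩
  have V' : v' ∈ Ioo b B := ⟨by linarith [hy.1, hv'.1], by linarith [hv'.2, hy'.2]⟩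
  have m1 := h.mono₁ u' (QX U') v' (QY V') u (QX U) v (QY V) (by linarith [hu'.1, hu''.2])
  have m2 := h.mono₂ u' (QX U') v' (QY V') w (QX hw) y' (QY hy') hv'.2
  have m3 := h.mono₂ w (QX hw) y (QY hy) u (QX U) v (QY V) hv.1
  have m4 := hu x' hx' z hz u U v V hu'.1
  have m5 := hu u' U' v' V' x hx z hz hu''.2
  have := h.mono₁₂ u (QX U) v (QY V) u' (QX U') v' (QY V')
    (by linarith [hu'.2, hv.2, hu''.1, hv'.1]) (hlt₁ u U v V) (hlt₂ u U v V) (by linarith)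
    (by linarith) (by linarith) (by linarith)
  linarith

/-- The reverse comparison uses points near `(x, y')` and `(x', y)`, where `x + y' < x' + y`. -/
theorem increments_of_noGap₂ (h : CriticalValues B ε f₁ f₂ f₁₂) (hM : NoGap B f₁ f₂ f₁₂)
    {b β : ℝ} (hb0 : 0 ≤ b) (hβ0 : 0 ≤ β)
    (hu : ∀ x ∈ Ioo β B, ∀ y ∈ Ioo b B, ∀ x' ∈ Ioo β B, ∀ y' ∈ Ioo b B, x < x' →
      f₁₂ x y - f₂ x y ≤ f₁₂ x' y' - f₂ x' y')
    (hlt₁ : ∀ x ∈ Ioo β B, ∀ y ∈ Ioo b B, f₁ x y < f₁₂ x y)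
    (hlt₂ : ∀ x ∈ Ioo β B, ∀ y ∈ Ioo b B, f₂ x y < f₁₂ x y) :
    ∀ w ∈ Ioo β B, ∀ z ∈ Ioo b B, ∀ x ∈ Ioo β B, ∀ x' ∈ Ioo β B, ∀ y ∈ Ioo b B,
      ∀ y' ∈ Ioo b B, y < y' → y' - y < x' - x →
        (f₁₂ x' z - f₂ x' z) - (f₁₂ x z - f₂ x z) < ε / 2 →
        f₂ w y' - f₂ w y ≤ (f₁₂ x' z - f₂ x' z) - (f₁₂ x z - f₂ x z) := by
  intro w hw z hz x hx x' hx' y hy y' hy' hyy' hlt hκ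
  have hε := h.ε_pos
  have QX : ∀ {x}, x ∈ Ioo β B → x ∈ Ioo 0 B := fun hx => ⟨by linarith [hx.1], hx.2⟩
  have QY : ∀ {y}, y ∈ Ioo b B → y ∈ Ioo 0 B := fun hx => ⟨by linarith [hx.1], hx.2⟩
  obtain ⟨δ, hδ, hδ'⟩ := exists_between (show
    0 < min (x' - x - (y' - y)) (min (B - y') (y - b)) / 4 from
      div_pos (lt_min (by linarith) (lt_min (by linarith [hy'.2]) (by linarith [hy.1])))
        (by norm_num))
  have d1 := min_le_left (x' - x - (y' - y)) (min (B - y') (y - b))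
  have d2 := (min_le_right (x' - x - (y' - y)) (min (B - y') (y - b))).trans (min_le_left _ _)
  have d3 := (min_le_right (x' - x - (y' - y)) (min (B - y') (y - b))).trans (min_le_right _ _)
  obtain ⟨u, hu', v, hv, hk⟩ := hM x (x + δ) y' (y' + δ) (ε / 4) (QX hx).1.le (by linarith)
    (by linarith [hx'.2]) (QY hy').1.le (by linarith) (by linarith) (by linarith)
  obtain ⟨u', hu'', v', hv', hk'⟩ := hM (x' - δ) x' (y - δ) y (ε / 4) (by linarith [hx.1])
    (by linarith) hx'.2.le (by linarith) (by linarith) hy.2.le (by linarith)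
  have U : u ∈ Ioo β B := ⟨by linarith [hx.1, hu'.1], by linarith [hu'.2, hx'.2]⟩
  have V : v ∈ Ioo b B := ⟨by linarith [hy'.1, hv.1], by linarith [hv.2]⟩
  have U' : u' ∈ Ioo β B := ⟨by linarith [hu''.1, hx.1], by linarith [hx'.2, hu''.2]⟩
  have V' : v' ∈ Ioo b B := ⟨by linarith [hv'.1], by linarith [hv'.2, hy.2]⟩
  have m1 := h.mono₂ u' (QX U') v' (QY V') u (QX U) v (QY V) (by linarith [hv.1, hv'.2])
  have m2 := h.mono₂ u' (QX U') v' (QY V') w (QX hw) y (QY hy) hv'.2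
  have m3 := h.mono₂ w (QX hw) y' (QY hy') u (QX U) v (QY V) hv.1
  have m4 := hu x hx z hz u U v V hu'.1
  have m5 := hu u' U' v' V' x' hx' z hz hu''.2
  have := h.mono₁₂ u (QX U) v (QY V) u' (QX U') v' (QY V')
    (by linarith [hu'.2, hv.2, hu''.1, hv'.1]) (hlt₁ u U v V) (hlt₂ u U v V) (by linarith)
    (by linarith) (by linarith) (by linarith)
  linarith

/-- If the bundles `1` and `2` do not compete and `f₂` is positive somewhere, then either only the
bundle `2` is ever allocated, or the critical values are affine on the strip `y > b`. -/
theorem exists_stripData (h : CriticalValues B ε f₁ f₂ f₁₂) (hM : NoGap B f₁ f₂ f₁₂) {b : ℝ}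
    (hb0 : 0 ≤ b) (hbB : b < B) (hb : ∀ x ∈ Ioo 0 B, ∀ y ∈ Ioo 0 B,
      (y < b → f₂ x y = 0) ∧ (b < y → 0 < f₂ x y)) :
    (∀ x ∈ Ioo 0 B, ∀ y ∈ Ioo 0 B, f₁ x y = 0 ∧ f₁₂ x y = f₂ x y) ∨
      ∃ l c d β, StripData B f₁ f₂ f₁₂ l c d b β := by
  have hε := h.ε_pos
  have QY : ∀ {y}, y ∈ Ioo b B → y ∈ Ioo 0 B := fun hx => ⟨by linarith [hx.1], hx.2⟩
  have hpos : ∀ x ∈ Ioo 0 B, ∀ y ∈ Ioo b B, 0 < f₂ x y :=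
    fun x hx y hy => (hb x hx y (QY hy)).2 hy.1
  have hlt₁ := h.lt_of_noGap hM hb0 hpos
  have hu : ∀ x ∈ Ioo 0 B, ∀ y ∈ Ioo b B, ∀ x' ∈ Ioo 0 B, ∀ y' ∈ Ioo b B, x < x' →
      f₁₂ x y - f₂ x y ≤ f₁₂ x' y' - f₂ x' y' := fun x hx y hy x' hx' y' hy' hlt =>
    h.marginal₁ x hx y (QY hy) x' hx' y' (QY hy') hlt (hlt₁ x hx y hy) (hpos x' hx' y' hy')
  obtain ⟨β, ⟨hβ0, hβB⟩, hβ⟩ := exists_threshold (P := fun x y => f₂ x y < f₁₂ x y) (c := b)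
    (d := B) h.B_pos.le (fun x hx y hy x' hx' y' hy' hlt hP => by
      have := hu x hx y hy x' hx' y' hy' hlt
      linarith)
  have QX : ∀ {x}, x ∈ Ioo β B → x ∈ Ioo 0 B := fun hx => ⟨by linarith [hx.1], hx.2⟩
  have hm : (b + B) / 2 ∈ Ioo b B := ⟨by linarith, by linarith⟩
  rcases hβB.eq_or_lt with rfl | hβB
  -- The marginal price of task `1` vanishes on the strip. The absence of gaps forces `f₁ = 0`, and
  -- `marginal₁` carries `f₁₂ = f₂` below the strip.
  · left
    have hz : ∀ x ∈ Ioo 0 β, ∀ y ∈ Ioo b β, f₁₂ x y = f₂ x y := fun x hx y hy =>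
      le_antisymm (not_lt.1 ((hβ x hx y hy).1 hx.2)) (h.le₂ x hx y (QY hy))
    have hf₁ : ∀ x ∈ Ioo 0 β, ∀ y ∈ Ioo 0 β, f₁ x y = 0 := by
      intro x hx y hy
      by_contra hne
      have hp : 0 < f₁ x y := lt_of_le_of_ne (h.nonneg₁ x hx y hy) (Ne.symm hne)
      obtain ⟨x', hx', y', hy', hk⟩ := hM x β b β (f₁ x y / 2) hx.1.le hx.2 le_rfl hb0 hbB le_rfl
        (by linarith)
      have X' : x' ∈ Ioo 0 β := ⟨hx.1.trans hx'.1, hx'.2⟩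
      linarith [hz x' X' y' hy', h.mono₁ x hx y hy x' X' y' (QY hy') hx'.1]
    refine fun x hx y hy => ⟨hf₁ x hx y hy, le_antisymm ?_ (h.le₂ x hx y hy)⟩
    by_contra! hcon
    have X' : (x + β) / 2 ∈ Ioo 0 β := ⟨by linarith [hx.1], by linarith [hx.2]⟩
    have := h.marginal₁ x hx y hy _ X' _ (QY hm) (by linarith [hx.2])
      (by rw [hf₁ x hx y hy]; linarith [h.nonneg₂ x hx y hy]) (hpos _ X' _ hm)
    linarith [hz _ X' _ hm]
  right
  have hlt₂ : ∀ x ∈ Ioo β B, ∀ y ∈ Ioo b B, f₂ x y < f₁₂ x y :=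
    fun x hx y hy => (hβ x (QX hx) y hy).2 hx.1
  obtain ⟨l, hl, d, c, H⟩ := exists_common_slope₂ (u := fun x y => f₁₂ x y - f₂ x y) (v := f₂)
    hβB hbB (half_pos hε)
    (fun x hx y hy x' hx' y' hy' => hu x (QX hx) y hy x' (QX hx') y' hy')
    (fun x hx y hy x' hx' y' hy' => h.mono₂ x (QX hx) y (QY hy) x' (QX hx') y' (QY hy'))
    (h.increments_of_noGap₁ hM hb0 hβ0
      (fun x hx y hy x' hx' y' hy' => hu x (QX hx) y hy x' (QX hx') y' hy')
      (fun x hx => hlt₁ x (QX hx)) hlt₂)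
    (h.increments_of_noGap₂ hM hb0 hβ0
      (fun x hx y hy x' hx' y' hy' => hu x (QX hx) y hy x' (QX hx') y' hy')
      (fun x hx => hlt₁ x (QX hx)) hlt₂)
  have hf₂ : ∀ x ∈ Ioo 0 B, ∀ y ∈ Ioo b B, f₂ x y = l * y + c :=
    h.extend_affine₂ hβ0 le_rfl hb0 le_rfl hβB fun x hx y hy => (H x hx y hy).2
  have hg : ∀ x ∈ Ioo β B, ∀ y ∈ Ioo b B, f₁₂ x y - f₂ x y = l * x + d :=
    fun x hx y hy => (H x hx y hy).1
  -- A jump of `f₁₂ - f₂` at `β` contradicts `mono₁₂`: crossing `β` to the left while raising `y` by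
  -- at most `e` can increase the sum, but `f₁₂` loses the jump and regains at most `l * e`.
  have hlβ : 0 < β → l * β + d ≤ 0 := by
    intro hβ1
    by_contra! hj
    obtain ⟨e, he, he1, he2⟩ := exists_small (lt_min hj (half_pos hε)) hl
      (min β (min (B - β) ((B - b) / 2)))
      (lt_min hβ1 (lt_min (by linarith) (by linarith)))
    have d1 := he1.trans_le (min_le_left _ _)
    have d2 := he1.trans_le ((min_le_right _ _).trans (min_le_left _ _))
    have d3 := he1.trans_le ((min_le_right _ _).trans (min_le_right _ _))
    have k1 := he2.trans_le (min_le_left _ _)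
    have k2 := he2.trans_le (min_le_right _ _)
    obtain ⟨x, hx, y, hy, hk⟩ := hM β (β + e / 8) ((b + B) / 2) ((b + B) / 2 + e / 8) (ε / 4)
      hβ0 (by linarith) (by linarith) (by linarith) (by linarith) (by linarith) (by linarith)
    obtain ⟨x', hx', y', hy', hk'⟩ := hM (β - e / 8) β ((b + B) / 2 + e / 2) ((b + B) / 2 + e)
      (ε / 4) (by linarith) (by linarith) (by linarith) (by linarith) (by linarith) (by linarith)
      (by linarith)
    have X : x ∈ Ioo β B := ⟨hx.1, by linarith [hx.2]⟩
    have Y : y ∈ Ioo b B := ⟨by linarith [hy.1], by linarith [hy.2]⟩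
    have X' : x' ∈ Ioo 0 B := ⟨by linarith [hx'.1], by linarith [hx'.2]⟩
    have Y' : y' ∈ Ioo b B := ⟨by linarith [hy'.1], by linarith [hy'.2]⟩
    have e0 : f₁₂ x' y' = f₂ x' y' :=
      le_antisymm (not_lt.1 ((hβ x' X' y' Y').1 hx'.2)) (h.le₂ x' X' y' (QY Y'))
    have e1 := hf₂ x (QX X) y Y
    have e2 := hf₂ x' X' y' Y'
    have e3 := hg x X y Y
    have l1 : l * (y' - y) ≤ l * e :=
      mul_le_mul_of_nonneg_left (by linarith [hy.1, hy'.2]) hl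
    have l2 : l * β ≤ l * x := mul_le_mul_of_nonneg_left hx.1.le hl
    have := h.mono₁₂ x (QX X) y (QY Y) x' X' y' (QY Y')
      (by linarith [hx.2, hy.2, hx'.1, hy'.1]) (hlt₁ x (QX X) y Y) (hlt₂ x X y Y)
      (by linarith [hlt₂ x X y Y]) (by linarith) (by linarith) (by linarith)
    linarith
  have f₁_le : ∀ x ∈ Ioo β B, ∀ y ∈ Ioo 0 B, f₁ x y ≤ l * x + d := by
    intro x hx y hy
    refine le_affine_of_forall_right hx.2 fun z hz => le_of_forall_pos_le_add fun η hη => ?_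
    obtain ⟨x', hx', y', hy', hk⟩ := hM x z b B η (QX hx).1.le hz.1 hz.2.le hb0 hbB le_rfl hη
    have X' : x' ∈ Ioo β B := ⟨hx.1.trans hx'.1, hx'.2.trans hz.2⟩
    have m1 := h.mono₁ x (QX hx) y hy x' (QX X') y' (QY hy') hx'.1
    have l1 : l * x' ≤ l * z := mul_le_mul_of_nonneg_left hx'.2.le hl
    linarith [hg x' X' y' hy']
  -- The same argument at `b`; below the strip `f₁₂` is bounded by `f₁_le` and `marginal₁`.
  have hlb : 0 < b → l * b + c ≤ 0 := by
    intro hb1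
    by_contra! hj
    obtain ⟨e, he, he1, he2⟩ := exists_small (half_pos (lt_min hj hε)) hl
      (min b (min (B - b) ((B - β) / 2)))
      (lt_min hb1 (lt_min (by linarith) (by linarith)))
    have d1 := he1.trans_le (min_le_left _ _)
    have d2 := he1.trans_le ((min_le_right _ _).trans (min_le_left _ _))
    have d3 := he1.trans_le ((min_le_right _ _).trans (min_le_right _ _))
    have k1 := min_le_left (l * b + c) ε
    have k2 := min_le_right (l * b + c) ε
    obtain ⟨x, hx, y, hy, hk⟩ := hM ((β + B) / 2 - e) ((β + B) / 2 - e / 2) b (b + e / 8) (ε / 4)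
      (by linarith) (by linarith) (by linarith) (by linarith) (by linarith) (by linarith)
      (by linarith)
    obtain ⟨x', hx', y', hy', hk'⟩ := hM ((β + B) / 2) ((β + B) / 2 + e / 8) (b - e / 8) b
      (ε / 4) (by linarith) (by linarith) (by linarith) (by linarith) (by linarith) (by linarith)
      (by linarith)
    have X : x ∈ Ioo β B := ⟨by linarith [hx.1], by linarith [hx.2]⟩
    have Y : y ∈ Ioo b B := ⟨by linarith [hy.1], by linarith [hy.2]⟩
    have X' : x' ∈ Ioo β B := ⟨by linarith [hx'.1], by linarith [hx'.2]⟩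
    have Y' : y' ∈ Ioo 0 B := ⟨by linarith [hy'.1], by linarith [hy'.2]⟩
    have e0 := (hb x' (QX X') y' Y').1 hy'.2
    have e1 := hf₂ x (QX X) y Y
    have e3 := hg x X y Y
    have e4 := f₁_le x' X' y' Y'
    have l1 : l * (x' - x) ≤ l * (2 * e) :=
      mul_le_mul_of_nonneg_left (by linarith [hx.1, hx'.2]) hl
    have l2 : l * b ≤ l * y := mul_le_mul_of_nonneg_left hy.1.le hl
    have up : f₁₂ x' y' ≤ l * x' + d := by
      rcases (h.le₁ x' (QX X') y' Y').eq_or_lt with h1 | h1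
      · linarith
      · refine le_affine_of_forall_right X'.2 fun z hz => ?_
        have hz' : z ∈ Ioo β B := ⟨X'.1.trans hz.1, hz.2⟩
        have := h.marginal₁ x' (QX X') y' Y' z (QX hz') _ (QY hm) hz.1 h1 (hpos z (QX hz') _ hm)
        linarith [hg z hz' _ hm]
    have := h.mono₁₂ x (QX X) y (QY Y) x' (QX X') y' Y'
      (by linarith [hx.2, hy.2, hx'.1, hy'.1]) (hlt₁ x (QX X) y Y) (hlt₂ x X y Y)
      (by linarith) (by linarith [hlt₁ x (QX X) y Y]) (by linarith) (by linarith)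
    linarith
  refine ⟨l, c, d, β, ⟨hl, hb0, hbB, hβ0, hβB, hf₂, hpos, ?_, hlb, ?_, hlt₂, ?_, hlβ⟩⟩
  · intro x hx y hy hyb
    refine le_antisymm ?_ (h.nonneg₂ x hx y hy)
    refine le_trans (le_affine_of_forall_right hbB fun z hz => ?_) (hlb (hy.1.trans_le hyb))
    rw [← hf₂ x hx z hz]
    exact h.mono₂ x hx y hy x hx z (QY hz) (by linarith [hz.1])
  · intro x hx y hy
    linarith [hg x hx y hy, hf₂ x (QX hx) y hy]
  · intro x hx y hy hxβ
    refine le_antisymm ?_ (h.le₂ x hx y (QY hy))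
    have : f₁₂ x y - f₂ x y ≤ l * β + d := by
      refine le_affine_of_forall_right hβB fun z hz => ?_
      rw [← hg z hz y hy]
      exact hu x hx y hy z (QX hz) y hy (by linarith [hz.1])
    linarith [hlβ (hx.1.trans_le hxβ)]

end CriticalValues

/-! ### Classification of the critical values -/

/-- Critical values of an affine minimizer (for `l = 0`: of a constant mechanism). -/
def IsAffineType (B : ℝ) (f₁ f₂ f₁₂ : ℝ → ℝ → ℝ) : Prop :=
  ∃ l : ℝ, 0 ≤ l ∧ ∃ o₁ o₂ o₁₂, ∀ x ∈ Ioo 0 B, ∀ y ∈ Ioo 0 B, AgreesAt l o₁ o₂ o₁₂ f₁ f₂ f₁₂ x y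

/-- Critical values of an affine minimizer with a bundling tail. -/
def IsTailType (B : ℝ) (f₁ f₂ f₁₂ : ℝ → ℝ → ℝ) : Prop :=
  ∃ (l D c₁₂ : ℝ) (o₁ o₂ : Option ℝ), 0 < l ∧ 0 < D ∧ D < B ∧ 0 ≤ l * D + c₁₂ ∧
    (∀ c ∈ o₁, c ≤ -(l * D)) ∧ (∀ c ∈ o₂, c ≤ -(l * D)) ∧
    (-(l * D) ∈ o₁ ∨ -(l * D) ∈ o₂) ∧
    (∀ x ∈ Ioo 0 B, ∀ y ∈ Ioo 0 B, D < x + y → AgreesAt l o₁ o₂ (some c₁₂) f₁ f₂ f₁₂ x y) ∧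
    ∀ x ∈ Ioo 0 B, ∀ y ∈ Ioo 0 B, x + y ≤ D →
      f₁ x y = 0 ∧ f₂ x y = 0 ∧ f₁₂ x y ≤ l * D + c₁₂

/-- Critical values of a one-dimensional mechanism. -/
def IsOneDimensionalType (B : ℝ) (f₁ f₂ f₁₂ : ℝ → ℝ → ℝ) : Prop :=
  (∀ x ∈ Ioo 0 B, ∀ y ∈ Ioo 0 B, f₁ x y = 0 ∧ f₂ x y = 0) ∨
  (∀ x ∈ Ioo 0 B, ∀ y ∈ Ioo 0 B, f₁ x y = 0 ∧ f₁₂ x y = f₂ x y) ∨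
  (∀ x ∈ Ioo 0 B, ∀ y ∈ Ioo 0 B, f₂ x y = 0 ∧ f₁₂ x y = f₁ x y)

/-- The critical values are of one of the three types. -/
def IsClassified (B : ℝ) (f₁ f₂ f₁₂ : ℝ → ℝ → ℝ) : Prop :=
  IsAffineType B f₁ f₂ f₁₂ ∨ IsTailType B f₁ f₂ f₁₂ ∨ IsOneDimensionalType B f₁ f₂ f₁₂

theorem IsClassified.of_swap {B : ℝ} {f₁ f₂ f₁₂ : ℝ → ℝ → ℝ}
    (h : IsClassified B (fun x y => f₂ y x) (fun x y => f₁ y x) (fun x y => f₁₂ y x)) :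
    IsClassified B f₁ f₂ f₁₂ := by
  rcases h with ⟨l, hl, o₁, o₂, o₁₂, h⟩ | ⟨l, D, c, o₁, o₂, hl, hD, hDB, h0, h1, h2, h3, h4, h5⟩ |
    h | h | h
  · exact Or.inl ⟨l, hl, o₂, o₁, o₁₂, fun x hx y hy => agreesAt_swap (h y hy x hx)⟩
  · refine Or.inr (Or.inl ⟨l, D, c, o₂, o₁, hl, hD, hDB, h0, h2, h1, h3.symm,
      fun x hx y hy hlt => agreesAt_swap (h4 y hy x hx (by linarith)), fun x hx y hy hle => ?_⟩)
    obtain ⟨h6, h7, h8⟩ := h5 y hy x hx (by linarith)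
    exact ⟨h7, h6, h8⟩
  · exact Or.inr (Or.inr (Or.inl fun x hx y hy => (h y hy x hx).symm))
  · exact Or.inr (Or.inr (Or.inr (Or.inr fun x hx y hy => h y hy x hx)))
  · exact Or.inr (Or.inr (Or.inr (Or.inl fun x hx y hy => h y hy x hx)))

namespace StripData

variable {B l c d b β : ℝ} {f₁ f₂ f₁₂ : ℝ → ℝ → ℝ}

theorem agrees₂ (S : StripData B f₁ f₂ f₁₂ l c d b β) :
    ∀ x ∈ Ioo 0 B, ∀ y ∈ Ioo 0 B, Agrees (some c) (l * y) (f₂ x y) (0 < f₂ x y) := by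
  intro x hx y hy
  rcases le_or_gt y b with hyb | hyb
  · have h1 := S.zero₂ x hx y hy hyb
    have h2 := S.threshold (hy.1.trans_le hyb)
    have h3 : l * y ≤ l * b := mul_le_mul_of_nonneg_left hyb S.l_nonneg
    refine ⟨fun hpos => absurd hpos (by rw [h1]; exact lt_irrefl _), fun c hc => ?_⟩
    obtain rfl := Option.mem_some.1 hc
    linarith
  · have h1 := S.eq₂ x hx y ⟨hyb, hy.2⟩
    exact ⟨fun _ => ⟨c, rfl, h1⟩, fun c hc => by obtain rfl := Option.mem_some.1 hc; exact h1.ge⟩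

theorem agrees₁₂ (S : StripData B f₁ f₂ f₁₂ l c d b β) :
    ∀ x ∈ Ioo 0 B, ∀ y ∈ Ioo b B, Agrees (some (c + d)) (l * (x + y)) (f₁₂ x y)
      (f₁ x y < f₁₂ x y ∧ f₂ x y < f₁₂ x y) := by
  intro x hx y hy
  rcases le_or_gt x β with hxβ | hxβ
  · have h1 := S.zero₁₂ x hx y hy hxβ
    have h2 := S.threshold₁₂ (hx.1.trans_le hxβ)
    have h3 : l * x ≤ l * β := mul_le_mul_of_nonneg_left hxβ S.l_nonneg
    refine ⟨fun hpos => absurd hpos.2 (by rw [h1]; exact lt_irrefl _), fun c hc => ?_⟩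
    obtain rfl := Option.mem_some.1 hc
    linarith [S.eq₂ x hx y hy]
  · have h1 := S.eq₁₂ x ⟨hxβ, hx.2⟩ y hy
    exact ⟨fun _ => ⟨_, rfl, h1⟩, fun c hc => by obtain rfl := Option.mem_some.1 hc; exact h1.ge⟩

end StripData

namespace CriticalValues

variable {B ε : ℝ} {f₁ f₂ f₁₂ : ℝ → ℝ → ℝ}

/-- Where only `∅` and `12` are allocated, but `(x, y)` can be compared with bids on the strip. -/
theorem agrees₁₂_of_stripData (h : CriticalValues B ε f₁ f₂ f₁₂) {l c d b β a : ℝ}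
    (S : StripData B f₁ f₂ f₁₂ l c d b β)
    (hf₁ : ∀ x ∈ Ioo 0 B, ∀ y ∈ Ioo 0 B, x ≤ a → f₁ x y = 0) {x y : ℝ} (hx : x ∈ Ioo 0 B)
    (hy : y ∈ Ioo 0 B) (hxa : x ≤ a) (hyb : y ≤ b) (hβ : 0 < β ∨ b < x + y) :
    Agrees (some (c + d)) (l * (x + y)) (f₁₂ x y) (f₁ x y < f₁₂ x y ∧ f₂ x y < f₁₂ x y) := by
  have hε := h.ε_pos
  have hb1 : 0 < b := hy.1.trans_le hyb
  have hb := S.threshold hb1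
  have hl := S.l_nonneg
  have hβ0 := S.β_nonneg
  have hbB := S.b_lt
  have hβB := S.β_lt
  have z1 := hf₁ x hx y hy hxa
  have z2 := S.zero₂ x hx y hy hyb
  have z3 := h.le₁ x hx y hy
  -- Up to the sum `β + b` the affine value is nonpositive and `f₁₂` must vanish; beyond it, strip
  -- points of nearly the same sum sandwich `f₁₂`.
  rcases le_or_gt (x + y) (β + b) with hle | hgt
  · have hβ1 : 0 < β := by
      rcases hβ with h1 | h1
      · exact h1
      · linarith
    have hlβ := S.threshold₁₂ hβ1
    have hraw : l * (x + y) ≤ l * (β + b) := mul_le_mul_of_nonneg_left hle hl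
    have left : ∀ x ∈ Ioo 0 B, ∀ y ∈ Ioo 0 B, x ≤ a → y ≤ b → x < β → f₁₂ x y = f₂ x y := by
      intro x hx y hy hxa hyb hxβ
      refine le_antisymm ?_ (h.le₂ x hx y hy)
      by_contra! hcon
      have X' : (x + β) / 2 ∈ Ioo 0 B := ⟨by linarith [hx.1], by linarith⟩
      have hm : (b + B) / 2 ∈ Ioo b B := ⟨by linarith, by linarith⟩
      have M : (b + B) / 2 ∈ Ioo 0 B := ⟨by linarith, by linarith⟩
      have h1 := h.marginal₁ x hx y hy _ X' _ M (by linarith)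
        (by rw [hf₁ x hx y hy hxa]; linarith [h.nonneg₂ x hx y hy]) (S.pos₂ _ X' _ hm)
      linarith [S.zero₁₂ _ X' _ hm (by linarith)]
    have key : f₁₂ x y ≤ 0 := by
      by_contra! hpos
      rcases lt_or_ge x β with hxβ | hxβ
      · linarith [left x hx y hy hxa hyb hxβ]
      · obtain ⟨e, he, he1, he2⟩ := exists_small (lt_min hε hpos) hl
          (min (β / 2) ((B - b) / 4)) (lt_min (by linarith) (by linarith))
        have d1 := he1.trans_le (min_le_left _ _)
        have d2 := he1.trans_le (min_le_right _ _)
        have k1 := he2.trans_le (min_le_left _ _)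
        have k2 := he2.trans_le (min_le_right _ _)
        -- This point has a sum larger by `e / 4`, lies left of `β`, where `f₁₂ = f₂`, and lies
        -- below height `b + e`, where `f₂ ≤ l * e`.
        have X' : β - e / 4 ∈ Ioo 0 B := ⟨by linarith, by linarith⟩
        have Y' : x + y - β + e / 2 ∈ Ioo 0 B := ⟨by linarith [hy.1], by linarith⟩
        have e1 := hf₁ _ X' _ Y' (by linarith)
        have hle0 : 0 ≤ l * e := mul_nonneg hl he.le
        have e2 : f₂ (β - e / 4) (x + y - β + e / 2) ≤ l * e ∧
            f₁₂ (β - e / 4) (x + y - β + e / 2) = f₂ (β - e / 4) (x + y - β + e / 2) := by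
          rcases le_or_gt (x + y - β + e / 2) b with h1 | h1
          · exact ⟨by rw [S.zero₂ _ X' _ Y' h1]; exact hle0,
              left _ X' _ Y' (by linarith) h1 (by linarith)⟩
          · refine ⟨?_, S.zero₁₂ _ X' _ ⟨h1, Y'.2⟩ (by linarith)⟩
            rw [S.eq₂ _ X' _ ⟨h1, Y'.2⟩]
            have : l * (x + y - β + e / 2) ≤ l * (b + e) :=
              mul_le_mul_of_nonneg_left (by linarith) hl
            linarith
        have := h.mono₁₂ x hx y hy _ X' _ Y' (by linarith) (by linarith) (by linarith)
          (by linarith) (by linarith) (by linarith) (by linarith)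
        linarith
    refine ⟨fun hact => by linarith [hact.1], fun c' hc => ?_⟩
    obtain rfl := Option.mem_some.1 hc
    linarith
  -- Within `m` above `b` one has `f₂ < ε`, so `mono₁₂` applies across the lower edge of the strip.
  · obtain ⟨m, hm, hm1, hm2⟩ := exists_small hε hl (min ((x + y - β - b) / 2) ((B - b) / 2))
      (lt_min (by linarith) (by linarith))
    have d1 := hm1.trans_le (min_le_left _ _)
    have d2 := hm1.trans_le (min_le_right _ _)
    have point : ∀ z ∈ Ioo b (b + m), ∀ w ∈ Ioo β x, w ∈ Ioo 0 B ∧ z ∈ Ioo 0 B ∧ f₁ w z = 0 ∧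
        0 < f₂ w z ∧ f₂ w z < ε ∧ f₂ w z < f₁₂ w z ∧ f₁₂ w z = l * (w + z) + (c + d) := by
      intro z hz w hw
      have W : w ∈ Ioo β B := ⟨hw.1, hw.2.trans hx.2⟩
      have Z : z ∈ Ioo b B := ⟨hz.1, by linarith [hz.2]⟩
      have W' : w ∈ Ioo 0 B := ⟨by linarith [hw.1], W.2⟩
      have Z' : z ∈ Ioo 0 B := ⟨by linarith [hz.1], Z.2⟩
      refine ⟨W', Z', hf₁ w W' z Z' (by linarith [hw.2]), S.pos₂ w W' z Z, ?_, S.pos₁₂ w W z Z,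
        S.eq₁₂ w W z Z⟩
      rw [S.eq₂ w W' z Z]
      have : l * z ≤ l * (b + m) := mul_le_mul_of_nonneg_left hz.2.le hl
      linarith
    refine ⟨fun hact => ⟨_, rfl, le_antisymm ?_ ?_⟩, fun c' hc => ?_⟩
    · refine le_affine_of_forall_right (b := x + y + m / 4) (by linarith) fun z hz => ?_
      have hZ : b + m / 2 ∈ Ioo b (b + m) := ⟨by linarith, by linarith⟩
      have hW : z - (b + m / 2) ∈ Ioo β x := ⟨by linarith [hz.1], by linarith [hz.2]⟩
      obtain ⟨W, Z, p1, p2, p3, p4, p5⟩ := point _ hZ _ hW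
      have := h.mono₁₂ x hx y hy _ W _ Z (by linarith [hz.1]) hact.1 hact.2
        (by linarith) (by linarith) (by linarith) (by linarith)
      rw [p5, sub_add_cancel] at this
      exact this
    all_goals
      try obtain rfl := Option.mem_some.1 hc
      refine affine_le_of_forall_left (a := x + y - m / 4) (by linarith) fun z hz => ?_
      have hZ : b + m / 2 ∈ Ioo b (b + m) := ⟨by linarith, by linarith⟩
      have hW : z - (b + m / 2) ∈ Ioo β x := ⟨by linarith [hz.1], by linarith [hz.2]⟩
      obtain ⟨W, Z, p1, p2, p3, p4, p5⟩ := point _ hZ _ hW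
      have := h.mono₁₂ _ W _ Z x hx y hy (by linarith [hz.2]) (by linarith) p4
        (by linarith) (by linarith) (by linarith) (by linarith)
      rw [p5, sub_add_cancel] at this
      exact this

/-- Only bids with `x + y ≤ b` can escape the affine form. If `β > 0`, then `f₁₂` vanishes there. If
`β = 0 < b`, no strip bid has so small a sum, and these bids form the bundling tail with `D = b`. -/
theorem isClassified_of_stripData (h : CriticalValues B ε f₁ f₂ f₁₂) {l c d b β a : ℝ}
    {o₁ : Option ℝ} (S : StripData B f₁ f₂ f₁₂ l c d b β) (hba : b ≤ a)
    (hf₁ : ∀ x ∈ Ioo 0 B, ∀ y ∈ Ioo 0 B, x ≤ a → f₁ x y = 0)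
    (A₁ : ∀ x ∈ Ioo 0 B, ∀ y ∈ Ioo 0 B, Agrees o₁ (l * x) (f₁ x y) (0 < f₁ x y))
    (ho₁ : 0 < b → ∀ c ∈ o₁, c ≤ -(l * b))
    (A₁₂ : ∀ x ∈ Ioo 0 B, ∀ y ∈ Ioo 0 B, a < x → Agrees (some (c + d)) (l * (x + y)) (f₁₂ x y)
      (f₁ x y < f₁₂ x y ∧ f₂ x y < f₁₂ x y)) :
    IsClassified B f₁ f₂ f₁₂ := by
  have hε := h.ε_pos
  have hl := S.l_nonneg
  have hb0 := S.b_nonneg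
  have hbB := S.b_lt
  have hβ0 := S.β_nonneg
  have agr : ∀ x ∈ Ioo 0 B, ∀ y ∈ Ioo 0 B, 0 < β ∨ b < x + y →
      AgreesAt l o₁ (some c) (some (c + d)) f₁ f₂ f₁₂ x y := by
    intro x hx y hy hxy
    refine ⟨A₁ x hx y hy, S.agrees₂ x hx y hy, ?_⟩
    rcases lt_or_ge b y with hyb | hyb
    · exact S.agrees₁₂ x hx y ⟨hyb, hy.2⟩
    rcases lt_or_ge a x with hxa | hxa
    · exact A₁₂ x hx y hy hxa
    · exact h.agrees₁₂_of_stripData S hf₁ hx hy hxa hyb hxy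
  rcases hβ0.lt_or_eq with hβ1 | rfl
  · exact Or.inl ⟨l, hl, _, _, _, fun x hx y hy => agr x hx y hy (Or.inl hβ1)⟩
  rcases hb0.lt_or_eq with hb1 | rfl
  swap
  · exact Or.inl ⟨l, hl, _, _, _,
      fun x hx y hy => agr x hx y hy (Or.inr (by linarith [hx.1, hy.1]))⟩
  have hb := S.threshold hb1
  have hB2 : B / 2 ∈ Ioo 0 B := ⟨by linarith [h.B_pos], by linarith [h.B_pos]⟩
  have hm : (b + B) / 2 ∈ Ioo b B := ⟨by linarith, by linarith⟩
  have hl' : 0 < l := by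
    have h1 := S.pos₂ _ hB2 _ hm
    rw [S.eq₂ _ hB2 _ hm] at h1
    by_contra hneg
    have : l = 0 := le_antisymm (not_lt.1 hneg) hl
    subst this
    linarith
  -- With `hb` this gives `-c = l * b`: the constant of the bundle `2` equals the end of the tail.
  have hb' : 0 ≤ l * b + c := by
    refine le_affine_of_forall_right hbB fun z hz => ?_
    rw [← S.eq₂ _ hB2 z hz]
    exact (S.pos₂ _ hB2 z hz).le
  have hd : 0 ≤ l * 0 + d := by
    refine le_affine_of_forall_right h.B_pos fun z hz => ?_
    have := S.pos₁₂ z hz _ hm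
    rw [S.eq₂ z hz _ hm, S.eq₁₂ z hz _ hm] at this
    linarith
  have hc : c = -(l * b) := by linarith
  refine Or.inr (Or.inl ⟨l, b, c + d, o₁, some c, hl', hb1, hbB, by linarith, ho₁ hb1, ?_,
    Or.inr (by rw [← hc]; rfl), fun x hx y hy hlt => agr x hx y hy (Or.inr hlt),
    fun x hx y hy hle => ?_⟩)
  · intro c' hc'
    obtain rfl := Option.mem_some.1 hc'
    exact hc.le
  · have z1 := hf₁ x hx y hy (by linarith [hy.1])
    have z2 := S.zero₂ x hx y hy (by linarith [hx.1])
    refine ⟨z1, z2, ?_⟩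
    rcases (h.le₁ x hx y hy).eq_or_lt with h1 | h1
    · linarith
    obtain ⟨m, hm, hm1, hm2⟩ := exists_small hε hl (min b (B - b)) (lt_min hb1 (by linarith))
    have d1 := hm1.trans_le (min_le_left _ _)
    have d2 := hm1.trans_le (min_le_right _ _)
    -- The comparison point is the strip bid near `(0, b)` with sum `z`; then `z` tends to `b`.
    refine le_affine_of_forall_right (b := b + m) (by linarith) fun z hz => ?_
    have W : (z - b) / 2 ∈ Ioo 0 B := ⟨by linarith [hz.1], by linarith [hz.2]⟩
    have Z : b + (z - b) / 2 ∈ Ioo b B := ⟨by linarith [hz.1], by linarith [hz.2]⟩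
    have Z' : b + (z - b) / 2 ∈ Ioo 0 B := ⟨by linarith [Z.1], Z.2⟩
    have p1 := hf₁ _ W _ Z' (by linarith [hz.2])
    have p2 := S.eq₂ _ W _ Z
    have p3 := S.eq₁₂ _ W _ Z
    have p4 := S.pos₁₂ _ W _ Z
    have l1 : l * (b + (z - b) / 2) ≤ l * (b + m) :=
      mul_le_mul_of_nonneg_left (by linarith [hz.1, hz.2]) hl
    have := h.mono₁₂ x hx y hy _ W _ Z' (by linarith [hz.1]) h1 (by linarith)
        (by linarith) (by linarith) (by linarith) (by linarith)
    rw [p3] at this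
    convert this using 2
    ring

/-- The case in which each of the bundles `1`, `2` is allocated for some bids. -/
theorem isClassified_of_stripData₂ (h : CriticalValues B ε f₁ f₂ f₁₂)
    {l c d b β l' c' d' a β' : ℝ} (S : StripData B f₁ f₂ f₁₂ l c d b β)
    (S' : StripData B (fun x y => f₂ y x) (fun x y => f₁ y x) (fun x y => f₁₂ y x) l' c' d' a β')
    (hba : b ≤ a) : IsClassified B f₁ f₂ f₁₂ := by
  have hy : max b β' < B := max_lt S.b_lt S'.β_lt
  have hY : (max b β' + B) / 2 ∈ Ioo (max b β') B := ⟨by linarith, by linarith⟩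
  -- On the overlap of the two strips `f₁₂` has both affine forms.
  obtain ⟨rfl, hcd⟩ := affine_unique (a := max β a) (b := B) (l := l) (l' := l')
    (c := l * ((max b β' + B) / 2) + (c + d)) (c' := l' * ((max b β' + B) / 2) + (c' + d'))
    (max_lt S.β_lt S'.b_lt) (fun x hx => by
      have e1 := S.eq₁₂ x ⟨(le_max_left _ _).trans_lt hx.1, hx.2⟩ ((max b β' + B) / 2)
        ⟨(le_max_left _ _).trans_lt hY.1, hY.2⟩
      have e2 := S'.eq₁₂ ((max b β' + B) / 2) ⟨(le_max_right _ _).trans_lt hY.1, hY.2⟩ x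
        ⟨(le_max_right _ _).trans_lt hx.1, hx.2⟩
      linarith)
  have hcd' : c + d = c' + d' := by linarith
  refine h.isClassified_of_stripData (o₁ := some c') S hba
    (fun x hx y hy hxa => S'.zero₂ y hy x hx hxa) (fun x hx y hy => S'.agrees₂ y hy x hx)
    (fun hb1 c'' hc => ?_) (fun x hx y hy hxa => ?_)
  · obtain rfl := Option.mem_some.1 hc
    have h1 := S'.threshold (hb1.trans_le hba)
    have h2 : l * b ≤ l * a := mul_le_mul_of_nonneg_left hba S.l_nonneg
    linarith
  · obtain ⟨h1, h2⟩ := S'.agrees₁₂ y hy x ⟨hxa, hx.2⟩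
    rw [hcd', add_comm x y]
    exact ⟨fun hact => h1 ⟨hact.2, hact.1⟩, h2⟩

/-- A threshold equal to `B` means that the price is identically `0`. If both thresholds are below
`B`, the smaller one is the possible end of the tail, so the tasks may be named such that `b ≤ a`.
-/
theorem isClassified_of_noGap (h : CriticalValues B ε f₁ f₂ f₁₂) (hM : NoGap B f₁ f₂ f₁₂) :
    IsClassified B f₁ f₂ f₁₂ := by
  have single : ∀ {f₁ f₂ f₁₂ : ℝ → ℝ → ℝ} (_ : CriticalValues B ε f₁ f₂ f₁₂)
      (_ : ∀ x ∈ Ioo 0 B, ∀ y ∈ Ioo 0 B, f₁ x y = 0) {l c d b β : ℝ}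
      (_ : StripData B f₁ f₂ f₁₂ l c d b β), IsClassified B f₁ f₂ f₁₂ := by
    intro f₁ f₂ f₁₂ h h0 l c d b β S
    refine h.isClassified_of_stripData (o₁ := none) (a := B) S S.b_lt.le
      (fun x hx y hy _ => h0 x hx y hy) (fun x hx y hy => ⟨fun hpos => ?_, by simp⟩) (by simp)
      (fun x hx y hy hlt => absurd hx.2 (not_lt.2 hlt.le))
    rw [h0 x hx y hy] at hpos
    exact absurd hpos (lt_irrefl _)
  obtain ⟨a, ⟨ha0, haB⟩, ha⟩ := h.exists_threshold₁
  obtain ⟨b, ⟨hb0, hbB⟩, hb⟩ := h.exists_threshold₂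
  rcases haB.eq_or_lt with rfl | haB
  · have hf₁ : ∀ x ∈ Ioo 0 a, ∀ y ∈ Ioo 0 a, f₁ x y = 0 := fun x hx y hy => (ha x hx y hy).1 hx.2
    rcases hbB.eq_or_lt with rfl | hbB
    · exact Or.inr (Or.inr (Or.inl fun x hx y hy => ⟨hf₁ x hx y hy, (hb x hx y hy).1 hy.2⟩))
    rcases h.exists_stripData hM hb0 hbB hb with h1 | ⟨l, c, d, β, S⟩
    · exact Or.inr (Or.inr (Or.inr (Or.inl h1)))
    · exact single h hf₁ S
  rcases h.swap.exists_stripData hM.swap ha0 haB (fun y hy x hx => ha x hx y hy) with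
    h1 | ⟨l', c', d', β', S'⟩
  · exact Or.inr (Or.inr (Or.inr (Or.inr fun x hx y hy => h1 y hy x hx)))
  rcases hbB.eq_or_lt with rfl | hbB
  · exact IsClassified.of_swap (single h.swap (fun y hy x hx => (hb x hx y hy).1 hy.2) S')
  rcases h.exists_stripData hM hb0 hbB hb with h1 | ⟨l, c, d, β, S⟩
  · exact Or.inr (Or.inr (Or.inr (Or.inl h1)))
  rcases le_total b a with hba | hab
  · exact h.isClassified_of_stripData₂ S S' hba
  · exact IsClassified.of_swap (h.swap.isClassified_of_stripData₂ S' S hab)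

theorem isClassified (h : CriticalValues B ε f₁ f₂ f₁₂) : IsClassified B f₁ f₂ f₁₂ := by
  by_cases hM : NoGap B f₁ f₂ f₁₂
  · exact h.isClassified_of_noGap hM
  · unfold NoGap at hM
    push Not at hM
    obtain ⟨p, q, r, s, κ, hp, hpq, hq, hr, hrs, hs, hκ, hk⟩ := hM
    exact Or.inl (h.exists_agreesAt_of_gap hp hpq hq hr hrs hs hκ fun x hx y hy =>
      (hk x hx y hy).le)

end CriticalValues

/-! ### Prices for a weakly monotone allocation -/

/-- The bundle after renaming the tasks. -/
def Bundle.swap : Bundle → Bundle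
  | .empty => .empty
  | .one => .two
  | .two => .one
  | .both => .both

/-- A weakly monotone allocation `a` on a domain `V` of valuations described by their excess
`x₁ + x₂ - x₁₂`, with the critical values `f₁, f₂` of the bundles `1, 2` against `∅`. -/
structure SingleCritical (V : Set Bid) (a : Bid → Bundle) (f₁ f₂ : ℝ) : Prop where
  mono : ∀ {x y z}, (x, y, z) ∈ V → 0 ≤ x ∧ 0 ≤ y ∧ x ≤ z ∧ y ≤ z
  -- The excess may move towards `0`, or slightly above the larger of itself and `0`. All four
  -- domains leave this room, and the test bids below need no more.
  step : ∀ {x y z}, (x, y, z) ∈ V → ∃ δ > 0, ∀ x' y' z', 0 ≤ x' → 0 ≤ y' → x' ≤ z' → y' ≤ z' →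
    min (x + y - z) 0 ≤ x' + y' - z' → x' + y' - z' < max (x + y - z) 0 + δ → (x', y', z') ∈ V
  wmon_empty_both : ∀ {x y z x' y' z'}, (x, y, z) ∈ V → (x', y', z') ∈ V →
    a (x, y, z) = .empty → a (x', y', z') = .both → z' ≤ z
  wmon_one_two : ∀ {x y z x' y' z'}, (x, y, z) ∈ V → (x', y', z') ∈ V →
    a (x, y, z) = .one → a (x', y', z') = .two → x - y ≤ x' - y'
  wmon_one_both : ∀ {x y z x' y' z'}, (x, y, z) ∈ V → (x', y', z') ∈ V →
    a (x, y, z) = .one → a (x', y', z') = .both → z' - x' ≤ z - x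
  wmon_two_both : ∀ {x y z x' y' z'}, (x, y, z) ∈ V → (x', y', z') ∈ V →
    a (x, y, z) = .two → a (x', y', z') = .both → z' - y' ≤ z - y
  nonneg₁ : 0 ≤ f₁
  nonneg₂ : 0 ≤ f₂
  le_of_empty₁ : ∀ {x y z}, (x, y, z) ∈ V → a (x, y, z) = .empty → f₁ ≤ x
  le_of_empty₂ : ∀ {x y z}, (x, y, z) ∈ V → a (x, y, z) = .empty → f₂ ≤ y
  le_of_one : ∀ {x y z}, (x, y, z) ∈ V → a (x, y, z) = .one → x ≤ f₁
  le_of_two : ∀ {x y z}, (x, y, z) ∈ V → a (x, y, z) = .two → y ≤ f₂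
  exists_one : ∀ r, 0 ≤ r → r < f₁ → ∃ x y z, (x, y, z) ∈ V ∧ a (x, y, z) = .one ∧ r < x
  exists_two : ∀ r, 0 ≤ r → r < f₂ → ∃ x y z, (x, y, z) ∈ V ∧ a (x, y, z) = .two ∧ r < y

theorem Bundle.swap_eq_iff {α β : Bundle} : α.swap = β ↔ α = β.swap := by
  cases α <;> cases β <;> simp [Bundle.swap]

namespace SingleCritical

variable {V : Set Bid} {a : Bid → Bundle} {f₁ f₂ : ℝ}

theorem swap (S : SingleCritical V a f₁ f₂) :
    SingleCritical {p | (p.2.1, p.1, p.2.2) ∈ V} (fun p => (a (p.2.1, p.1, p.2.2)).swap) f₂ f₁ := by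
  constructor
  case mono =>
    intro x y z h
    obtain ⟨h1, h2, h3, h4⟩ := S.mono h
    exact ⟨h2, h1, h4, h3⟩
  case step =>
    intro x y z h
    obtain ⟨δ, hδ, H⟩ := S.step h
    refine ⟨δ, hδ, fun x' y' z' h1 h2 h3 h4 h5 h6 => H y' x' z' h2 h1 h4 h3 ?_ ?_⟩
    · rwa [add_comm y x, add_comm y' x']
    · rwa [add_comm y x, add_comm y' x']
  case nonneg₁ => exact S.nonneg₂
  case nonneg₂ => exact S.nonneg₁
  all_goals simp only [Bundle.swap_eq_iff, mem_ofPred_eq]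
  all_goals simp only [Bundle.swap]
  case wmon_empty_both => exact S.wmon_empty_both
  case wmon_one_two =>
    intro x y z x' y' z' h h' h1 h2
    have := S.wmon_one_two h' h h2 h1
    linarith
  case wmon_one_both => exact S.wmon_two_both
  case wmon_two_both => exact S.wmon_one_both
  case le_of_empty₁ => exact S.le_of_empty₂
  case le_of_empty₂ => exact S.le_of_empty₁
  case le_of_one => exact S.le_of_two
  case le_of_two => exact S.le_of_one
  case exists_one =>
    intro r hr hlt
    obtain ⟨x, y, z, h⟩ := S.exists_two r hr hlt
    exact ⟨y, x, z, h⟩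
  case exists_two =>
    intro r hr hlt
    obtain ⟨x, y, z, h⟩ := S.exists_one r hr hlt
    exact ⟨y, x, z, h⟩

theorem one_le_two (S : SingleCritical V a f₁ f₂) {x y z : ℝ} (ht : (x, y, z) ∈ V)
    (h1 : a (x, y, z) = .one) : x - f₁ ≤ y - f₂ := by
  by_contra! hlt
  obtain ⟨hx, hy, hxz, hyz⟩ := S.mono ht
  have hxf := S.le_of_one ht h1
  obtain ⟨u, v, w, hu, hu2, huv⟩ := S.exists_two (y + (f₁ - x)) (by linarith) (by linarith)
  obtain ⟨δ, hδ, H⟩ := S.step ht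
  obtain ⟨η, hη, hη'⟩ := exists_between (show 0 < (v - (y + (f₁ - x))) / 3 by linarith)
  -- This bid has the same excess and can receive nothing: its first cost is above `f₁`, its second
  -- below `f₂`, its difference of the two costs is smaller than `x - y` and its marginal cost of
  -- task `2` is larger than `z - x`.
  have hmem := H (f₁ + η) (y + (f₁ - x) + 2 * η) (z + 2 * (f₁ - x) + 3 * η) (by linarith)
    (by linarith) (by linarith) (by linarith) (by linarith [min_le_left (x + y - z) 0])
    (by linarith [le_max_left (x + y - z) 0])
  cases hax : a (f₁ + η, y + (f₁ - x) + 2 * η, z + 2 * (f₁ - x) + 3 * η) with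
  | empty => linarith [S.le_of_empty₂ hmem hax, S.le_of_two hu hu2]
  | one => linarith [S.le_of_one hmem hax]
  | two => linarith [S.wmon_one_two ht hmem h1 hax]
  | both => linarith [S.wmon_one_both ht hmem h1 hax]

/-- The test bid has first cost below `f₁` (not `∅`), second cost above `y ≥ f₂` (not `2`), cost of
`12` above `z` (not `12`) and marginal cost of task `2` below `w - u` (not `1`). -/
theorem empty_le_both₁ (S : SingleCritical V a f₁ f₂) {x y z u v w : ℝ} (ht : (x, y, z) ∈ V)
    (h0 : a (x, y, z) = .empty) (hv : (u, v, w) ∈ V) (h12 : a (u, v, w) = .both) :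
    f₁ + w - u ≤ z := by
  by_contra! hlt
  obtain ⟨hx, hy, hxz, hyz⟩ := S.mono ht
  obtain ⟨hu, hv', huw, hvw⟩ := S.mono hv
  have hwz := S.wmon_empty_both ht hv h0 h12
  have hfx := S.le_of_empty₁ ht h0
  obtain ⟨δ, hδ, H⟩ := S.step ht
  obtain ⟨η, hη, hη'⟩ := exists_between (show 0 < min (min δ f₁) ((f₁ + w - u - z) / 4) from
    lt_min (lt_min hδ (by linarith)) (by linarith))
  have d1 := hη'.trans_le ((min_le_left _ _).trans (min_le_left _ _))
  have d2 := hη'.trans_le ((min_le_left _ _).trans (min_le_right _ _))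
  have d3 := hη'.trans_le (min_le_right _ _)
  obtain ⟨y', hy1, hy2, hy3, hy4⟩ : ∃ y', y < y' ∧ y' ≤ z + 2 * η ∧ 0 ≤ f₁ - η + y' - (z + 2 * η) ∧
      f₁ - η + y' - (z + 2 * η) < max (x + y - z) 0 + δ := by
    have m1 := le_max_left (x + y - z) 0
    have m2 := le_max_right (x + y - z) 0
    rcases le_total y (z - f₁) with hc | hc
    · rcases le_total (z - f₁ + 4 * η) (z + 2 * η) with hc' | hc'
      · exact ⟨z - f₁ + 4 * η, by linarith, hc', by linarith, by linarith⟩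
      · exact ⟨z + 2 * η, by linarith, le_rfl, by linarith, by linarith⟩
    · rcases le_total (y + 4 * η) (z + 2 * η) with hc' | hc'
      · exact ⟨y + 4 * η, by linarith, hc', by linarith, by linarith⟩
      · exact ⟨z + 2 * η, by linarith, le_rfl, by linarith, by linarith⟩
  have hmem := H (f₁ - η) y' (z + 2 * η) (by linarith) (by linarith) (by linarith) hy2
    ((min_le_right _ _).trans hy3) hy4
  cases hax : a (f₁ - η, y', z + 2 * η) with
  | empty => linarith [S.le_of_empty₁ hmem hax]
  | one => linarith [S.wmon_one_both hmem hv hax h12]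
  | two =>
    have h2 := S.le_of_two hmem hax
    linarith [S.le_of_empty₂ ht h0]
  | both => linarith [S.wmon_empty_both ht hmem h0 hax]

theorem empty_le_both₂ (S : SingleCritical V a f₁ f₂) {x y z u v w : ℝ} (ht : (x, y, z) ∈ V)
    (h0 : a (x, y, z) = .empty) (hv : (u, v, w) ∈ V) (h12 : a (u, v, w) = .both) :
    f₂ + w - v ≤ z :=
  S.swap.empty_le_both₁ (x := y) (y := x) (z := z) (u := v) (v := u) (w := w) ht
    (by simp only [h0, Bundle.swap]) hv (by simp only [h12, Bundle.swap])

theorem one_le_both_empty (S : SingleCritical V a f₁ f₂) {x y z u v w : ℝ} (ht : (x, y, z) ∈ V)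
    (h1 : a (x, y, z) = .one) (hv : (u, v, w) ∈ V) (h12 : a (u, v, w) = .both) :
    w - f₁ ≤ z - x := by
  by_contra! hlt
  obtain ⟨hx, hy, hxz, hyz⟩ := S.mono ht
  obtain ⟨hu, hv', huw, hvw⟩ := S.mono hv
  have hw := S.wmon_one_both ht hv h1 h12
  have h12' := S.one_le_two ht h1
  have hf := S.nonneg₁
  obtain ⟨δ, hδ, H⟩ := S.step hv
  obtain ⟨η, hη, hη'⟩ := exists_between (show 0 < min δ (w - f₁ - (z - x)) / 4 from
    div_pos (lt_min hδ (by linarith)) (by norm_num))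
  have d1 := min_le_left δ (w - f₁ - (z - x))
  have d2 := min_le_right δ (w - f₁ - (z - x))
  obtain ⟨y', hy1, hy2, hy3, hy4⟩ : ∃ y', (y' = w - η ∨ v ≤ y') ∧ y' ≤ w - η ∧
      0 ≤ f₁ + η + y' - (w - η) ∧ f₁ + η + y' - (w - η) < max (u + v - w) 0 + δ := by
    have m1 := le_max_left (u + v - w) 0
    have m2 := le_max_right (u + v - w) 0
    rcases le_total v (w - f₁) with hc | hc
    · rcases le_total (w - f₁) (w - η) with hc' | hc'
      · exact ⟨w - f₁, Or.inr hc, hc', by linarith, by linarith⟩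
      · exact ⟨w - η, Or.inl rfl, le_rfl, by linarith, by linarith⟩
    · rcases le_total v (w - η) with hc' | hc'
      · exact ⟨v, Or.inr le_rfl, hc', by linarith, by linarith⟩
      · exact ⟨w - η, Or.inl rfl, le_rfl, by linarith, by linarith⟩
  have hmem := H (f₁ + η) y' (w - η) (by linarith) (by rcases hy1 with rfl | hy1 <;> linarith)
    (by linarith) hy2 ((min_le_right _ _).trans hy3) hy4
  cases hax : a (f₁ + η, y', w - η) with
  | empty => linarith [S.wmon_empty_both hmem hv hax h12]
  | one => linarith [S.le_of_one hmem hax]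
  | two =>
    rcases hy1 with rfl | hy1
    · linarith [S.le_of_two hmem hax]
    · linarith [S.wmon_two_both hmem hv hax h12]
  | both => linarith [S.wmon_one_both ht hmem h1 hax]

/-- Bids that prefer `2` to `1`, have second cost at most `f₂` and a marginal cost of task `1` just
below `w - v` must receive `12` (`key`). One of them is incompatible with the bid that receives `1`.
-/
theorem one_le_both_two (S : SingleCritical V a f₁ f₂) {x y z u v w : ℝ} (ht : (x, y, z) ∈ V)
    (h1 : a (x, y, z) = .one) (hv : (u, v, w) ∈ V) (h12 : a (u, v, w) = .both) :
    w - v + f₂ - f₁ ≤ z - x := by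
  by_contra! hlt
  obtain ⟨hx, hy, hxz, hyz⟩ := S.mono ht
  obtain ⟨hu, hv', huw, hvw⟩ := S.mono hv
  have hw := S.wmon_one_both ht hv h1 h12
  have h12' := S.one_le_two ht h1
  have hb := S.one_le_both_empty ht h1 hv h12
  have hf := S.nonneg₁
  have hvw' : v < w := by linarith
  obtain ⟨δ, hδ, H⟩ := S.step hv
  obtain ⟨η, hη, hη'⟩ := exists_between
    (show 0 < min (min δ (w - v)) (w - v + f₂ - f₁ - (z - x)) / 4 from
      div_pos (lt_min (lt_min hδ (by linarith)) (by linarith)) (by norm_num))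
  have d1 := (min_le_left (min δ (w - v)) (w - v + f₂ - f₁ - (z - x))).trans (min_le_left _ _)
  have d2 := (min_le_left (min δ (w - v)) (w - v + f₂ - f₁ - (z - x))).trans (min_le_right _ _)
  have d3 := min_le_right (min δ (w - v)) (w - v + f₂ - f₁ - (z - x))
  have m1 := le_max_left (u + v - w) 0
  have m2 := le_max_right (u + v - w) 0
  have key : ∀ x' y', (x', y', w - v + y' - η) ∈ V → f₁ - f₂ < x' - y' → y' ≤ f₂ →
      a (x', y', w - v + y' - η) = .both := by
    intro x' y' hmem hxy hyf
    cases hax : a (x', y', w - v + y' - η) with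
    | empty => linarith [S.empty_le_both₂ hmem hax hv h12]
    | one => linarith [S.one_le_two hmem hax]
    | two => linarith [S.wmon_two_both hmem hv hax h12]
    | both => rfl
  have finish : ∀ y', v ≤ y' → y' ≤ f₂ → 0 ≤ 2 * y' - f₂ + f₁ + η - (w - v + y' - η) →
      2 * y' - f₂ + f₁ + η - (w - v + y' - η) < max (u + v - w) 0 + δ → False := by
    intro y' hy1 hy2 hy3 hy4
    have hmem := H (y' - f₂ + f₁ + η) y' (w - v + y' - η) (by linarith) (by linarith)
      (by linarith) (by linarith) ((min_le_right _ _).trans (by linarith)) (by linarith)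
    have hax := key _ _ hmem (by linarith) hy2
    linarith [S.wmon_one_both ht hmem h1 hax]
  -- The second cost is `v` if this gives nonnegative excess, else the value in `[v, f₂]` of excess
  -- `0`; failing that, it is `f₂`, with the first cost raised to reach excess `0`.
  rcases le_or_gt 0 (2 * v - f₂ + f₁ - w + 2 * η) with hc | hc
  · exact finish v le_rfl (by linarith) (by linarith) (by linarith)
  rcases le_or_gt 0 (f₁ + v - w + 2 * η) with hc' | hc'
  · exact finish (f₂ - f₁ - v + w - 2 * η) (by linarith) (by linarith) (by linarith) (by linarith)
  · have hmem := H (w - v - η) f₂ (w - v + f₂ - η) (by linarith) S.nonneg₂ (by linarith [S.nonneg₂])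
      (by linarith) ((min_le_right _ _).trans (by linarith)) (by linarith)
    have hax := key _ _ hmem (by linarith) le_rfl
    linarith [S.one_le_both_empty ht h1 hmem hax]

theorem two_le_one (S : SingleCritical V a f₁ f₂) {x y z : ℝ} (ht : (x, y, z) ∈ V)
    (h2 : a (x, y, z) = .two) : y - f₂ ≤ x - f₁ :=
  S.swap.one_le_two (x := y) (y := x) (z := z) ht (by simp only [h2, Bundle.swap])

theorem two_le_both_empty (S : SingleCritical V a f₁ f₂) {x y z u v w : ℝ} (ht : (x, y, z) ∈ V)
    (h2 : a (x, y, z) = .two) (hv : (u, v, w) ∈ V) (h12 : a (u, v, w) = .both) :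
    w - f₂ ≤ z - y :=
  S.swap.one_le_both_empty (x := y) (y := x) (z := z) (u := v) (v := u) (w := w) ht
    (by simp only [h2, Bundle.swap]) hv (by simp only [h12, Bundle.swap])

theorem two_le_both_one (S : SingleCritical V a f₁ f₂) {x y z u v w : ℝ} (ht : (x, y, z) ∈ V)
    (h2 : a (x, y, z) = .two) (hv : (u, v, w) ∈ V) (h12 : a (u, v, w) = .both) :
    w - u + f₁ - f₂ ≤ z - y :=
  S.swap.one_le_both_two (x := y) (y := x) (z := z) (u := v) (v := u) (w := w) ht
    (by simp only [h2, Bundle.swap]) hv (by simp only [h12, Bundle.swap])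

/-- A critical value of the bundle `12`. -/
theorem exists_both (S : SingleCritical V a f₁ f₂)
    (h0 : ∃ x y z, (x, y, z) ∈ V ∧ a (x, y, z) = .empty) :
    ∃ f₁₂, f₁ ≤ f₁₂ ∧ f₂ ≤ f₁₂ ∧
      (∀ x y z, (x, y, z) ∈ V → a (x, y, z) = .empty → f₁₂ ≤ z) ∧
      (∀ x y z, (x, y, z) ∈ V → a (x, y, z) = .one → f₁₂ - f₁ ≤ z - x) ∧
      (∀ x y z, (x, y, z) ∈ V → a (x, y, z) = .two → f₁₂ - f₂ ≤ z - y) ∧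
      (∀ x y z, (x, y, z) ∈ V → a (x, y, z) = .both →
        z ≤ f₁₂ ∧ z - x ≤ f₁₂ - f₁ ∧ z - y ≤ f₁₂ - f₂) := by
  -- `T` collects the lower bounds on the price of `12`. The preceding lemmas show that every upper
  -- bound coming from another region dominates each of them.
  set T : Set ℝ := {r | r = f₁ ∨ r = f₂ ∨ ∃ u v w, (u, v, w) ∈ V ∧ a (u, v, w) = .both ∧
    (r = w ∨ r = f₁ + w - u ∨ r = f₂ + w - v)}
  have hne : T.Nonempty := ⟨f₁, Or.inl rfl⟩
  have bd0 : ∀ x y z, (x, y, z) ∈ V → a (x, y, z) = .empty → ∀ r ∈ T, r ≤ z := by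
    intro x y z ht h r hr
    obtain ⟨hx, hy, hxz, hyz⟩ := S.mono ht
    have e1 := S.le_of_empty₁ ht h
    have e2 := S.le_of_empty₂ ht h
    rcases hr with rfl | rfl | ⟨u, v, w, hv, h12, rfl | rfl | rfl⟩
    · linarith
    · linarith
    · exact S.wmon_empty_both ht hv h h12
    · exact S.empty_le_both₁ ht h hv h12
    · exact S.empty_le_both₂ ht h hv h12
  have hbd : BddAbove T := by
    obtain ⟨x, y, z, ht, h⟩ := h0
    exact ⟨z, fun r hr => bd0 x y z ht h r hr⟩
  refine ⟨sSup T, le_csSup hbd (Or.inl rfl), le_csSup hbd (Or.inr (Or.inl rfl)),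
    fun x y z ht h => csSup_le hne (bd0 x y z ht h), fun x y z ht h => ?_, fun x y z ht h => ?_,
    fun x y z ht h => ?_⟩
  · suffices sSup T ≤ z - x + f₁ by linarith
    refine csSup_le hne fun r hr => ?_
    obtain ⟨hx, hy, hxz, hyz⟩ := S.mono ht
    have e1 := S.one_le_two ht h
    rcases hr with rfl | rfl | ⟨u, v, w, hv, h12, rfl | rfl | rfl⟩
    · linarith
    · linarith
    · linarith [S.one_le_both_empty ht h hv h12]
    · linarith [S.wmon_one_both ht hv h h12]
    · linarith [S.one_le_both_two ht h hv h12]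
  · suffices sSup T ≤ z - y + f₂ by linarith
    refine csSup_le hne fun r hr => ?_
    obtain ⟨hx, hy, hxz, hyz⟩ := S.mono ht
    have e1 := S.two_le_one ht h
    rcases hr with rfl | rfl | ⟨u, v, w, hv, h12, rfl | rfl | rfl⟩
    · linarith
    · linarith
    · linarith [S.two_le_both_empty ht h hv h12]
    · linarith [S.two_le_both_one ht h hv h12]
    · linarith [S.wmon_two_both ht hv h h12]
  · have e1 : z ≤ sSup T := le_csSup hbd (Or.inr (Or.inr ⟨x, y, z, ht, h, Or.inl rfl⟩))
    have e2 : f₁ + z - x ≤ sSup T :=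
      le_csSup hbd (Or.inr (Or.inr ⟨x, y, z, ht, h, Or.inr (Or.inl rfl)⟩))
    have e3 : f₂ + z - y ≤ sSup T :=
      le_csSup hbd (Or.inr (Or.inr ⟨x, y, z, ht, h, Or.inr (Or.inr rfl)⟩))
    exact ⟨e1, by linarith, by linarith⟩

end SingleCritical

/-- The four domains are described by conditions on the excess `x₁ + x₂ - x₁₂`. -/
theorem exists_excess_condition {ε : ℝ} (hε : 0 < ε) {V : Set Bid}
    (hV : V = monotoneVals ∨ V = submodVals ∨ V = epsAddVals ε ∨ V = submodVals ∩ epsAddVals ε) :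
    ∃ P : ℝ → Prop,
      (∀ x y z, (x, y, z) ∈ V ↔ (0 ≤ x ∧ 0 ≤ y ∧ x ≤ z ∧ y ≤ z) ∧ P (x + y - z)) ∧
      (∀ e, P e → ∃ δ > 0, ∀ e', min e 0 ≤ e' → e' < max e 0 + δ → P e') ∧
      ∀ e, 0 ≤ e → e < ε → P e := by
  rcases hV with rfl | rfl | rfl | rfl
  · exact ⟨fun _ => True, fun x y z => by simp [monotoneVals],
      fun e _ => ⟨1, one_pos, fun _ _ _ => trivial⟩, fun _ _ _ => trivial⟩
  · refine ⟨fun e => 0 ≤ e, fun x y z => by simp [monotoneVals, submodVals],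
      fun e he => ⟨1, one_pos, fun e' h1 _ => by rwa [min_eq_right he] at h1⟩, fun e h _ => h⟩
  · refine ⟨fun e => -ε < e ∧ e < ε, fun x y z => ?_, fun e he => ?_,
      fun e h1 h2 => ⟨by linarith, h2⟩⟩
    · simp only [monotoneVals, epsAddVals, mem_ofPred_eq, mem_Ioo]
      constructor
      · rintro ⟨h, h1, h2⟩
        exact ⟨h, by linarith, by linarith⟩
      · rintro ⟨h, h1, h2⟩
        exact ⟨h, by linarith, by linarith⟩
    · refine ⟨ε - max e 0, sub_pos.2 (max_lt he.2 hε), fun e' h1 h2 => ⟨?_, by linarith⟩⟩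
      exact (lt_min he.1 (by linarith)).trans_le h1
  · refine ⟨fun e => 0 ≤ e ∧ e < ε, fun x y z => ?_, fun e he => ?_, fun e h1 h2 => ⟨h1, h2⟩⟩
    · simp only [monotoneVals, submodVals, epsAddVals, mem_inter_iff, mem_ofPred_eq, mem_Ioo]
      constructor
      · rintro ⟨⟨h, h1⟩, -, h2, h3⟩
        exact ⟨h, by linarith, by linarith⟩
      · rintro ⟨h, h1, h2⟩
        exact ⟨⟨h, by linarith⟩, h, by linarith, by linarith⟩
    · refine ⟨ε - max e 0, sub_pos.2 (max_lt he.2 hε), fun e' h1 h2 => ⟨?_, by linarith⟩⟩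
      rwa [min_eq_right he.1] at h1

/-- `p` lists critical values of the bundles: the allocation minimizes `cost t - cost p`. -/
def IsPrice (V : Set Bid) (a : Bid → Bundle) (p : Bid) : Prop :=
  p ∈ monotoneVals ∧ ∀ t ∈ V, ∀ α, cost t (a t) - cost p (a t) ≤ cost t α - cost p α

/-- The prices of `1` and `2` are the suprema of the costs at which they are received. Inserting `0`
gives price `0` to a bundle that is never received. -/
theorem exists_isPrice {V : Set Bid} {P : ℝ → Prop}
    (hV : ∀ x y z, (x, y, z) ∈ V ↔ (0 ≤ x ∧ 0 ≤ y ∧ x ≤ z ∧ y ≤ z) ∧ P (x + y - z))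
    (hP : ∀ e, P e → ∃ δ > 0, ∀ e', min e 0 ≤ e' → e' < max e 0 + δ → P e') {a : Bid → Bundle}
    (hw : ∀ t ∈ V, ∀ t' ∈ V, cost t (a t) - cost t (a t') ≤ cost t' (a t) - cost t' (a t'))
    (h0 : ∃ t ∈ V, a t = .empty) : ∃ p, IsPrice V a p := by
  obtain ⟨⟨x₀, y₀, z₀⟩, ht₀, ha₀⟩ := h0
  have w : ∀ {t t' : Bid} {α β : Bundle}, t ∈ V → t' ∈ V → a t = α → a t' = β →
      cost t α - cost t β ≤ cost t' α - cost t' β := by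
    rintro t t' α β ht ht' rfl rfl
    exact hw t ht t' ht'
  have w₁ : ∀ {x y z x' y' z'}, (x, y, z) ∈ V → (x', y', z') ∈ V →
      a (x, y, z) = .empty → a (x', y', z') = .one → x' ≤ x := by
    intro x y z x' y' z' h h' h1 h2
    have := w h h' h1 h2
    simp only [cost] at this
    linarith
  have w₂ : ∀ {x y z x' y' z'}, (x, y, z) ∈ V → (x', y', z') ∈ V →
      a (x, y, z) = .empty → a (x', y', z') = .two → y' ≤ y := by
    intro x y z x' y' z' h h' h1 h2
    have := w h h' h1 h2
    simp only [cost] at this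
    linarith
  have mono₀ := ((hV _ _ _).1 ht₀).1
  set T₁ : Set ℝ := insert 0 {x | ∃ y z, (x, y, z) ∈ V ∧ a (x, y, z) = .one} with hT₁
  set T₂ : Set ℝ := insert 0 {y | ∃ x z, (x, y, z) ∈ V ∧ a (x, y, z) = .two} with hT₂
  have ub₁ : ∀ {x y z}, (x, y, z) ∈ V → a (x, y, z) = .empty → x ∈ upperBounds T₁ := by
    rintro x y z h h1 r (rfl | ⟨y', z', h', h2⟩)
    · exact ((hV _ _ _).1 h).1.1
    · exact w₁ h h' h1 h2
  have ub₂ : ∀ {x y z}, (x, y, z) ∈ V → a (x, y, z) = .empty → y ∈ upperBounds T₂ := by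
    rintro x y z h h1 r (rfl | ⟨y', z', h', h2⟩)
    · exact ((hV _ _ _).1 h).1.2.1
    · exact w₂ h h' h1 h2
  have bd₁ : BddAbove T₁ := ⟨_, ub₁ ht₀ ha₀⟩
  have bd₂ : BddAbove T₂ := ⟨_, ub₂ ht₀ ha₀⟩
  have ne₁ : T₁.Nonempty := ⟨0, mem_insert _ _⟩
  have ne₂ : T₂.Nonempty := ⟨0, mem_insert _ _⟩
  have S : SingleCritical V a (sSup T₁) (sSup T₂) := by
    constructor
    case mono => exact fun h => ((hV _ _ _).1 h).1
    case step =>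
      intro x y z h
      obtain ⟨δ, hδ, H⟩ := hP _ ((hV _ _ _).1 h).2
      exact ⟨δ, hδ, fun x' y' z' h1 h2 h3 h4 h5 h6 =>
        (hV _ _ _).2 ⟨⟨h1, h2, h3, h4⟩, H _ h5 h6⟩⟩
    case nonneg₁ => exact le_csSup bd₁ (mem_insert _ _)
    case nonneg₂ => exact le_csSup bd₂ (mem_insert _ _)
    case le_of_empty₁ => exact fun h h1 => csSup_le ne₁ (ub₁ h h1)
    case le_of_empty₂ => exact fun h h1 => csSup_le ne₂ (ub₂ h h1)
    case le_of_one => exact fun h h1 => le_csSup bd₁ (Or.inr ⟨_, _, h, h1⟩)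
    case le_of_two => exact fun h h1 => le_csSup bd₂ (Or.inr ⟨_, _, h, h1⟩)
    case exists_one =>
      intro r hr hlt
      obtain ⟨x, hx, hrx⟩ := exists_lt_of_lt_csSup ne₁ hlt
      rcases hx with rfl | ⟨y, z, h, h1⟩
      · exact absurd hrx (not_lt.2 hr)
      · exact ⟨x, y, z, h, h1, hrx⟩
    case exists_two =>
      intro r hr hlt
      obtain ⟨y, hy, hry⟩ := exists_lt_of_lt_csSup ne₂ hlt
      rcases hy with rfl | ⟨x, z, h, h1⟩
      · exact absurd hry (not_lt.2 hr)
      · exact ⟨x, y, z, h, h1, hry⟩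
    all_goals
      intro x y z x' y' z' h h' h1 h2
      have := w h h' h1 h2
      simp only [cost] at this
      linarith
  obtain ⟨f, hf₁, hf₂, e0, e1, e2, e12⟩ := S.exists_both ⟨_, _, _, ht₀, ha₀⟩
  refine ⟨(sSup T₁, sSup T₂, f), ⟨S.nonneg₁, S.nonneg₂, hf₁, hf₂⟩, ?_⟩
  rintro ⟨x, y, z⟩ ht α
  obtain ⟨hx, hy, hxz, hyz⟩ := ((hV _ _ _).1 ht).1
  cases hax : a (x, y, z) with
  | empty =>
    have := S.le_of_empty₁ ht hax
    have := S.le_of_empty₂ ht hax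
    have := e0 x y z ht hax
    cases α <;> simp only [cost] <;> linarith
  | one =>
    have := S.le_of_one ht hax
    have := S.one_le_two ht hax
    have := e1 x y z ht hax
    cases α <;> simp only [cost] <;> linarith
  | two =>
    have := S.le_of_two ht hax
    have := S.two_le_one ht hax
    have := e2 x y z ht hax
    cases α <;> simp only [cost] <;> linarith
  | both =>
    have := e12 x y z ht hax
    cases α <;> simp only [cost] <;> linarith

/-! ### Regions cut out by prices, and monotonicity of the prices in the bid of the `s`-player. -/

namespace IsPrice

variable {V : Set Bid} {a : Bid → Bundle} {p : Bid} {x y z : ℝ}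

theorem eq_empty (h : IsPrice V a p) (ht : (x, y, z) ∈ V) (h1 : p.1 < x) (h2 : p.2.1 < y)
    (h3 : p.2.2 < z) : a (x, y, z) = .empty := by
  have := h.2 _ ht .empty
  cases hax : a (x, y, z) <;> simp only [hax, cost] at this <;> first | rfl | linarith

theorem eq_one (h : IsPrice V a p) (ht : (x, y, z) ∈ V) (h1 : x < p.1)
    (h2 : x - p.1 < y - p.2.1) (h3 : x - p.1 < z - p.2.2) : a (x, y, z) = .one := by
  have := h.2 _ ht .one
  cases hax : a (x, y, z) <;> simp only [hax, cost] at this <;> first | rfl | linarith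

theorem eq_two (h : IsPrice V a p) (ht : (x, y, z) ∈ V) (h1 : y < p.2.1)
    (h2 : y - p.2.1 < x - p.1) (h3 : y - p.2.1 < z - p.2.2) : a (x, y, z) = .two := by
  have := h.2 _ ht .two
  cases hax : a (x, y, z) <;> simp only [hax, cost] at this <;> first | rfl | linarith

theorem eq_both (h : IsPrice V a p) (ht : (x, y, z) ∈ V) (h1 : z < p.2.2)
    (h2 : z - p.2.2 < x - p.1) (h3 : z - p.2.2 < y - p.2.1) : a (x, y, z) = .both := by
  have := h.2 _ ht .both
  cases hax : a (x, y, z) <;> simp only [hax, cost] at this <;> first | rfl | linarith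

end IsPrice

/-- Numbers in prescribed intervals whose sum lies in `[T, T + ε)`. -/
theorem exists_sum_mem {m₁ m₂ T ε : ℝ} (h₁ : m₁ < T) (h₂ : m₂ < T) (h0 : 0 ≤ m₁) (h0' : 0 ≤ m₂)
    (hε : 0 < ε) (hsum : m₁ + m₂ < T + ε) :
    ∃ u ∈ Ioo m₁ T, ∃ v ∈ Ioo m₂ T, T ≤ u + v ∧ u + v < T + ε := by
  rcases lt_or_ge (m₁ + m₂) T with hc | hc
  · obtain ⟨v, hv, hv'⟩ := exists_between (show m₂ < T - m₁ by linarith)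
    exact ⟨T - v, ⟨by linarith, by linarith⟩, v, ⟨hv, by linarith⟩, by linarith, by linarith⟩
  · obtain ⟨u, hu, hu'⟩ := exists_between (lt_min h₁ (show m₁ < T + ε - m₂ by linarith))
    have k := hu'.trans_le (min_le_right _ _)
    obtain ⟨v, hv, hv'⟩ := exists_between (lt_min h₂ (show m₂ < T + ε - u by linarith))
    exact ⟨u, ⟨hu, hu'.trans_le (min_le_left _ _)⟩, v, ⟨hv, hv'.trans_le (min_le_left _ _)⟩,
      by linarith, by linarith [min_le_right T (T + ε - u)]⟩

theorem exists_diff_mem {p q p' q' l u : ℝ} (h : p < q) (h' : p' < q') (hlu : l < u)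
    (h1 : p - q' < u) (h2 : l < q - p') :
    ∃ x ∈ Ioo p q, ∃ y ∈ Ioo p' q', l < x - y ∧ x - y < u := by
  obtain ⟨d, hd, hd'⟩ := exists_between (show max l (p - q') < min u (q - p') from
    max_lt (lt_min hlu h2) (lt_min h1 (by linarith)))
  have a1 := (le_max_left _ _).trans_lt hd
  have a2 := (le_max_right _ _).trans_lt hd
  have a3 := hd'.trans_le (min_le_left _ _)
  have a4 := hd'.trans_le (min_le_right _ _)
  obtain ⟨y, hy, hy'⟩ := exists_between (show max p' (p - d) < min q' (q - d) from
    max_lt (lt_min h' (by linarith)) (lt_min (by linarith) (by linarith)))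
  have b1 := (le_max_left _ _).trans_lt hy
  have b2 := (le_max_right _ _).trans_lt hy
  have b3 := hy'.trans_le (min_le_left _ _)
  have b4 := hy'.trans_le (min_le_right _ _)
  exact ⟨y + d, ⟨by linarith, by linarith⟩, y, ⟨b1, b3⟩, by linarith, by linarith⟩

theorem mem_boundedAddVals {B x y : ℝ} (hx : x ∈ Ioo 0 B) (hy : y ∈ Ioo 0 B) :
    (x, y, x + y) ∈ boundedAddVals B :=
  ⟨⟨hx.1.le, hx.2⟩, ⟨hy.1.le, hy.2⟩, rfl⟩

/-- The prices of a weakly monotone allocation have the monotonicity properties. -/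
theorem criticalValues_of_isPrice {B ε : ℝ} (hB : 0 < B) (hε : 0 < ε) {V : Set Bid}
    (hV : ∀ x y z, 0 ≤ x → 0 ≤ y → x ≤ z → y ≤ z → 0 ≤ x + y - z → x + y - z < ε → (x, y, z) ∈ V)
    {A : Allocation}
    (hA : ∀ t ∈ V, ∀ s ∈ boundedAddVals B, ∀ s' ∈ boundedAddVals B,
      cost s (A t s).compl - cost s (A t s').compl ≤
        cost s' (A t s).compl - cost s' (A t s').compl)
    {p : Bid → Bid} (hp : ∀ s ∈ boundedAddVals B, IsPrice V (fun t => A t s) (p s)) :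
    CriticalValues B ε (fun x y => (p (x, y, x + y)).1) (fun x y => (p (x, y, x + y)).2.1)
      (fun x y => (p (x, y, x + y)).2.2) := by
  have price : ∀ x ∈ Ioo 0 B, ∀ y ∈ Ioo 0 B, IsPrice V (fun t => A t (x, y, x + y))
      (p (x, y, x + y)) := fun x hx y hy => hp _ (mem_boundedAddVals hx hy)
  have nn : ∀ x ∈ Ioo 0 B, ∀ y ∈ Ioo 0 B, 0 ≤ (p (x, y, x + y)).1 ∧ 0 ≤ (p (x, y, x + y)).2.1 ∧
      (p (x, y, x + y)).1 ≤ (p (x, y, x + y)).2.2 ∧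
      (p (x, y, x + y)).2.1 ≤ (p (x, y, x + y)).2.2 := fun x hx y hy => (price x hx y hy).1
  have w : ∀ {x y x' y' : ℝ} {t : Bid} {α β : Bundle}, x ∈ Ioo 0 B → y ∈ Ioo 0 B →
      x' ∈ Ioo 0 B → y' ∈ Ioo 0 B → t ∈ V → A t (x, y, x + y) = α →
      A t (x', y', x' + y') = β →
      cost (x, y, x + y) α.compl - cost (x, y, x + y) β.compl ≤
        cost (x', y', x' + y') α.compl - cost (x', y', x' + y') β.compl := by
    rintro x y x' y' t α β hx hy hx' hy' ht rfl rfl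
    exact hA t ht _ (mem_boundedAddVals hx hy) _ (mem_boundedAddVals hx' hy')
  have mem_add : ∀ u v, 0 ≤ u → 0 ≤ v → (u, v, u + v) ∈ V := fun u v hu hv =>
    hV u v (u + v) hu hv (by linarith) (by linarith) (by linarith) (by linarith)
  refine ⟨hB, hε, fun x hx y hy => (nn x hx y hy).1, fun x hx y hy => (nn x hx y hy).2.1,
    fun x hx y hy => (nn x hx y hy).2.2.1, fun x hx y hy => (nn x hx y hy).2.2.2,
    ?_, ?_, ?_, ?_, ?_, ?_⟩ <;> intro x hx y hy x' hx' y' hy' hlt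
  all_goals
    have P := price x hx y hy
    have P' := price x' hx' y' hy'
    obtain ⟨n1, n2, n3, n4⟩ := nn x hx y hy
    obtain ⟨n1', n2', n3', n4'⟩ := nn x' hx' y' hy'
    revert P P' n1 n2 n3 n4 n1' n2' n3' n4'
    generalize hq : p (x, y, x + y) = q
    generalize hq' : p (x', y', x' + y') = q'
    obtain ⟨f₁, f₂, f₁₂⟩ := q
    obtain ⟨g₁, g₂, g₁₂⟩ := q'
    dsimp only
    intro P P' n1 n2 n3 n4 n1' n2' n3' n4'
  · by_contra! hcon
    obtain ⟨u, hu, hu'⟩ := exists_between hcon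
    -- The large cost of task `2` leaves only `∅` and `1`.
    have ht := mem_add u (f₁₂ + g₁₂ + 1) (by linarith) (by linarith)
    have e1 := P.eq_one ht (by dsimp only; linarith) (by dsimp only; linarith)
      (by dsimp only; linarith)
    have e2 := P'.eq_empty ht (by dsimp only; linarith) (by dsimp only; linarith)
      (by dsimp only; linarith)
    have := w hx hy hx' hy' ht e1 e2
    simp only [cost, Bundle.compl] at this
    linarith
  · by_contra! hcon
    obtain ⟨u, hu, hu'⟩ := exists_between hcon
    have ht := mem_add (f₁₂ + g₁₂ + 1) u (by linarith) (by linarith)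
    have e1 := P.eq_two ht (by dsimp only; linarith) (by dsimp only; linarith)
      (by dsimp only; linarith)
    have e2 := P'.eq_empty ht (by dsimp only; linarith) (by dsimp only; linarith)
      (by dsimp only; linarith)
    have := w hx hy hx' hy' ht e1 e2
    simp only [cost, Bundle.compl] at this
    linarith
  · intro h1 h2
    by_contra! hcon
    obtain ⟨u, hu, hu'⟩ := exists_between hcon
    obtain ⟨v, hv, hv'⟩ := exists_between (show 0 < min (min (f₁₂ - f₁) g₂)
      (min (f₁₂ - f₂ - u) (u - (g₁₂ - g₂))) from lt_min (lt_min (by linarith) h2)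
        (lt_min (by linarith) (by linarith)))
    have d1 := hv'.trans_le ((min_le_left _ _).trans (min_le_left _ _))
    have d2 := hv'.trans_le ((min_le_left _ _).trans (min_le_right _ _))
    have d3 := hv'.trans_le ((min_le_right _ _).trans (min_le_left _ _))
    have d4 := hv'.trans_le ((min_le_right _ _).trans (min_le_right _ _))
    have ht := mem_add u v (by linarith) (by linarith)
    have e1 := P.eq_both ht (by dsimp only; linarith) (by dsimp only; linarith)
      (by dsimp only; linarith)
    have e2 := P'.eq_two ht (by dsimp only; linarith) (by dsimp only; linarith)
      (by dsimp only; linarith)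
    have := w hx hy hx' hy' ht e1 e2
    simp only [cost, Bundle.compl] at this
    linarith
  · intro h1 h2
    by_contra! hcon
    obtain ⟨u, hu, hu'⟩ := exists_between hcon
    obtain ⟨v, hv, hv'⟩ := exists_between (show 0 < min (min (f₁₂ - f₂) g₁)
      (min (f₁₂ - f₁ - u) (u - (g₁₂ - g₁))) from lt_min (lt_min (by linarith) h2)
        (lt_min (by linarith) (by linarith)))
    have d1 := hv'.trans_le ((min_le_left _ _).trans (min_le_left _ _))
    have d2 := hv'.trans_le ((min_le_left _ _).trans (min_le_right _ _))
    have d3 := hv'.trans_le ((min_le_right _ _).trans (min_le_left _ _))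
    have d4 := hv'.trans_le ((min_le_right _ _).trans (min_le_right _ _))
    have ht := mem_add v u (by linarith) (by linarith)
    have e1 := P.eq_both ht (by dsimp only; linarith) (by dsimp only; linarith)
      (by dsimp only; linarith)
    have e2 := P'.eq_one ht (by dsimp only; linarith) (by dsimp only; linarith)
      (by dsimp only; linarith)
    have := w hx hy hx' hy' ht e1 e2
    simp only [cost, Bundle.compl] at this
    linarith
  · intro h1 h2 h3 h4 h5 h6
    by_contra! hcon
    obtain ⟨T, hT, hT'⟩ := exists_between hcon
    -- `T` separates the two prices of `12`. The lower bounds on `u` and `v` make `(u, v, T)`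
    -- receive `12` at `(x, y)` and `∅` at `(x', y')`.
    obtain ⟨u, hu, v, hv, huv, huv'⟩ := exists_sum_mem (m₁ := max g₁ (T - (f₁₂ - f₁)))
      (m₂ := max g₂ (T - (f₁₂ - f₂))) (T := T) (max_lt (by linarith) (by linarith))
      (max_lt (by linarith) (by linarith)) (n1'.trans (le_max_left _ _))
      (n2'.trans (le_max_left _ _)) hε (by
        rcases max_cases g₁ (T - (f₁₂ - f₁)) with ⟨e, -⟩ | ⟨e, -⟩ <;>
        rcases max_cases g₂ (T - (f₁₂ - f₂)) with ⟨e', -⟩ | ⟨e', -⟩ <;> rw [e, e'] <;> linarith)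
    have a1 := (le_max_left _ _).trans_lt hu.1
    have a2 := (le_max_right _ _).trans_lt hu.1
    have a3 := (le_max_left _ _).trans_lt hv.1
    have a4 := (le_max_right _ _).trans_lt hv.1
    have ht := hV u v T (by linarith) (by linarith) hu.2.le hv.2.le (by linarith) (by linarith)
    have e1 := P.eq_both ht (by dsimp only; linarith) (by dsimp only; linarith)
      (by dsimp only; linarith)
    have e2 := P'.eq_empty ht (by dsimp only; linarith) (by dsimp only; linarith)
      (by dsimp only; linarith)
    have := w hx hy hx' hy' ht e1 e2
    simp only [cost, Bundle.compl] at this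
    linarith
  · intro h1 h2 h3 h4
    by_contra! hcon
    obtain ⟨u, hu, v, hv, huv, huv'⟩ := exists_diff_mem h2 h1 hcon h3 h4
    have ht := mem_add u v (by linarith [hu.1]) (by linarith [hv.1])
    have e1 := P.eq_one ht (by dsimp only; linarith [hu.2]) (by dsimp only; linarith)
      (by dsimp only; linarith [hv.1])
    have e2 := P'.eq_two ht (by dsimp only; linarith [hv.2]) (by dsimp only; linarith)
      (by dsimp only; linarith [hu.1])
    have := w hx hy hx' hy' ht e1 e2
    simp only [cost, Bundle.compl] at this
    linarith

/-! ### From prices back to mechanisms. -/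

/-- The additive constant of an affine minimizer. -/
noncomputable def constantOf (o : Option ℝ) : EReal :=
  o.elim ⊤ fun c => ((-c : ℝ) : EReal)

theorem constantOf_ne_bot (o : Option ℝ) : constantOf o ≠ ⊥ := by
  cases o
  · exact top_ne_bot
  · exact EReal.coe_ne_bot _

theorem Agrees.le_constantOf {o : Option ℝ} {z f : ℝ} {P : Prop} (h : Agrees o z f P) :
    ((z - f : ℝ) : EReal) ≤ constantOf o := by
  cases o with
  | none => exact le_top
  | some c => exact EReal.coe_le_coe_iff.2 (by linarith [h.2 c rfl])

theorem Agrees.constantOf_eq {o : Option ℝ} {z f : ℝ} {P : Prop} (h : Agrees o z f P) (hP : P) :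
    constantOf o = ((z - f : ℝ) : EReal) := by
  obtain ⟨c, hc, rfl⟩ := h.1 hP
  obtain rfl := Option.mem_def.1 hc
  simp [constantOf]

/-- The additive constants, with `γ_∅ = 0`. -/
noncomputable def constants (o₁ o₂ o₁₂ : Option ℝ) : Bundle → EReal
  | .empty => 0
  | .one => constantOf o₁
  | .two => constantOf o₂
  | .both => constantOf o₁₂

theorem admissibleConstants_constants (o₁ o₂ o₁₂ : Option ℝ) :
    AdmissibleConstants (constants o₁ o₂ o₁₂) := by
  refine ⟨EReal.zero_ne_top, fun α => ?_⟩
  cases α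
  · exact EReal.zero_ne_bot
  all_goals exact constantOf_ne_bot _

/-- The objective at `α` is at least `t(α) - p(α) + l * (x + y)`, with equality at the allocated
bundle. Equality requires that bundle to be active, and it is: positive marginal costs of `t` force
positive marginal prices. -/
theorem minimizesAffineCost_of_agreesAt {V : Set Bid} {a : Bid → Bundle} {p : Bid}
    (hp : IsPrice V a p) {t : Bid} (ht : t ∈ positivePart V) {l x y : ℝ} {o₁ o₂ o₁₂ : Option ℝ}
    (h₁ : Agrees o₁ (l * x) p.1 (0 < p.1)) (h₂ : Agrees o₂ (l * y) p.2.1 (0 < p.2.1))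
    (h₁₂ : Agrees o₁₂ (l * (x + y)) p.2.2 (p.1 < p.2.2 ∧ p.2.1 < p.2.2)) :
    MinimizesAffineCost 1 l (constants o₁ o₂ o₁₂) t (x, y, x + y) (a t) := by
  obtain ⟨htV, t1, t2, t3, t4⟩ := ht
  have hmin := hp.2 t htV
  have lower : ∀ α, ((l * cost (x, y, x + y) α - cost p α : ℝ) : EReal) ≤
      constants o₁ o₂ o₁₂ α := by
    intro α
    cases α
    · simp [cost, constants]
    · exact h₁.le_constantOf
    · exact h₂.le_constantOf
    · exact h₁₂.le_constantOf
  have eq : constants o₁ o₂ o₁₂ (a t) =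
      ((l * cost (x, y, x + y) (a t) - cost p (a t) : ℝ) : EReal) := by
    have m0 := hmin .empty
    have m1 := hmin .one
    have m2 := hmin .two
    cases hat : a t <;> simp only [hat, cost] at m0 m1 m2
    · simp [cost, constants]
    · exact h₁.constantOf_eq (by linarith)
    · exact h₂.constantOf_eq (by linarith)
    · exact h₁₂.constantOf_eq ⟨by linarith, by linarith⟩
  have total : ∀ α : Bundle, 1 * cost t α + l * cost (x, y, x + y) α.compl +
      (l * cost (x, y, x + y) α - cost p α) = cost t α - cost p α + l * (x + y) := by
    intro α
    cases α <;> simp only [cost, Bundle.compl] <;> ring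
  intro β
  unfold affineCost
  refine le_trans ?_ (add_le_add_right (lower β) _)
  rw [eq, ← EReal.coe_add, ← EReal.coe_add, EReal.coe_le_coe_iff, total, total]
  linarith [hmin β]

theorem hasCriticalValue_of_isPrice {V : Set Bid} {A : Allocation} {s p : Bid}
    (hp : IsPrice V (fun t => A t s) p) {α : Bundle}
    (hα : ∀ t ∈ positivePart V, A t s = .empty ∨ A t s = α) :
    HasCriticalValue (positivePart V) A α 1 s (cost p α) := by
  have e : ∀ x, cost x .empty = 0 := fun _ => rfl
  intro t ht
  refine ⟨hα t ht, fun hlt => ?_, fun hlt => ?_⟩ <;> rw [one_mul] at hlt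
  · rcases hα t ht with h | h
    · exact h
    · have := hp.2 t ht.1 .empty
      simp only [h, e] at this
      linarith
  · rcases hα t ht with h | h
    · have := hp.2 t ht.1 α
      simp only [h, e] at this
      linarith
    · exact h

theorem mem_positivePart_boundedAddVals {B : ℝ} {s : Bid}
    (hs : s ∈ positivePart (boundedAddVals B)) :
    ∃ x ∈ Ioo 0 B, ∃ y ∈ Ioo 0 B, s = (x, y, x + y) := by
  obtain ⟨s₁, s₂, s₁₂⟩ := s
  obtain ⟨⟨h1, h2, h3⟩, h4, h5, -⟩ := hs
  simp only at h1 h2 h3 h4 h5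
  exact ⟨s₁, ⟨h4, h1.2⟩, s₂, ⟨h5, h2.2⟩, by rw [h3]⟩

theorem cost_nonneg {p : Bid} (hp : p ∈ monotoneVals) (α : Bundle) : 0 ≤ cost p α := by
  obtain ⟨h1, h2, h3, h4⟩ := hp
  cases α
  · exact le_rfl
  · exact h1
  · exact h2
  · exact h1.trans h3

/-- Prices at bids with equal `s(α)` differ only within a jump, so `ξ` can be read off at any
representative `σ z`. -/
theorem isOneDimensional_of_isPrice {V S : Set Bid} {A : Allocation} {p : Bid → Bid}
    (hp : ∀ s ∈ S, IsPrice V (fun t => A t s) (p s)) {α : Bundle} (hα : α ≠ .empty)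
    (mono : ∀ s ∈ S, ∀ s' ∈ S, cost s α < cost s' α → cost (p s) α ≤ cost (p s') α)
    (only : ∀ s ∈ S, ∀ t ∈ positivePart V, A t s = .empty ∨ A t s = α) :
    IsOneDimensional (positivePart V) S A := by
  have hex : ∀ z ∈ (fun s => cost s α) '' S, ∃ s, s ∈ S ∧ cost s α = z :=
    fun z ⟨s, hs, h⟩ => ⟨s, hs, h⟩
  choose! σ hσ using hex
  refine ⟨α, fun z => cost (p (σ z)) α, hα, fun z hz z' hz' hle => ?_, fun z hz => ?_,
    fun s hs => ⟨cost (p s) α, ⟨fun y hy hlt => ?_, fun y hy hlt => ?_⟩,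
      hasCriticalValue_of_isPrice (hp s hs) (only s hs)⟩⟩
  · rcases hle.eq_or_lt with rfl | hlt
    · exact le_rfl
    · exact mono _ (hσ z hz).1 _ (hσ z' hz').1 (by rwa [(hσ z hz).2, (hσ z' hz').2])
  · exact cost_nonneg (hp _ (hσ z hz).1).1 α
  · exact mono _ (hσ y hy).1 _ hs (by rwa [(hσ y hy).2])
  · exact mono _ hs _ (hσ y hy).1 (by rwa [(hσ y hy).2])

theorem isOneDimensional_of_type {B ε : ℝ} {V : Set Bid} {A : Allocation} {p : Bid → Bid}
    (hp : ∀ s ∈ boundedAddVals B, IsPrice V (fun t => A t s) (p s))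
    (h : CriticalValues B ε (fun x y => (p (x, y, x + y)).1) (fun x y => (p (x, y, x + y)).2.1)
      (fun x y => (p (x, y, x + y)).2.2))
    (hO : IsOneDimensionalType B (fun x y => (p (x, y, x + y)).1)
      (fun x y => (p (x, y, x + y)).2.1) (fun x y => (p (x, y, x + y)).2.2)) :
    IsOneDimensional (positivePart V) (positivePart (boundedAddVals B)) A := by
  have hε := h.ε_pos
  rcases hO with hO | hO | hO
  · refine isOneDimensional_of_isPrice (α := .both) (fun s hs => hp s hs.1) (by simp) ?_ ?_
    · intro s hs s' hs' hlt
      obtain ⟨x, hx, y, hy, rfl⟩ := mem_positivePart_boundedAddVals hs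
      obtain ⟨x', hx', y', hy', rfl⟩ := mem_positivePart_boundedAddVals hs'
      simp only [cost] at hlt ⊢
      have n1 := h.le₁ x hx y hy
      have n2 := h.le₁ x' hx' y' hy'
      obtain ⟨z1, z2⟩ := hO x hx y hy
      obtain ⟨z3, z4⟩ := hO x' hx' y' hy'
      have M := h.mono₁₂ x hx y hy x' hx' y' hy' hlt
      simp only at n1 n2 z1 z2 z3 z4 M
      rcases n1.eq_or_lt with h1 | h1
      · linarith
      · exact M h1 (by linarith) (by linarith) (by linarith) (by linarith) (by linarith)
    · intro s hs t ht
      obtain ⟨x, hx, y, hy, rfl⟩ := mem_positivePart_boundedAddVals hs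
      obtain ⟨htV, t1, t2, -⟩ := ht
      obtain ⟨z1, z2⟩ := hO x hx y hy
      have m := (hp _ hs.1).2 t htV .empty
      cases hat : A t (x, y, x + y) <;> simp only [hat, cost] at m <;> simp <;> linarith
  · refine isOneDimensional_of_isPrice (α := .two) (fun s hs => hp s hs.1) (by simp) ?_ ?_
    · intro s hs s' hs' hlt
      obtain ⟨x, hx, y, hy, rfl⟩ := mem_positivePart_boundedAddVals hs
      obtain ⟨x', hx', y', hy', rfl⟩ := mem_positivePart_boundedAddVals hs'
      exact h.mono₂ x hx y hy x' hx' y' hy' hlt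
    · intro s hs t ht
      obtain ⟨x, hx, y, hy, rfl⟩ := mem_positivePart_boundedAddVals hs
      obtain ⟨htV, t1, t2, t3, t4⟩ := ht
      obtain ⟨z1, z2⟩ := hO x hx y hy
      have m := (hp _ hs.1).2 t htV .empty
      have m' := (hp _ hs.1).2 t htV .two
      cases hat : A t (x, y, x + y) <;> simp only [hat, cost] at m m' <;> simp <;> linarith
  · refine isOneDimensional_of_isPrice (α := .one) (fun s hs => hp s hs.1) (by simp) ?_ ?_
    · intro s hs s' hs' hlt
      obtain ⟨x, hx, y, hy, rfl⟩ := mem_positivePart_boundedAddVals hs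
      obtain ⟨x', hx', y', hy', rfl⟩ := mem_positivePart_boundedAddVals hs'
      exact h.mono₁ x hx y hy x' hx' y' hy' hlt
    · intro s hs t ht
      obtain ⟨x, hx, y, hy, rfl⟩ := mem_positivePart_boundedAddVals hs
      obtain ⟨htV, t1, t2, t3, t4⟩ := ht
      obtain ⟨z1, z2⟩ := hO x hx y hy
      have m := (hp _ hs.1).2 t htV .empty
      have m' := (hp _ hs.1).2 t htV .one
      cases hat : A t (x, y, x + y) <;> simp only [hat, cost] at m m' <;> simp <;> linarith

theorem min_constantOf {o₁ o₂ : Option ℝ} {D : ℝ} (h₁ : ∀ c ∈ o₁, c ≤ -D) (h₂ : ∀ c ∈ o₂, c ≤ -D)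
    (h : -D ∈ o₁ ∨ -D ∈ o₂) : min (constantOf o₁) (constantOf o₂) = (D : EReal) := by
  have le : ∀ {o : Option ℝ}, (∀ c ∈ o, c ≤ -D) → (D : EReal) ≤ constantOf o := by
    intro o ho
    cases o with
    | none => exact le_top
    | some c => exact EReal.coe_le_coe_iff.2 (by linarith [ho c rfl])
  have eq : ∀ {o : Option ℝ}, -D ∈ o → constantOf o = (D : EReal) := by
    intro o ho
    obtain rfl := Option.mem_def.1 ho
    simp [constantOf]
  rcases h with h | h
  · rw [eq h, min_eq_left (le h₂)]
  · rw [eq h, min_eq_right (le h₁)]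

theorem isAffineMinimizerWithTail_of_type {B ε : ℝ} {V : Set Bid} {A : Allocation}
    {p : Bid → Bid} (hp : ∀ s ∈ boundedAddVals B, IsPrice V (fun t => A t s) (p s))
    (h : CriticalValues B ε (fun x y => (p (x, y, x + y)).1) (fun x y => (p (x, y, x + y)).2.1)
      (fun x y => (p (x, y, x + y)).2.2))
    (hT : IsTailType B (fun x y => (p (x, y, x + y)).1)
      (fun x y => (p (x, y, x + y)).2.1) (fun x y => (p (x, y, x + y)).2.2)) :
    IsAffineMinimizerWithTail (positivePart V) (positivePart (boundedAddVals B)) A := by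
  have hε := h.ε_pos
  obtain ⟨l, D, c₁₂, o₁, o₂, hl, hD, hDB, hnn, ho₁, ho₂, ho, hag, htail⟩ := hT
  set F : ℝ → ℝ → ℝ := fun x y => (p (x, y, x + y)).2.2 with hF
  have Fnn : ∀ x ∈ Ioo 0 B, ∀ y ∈ Ioo 0 B, 0 ≤ F x y := fun x hx y hy =>
    (h.nonneg₁ x hx y hy).trans (h.le₁ x hx y hy)
  have Fmono : ∀ x ∈ Ioo 0 B, ∀ y ∈ Ioo 0 B, ∀ x' ∈ Ioo 0 B, ∀ y' ∈ Ioo 0 B, x + y < x' + y' →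
      x' + y' ≤ D → F x y ≤ F x' y' := by
    intro x hx y hy x' hx' y' hy' hlt hle
    obtain ⟨z1, z2, -⟩ := htail x hx y hy (by linarith)
    obtain ⟨z3, z4, -⟩ := htail x' hx' y' hy' hle
    have M := h.mono₁₂ x hx y hy x' hx' y' hy' hlt
    simp only at z1 z2 z3 z4 M
    have n := Fnn x hx y hy
    have n' := Fnn x' hx' y' hy'
    simp only [hF] at n n' ⊢
    rcases n.eq_or_lt with h1 | h1
    · linarith
    · exact M (by linarith) (by linarith) (by linarith) (by linarith) (by linarith) (by linarith)
  have hlD : 0 < l * D := mul_pos hl hD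
  have half : ∀ z, 0 < z → z < l * D → z / l / 2 ∈ Ioo 0 B ∧ z / l / 2 + z / l / 2 < D ∧
      l * (z / l / 2 + z / l / 2) = z := by
    intro z hz hzD
    have h1 : z / l < D := by rw [div_lt_iff₀ hl]; linarith
    have h2 : 0 < z / l := div_pos hz hl
    refine ⟨⟨by linarith, by linarith⟩, by linarith, ?_⟩
    field_simp
    ring
  -- `ξ` is the price at the diagonal bid of the given sum. Its value at the end of the tail is
  -- forced by the constants; the value `0` at `z ≤ 0` is a default, as positive bids have positive
  -- sum.
  set ξ : ℝ → ℝ := fun z => if z < l * D then (if 0 < z then F (z / l / 2) (z / l / 2) else 0)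
    else l * D + c₁₂ with hξ
  have ξD : ξ (l * D) = l * D + c₁₂ := by simp [hξ]
  have ξ_zero : ∀ z, z ≤ 0 → ξ z = 0 := fun z hz => by
    simp only [hξ]
    rw [if_pos (by linarith), if_neg (not_lt.2 hz)]
  have ξ_mid : ∀ z, 0 < z → z < l * D → ξ z = F (z / l / 2) (z / l / 2) := fun z hz hz' => by
    simp only [hξ]
    rw [if_pos hz', if_pos hz]
  have lower : ∀ x ∈ Ioo 0 B, ∀ y ∈ Ioo 0 B, x + y ≤ D → ∀ z, z < l * (x + y) → ξ z ≤ F x y := by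
    intro x hx y hy hle z hz
    rcases le_or_gt z 0 with h0 | h0
    · rw [ξ_zero z h0]
      exact Fnn x hx y hy
    · have hz' : z < l * D := hz.trans_le (mul_le_mul_of_nonneg_left hle hl.le)
      obtain ⟨m1, m2, m3⟩ := half z h0 hz'
      rw [ξ_mid z h0 hz']
      exact Fmono _ m1 _ m1 x hx y hy (lt_of_mul_lt_mul_left (by rw [m3]; exact hz) hl.le) hle
  have upper : ∀ x ∈ Ioo 0 B, ∀ y ∈ Ioo 0 B, x + y ≤ D → ∀ z, z ≤ l * D → l * (x + y) < z →
      F x y ≤ ξ z := by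
    intro x hx y hy hle z hzD hz
    rcases hzD.eq_or_lt with rfl | hzD
    · rw [ξD]
      exact (htail x hx y hy hle).2.2
    · have h0 : 0 < z := lt_trans (mul_pos hl (by linarith [hx.1, hy.1])) hz
      obtain ⟨m1, m2, m3⟩ := half z h0 hzD
      rw [ξ_mid z h0 hzD]
      exact Fmono x hx y hy _ m1 _ m1 (lt_of_mul_lt_mul_left (by rw [m3]; exact hz) hl.le) m2.le
  have ξ_nonneg : ∀ z ∈ Icc 0 (l * D), 0 ≤ ξ z := by
    intro z hz
    rcases hz.1.eq_or_lt with rfl | h0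
    · rw [ξ_zero 0 le_rfl]
    rcases hz.2.eq_or_lt with rfl | hD'
    · rwa [ξD]
    · rw [ξ_mid z h0 hD']
      exact Fnn _ (half z h0 hD').1 _ (half z h0 hD').1
  refine ⟨1, l, constants o₁ o₂ (some c₁₂), l * D, ξ, one_pos, hl,
    admissibleConstants_constants _ _ _, hlD, ?_, ?_, ξ_nonneg, ?_, ?_, ?_⟩
  · simp only [constants]
    rw [min_constantOf ho₁ ho₂ ho, sub_zero]
  · intro z hz z' hz' hle
    rcases hle.eq_or_lt with rfl | hlt
    · exact le_rfl
    rcases hz.1.eq_or_lt with rfl | h0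
    · rw [ξ_zero 0 le_rfl]
      exact ξ_nonneg z' hz'
    · have hzD : z < l * D := hlt.trans_le hz'.2
      obtain ⟨m1, m2, m3⟩ := half z h0 hzD
      rw [ξ_mid z h0 hzD]
      exact upper _ m1 _ m1 m2.le z' hz'.2 (by rwa [m3])
  · simp only [constants]
    rw [min_constantOf ho₁ ho₂ ho, ξD]
    simp only [constantOf, Option.elim]
    rw [← EReal.coe_sub, sub_neg_eq_add]
  · intro s hs hlt t ht
    obtain ⟨x, hx, y, hy, rfl⟩ := mem_positivePart_boundedAddVals hs
    obtain ⟨a1, a2, a12⟩ := hag x hx y hy (lt_of_mul_lt_mul_left hlt hl.le)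
    exact minimizesAffineCost_of_agreesAt (hp _ hs.1) ht a1 a2 a12
  · intro s hs hle
    obtain ⟨x, hx, y, hy, rfl⟩ := mem_positivePart_boundedAddVals hs
    have hle' : x + y ≤ D := le_of_mul_le_mul_left hle hl
    obtain ⟨z1, z2, z3⟩ := htail x hx y hy hle'
    refine ⟨F x y, ⟨fun z _ hz => lower x hx y hy hle' z hz,
      fun z hz hz' => upper x hx y hy hle' z hz.2 hz'⟩, by rwa [ξD],
      hasCriticalValue_of_isPrice (α := .both) (hp _ hs.1) fun t ht => ?_⟩
    obtain ⟨htV, t1, t2, -⟩ := ht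
    have m := (hp _ hs.1).2 t htV .empty
    cases hat : A t (x, y, x + y) <;> simp only [hat, cost] at m <;> simp <;> linarith

theorem isAffineMinimizer_or_isConstantMechanism_of_type {B : ℝ} {V : Set Bid} {A : Allocation}
    {p : Bid → Bid} (hp : ∀ s ∈ boundedAddVals B, IsPrice V (fun t => A t s) (p s))
    (hT : IsAffineType B (fun x y => (p (x, y, x + y)).1)
      (fun x y => (p (x, y, x + y)).2.1) (fun x y => (p (x, y, x + y)).2.2)) :
    IsAffineMinimizer (positivePart V) (positivePart (boundedAddVals B)) A ∨
      IsConstantMechanism (positivePart V) (positivePart (boundedAddVals B)) A := by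
  obtain ⟨l, hl, o₁, o₂, o₁₂, hag⟩ := hT
  have key : ∀ t ∈ positivePart V, ∀ s ∈ positivePart (boundedAddVals B),
      MinimizesAffineCost 1 l (constants o₁ o₂ o₁₂) t s (A t s) := by
    intro t ht s hs
    obtain ⟨x, hx, y, hy, rfl⟩ := mem_positivePart_boundedAddVals hs
    obtain ⟨a1, a2, a12⟩ := hag x hx y hy
    exact minimizesAffineCost_of_agreesAt (hp _ hs.1) ht a1 a2 a12
  rcases hl.eq_or_lt with rfl | hl
  · exact Or.inr ⟨1, _, one_pos, admissibleConstants_constants _ _ _, key⟩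
  · exact Or.inl ⟨1, l, _, one_pos, hl, admissibleConstants_constants _ _ _, key⟩

theorem mainTheorem2 (B ε : ℝ) (hB : 0 < B) (hε : 0 < ε) (V : Set Bid)
    (hV : V = monotoneVals ∨ V = submodVals ∨ V = epsAddVals ε ∨ V = submodVals ∩ epsAddVals ε)
    (A : Allocation) (hA : IsWMON V (boundedAddVals B) A)
    (hR : ∀ s ∈ boundedAddVals B, (region V A .empty s).Nonempty) :
    IsRelaxedAffineMinimizer (positivePart V) (positivePart (boundedAddVals B)) A ∨
    IsOneDimensional (positivePart V) (positivePart (boundedAddVals B)) A ∨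
    IsConstantMechanism (positivePart V) (positivePart (boundedAddVals B)) A := by
  obtain ⟨P, hP, hP', hP''⟩ := exists_excess_condition hε hV
  have hex : ∀ s ∈ boundedAddVals B, ∃ p, IsPrice V (fun t => A t s) p := by
    intro s hs
    obtain ⟨t, ht, hev⟩ := hR s hs
    exact exists_isPrice hP hP' (hA.1 s hs) ⟨t, ht, hev.self_of_nhdsWithin ht⟩
  choose! p hp using hex
  have h := criticalValues_of_isPrice hB hε
    (fun x y z h1 h2 h3 h4 h5 h6 => (hP x y z).2 ⟨⟨h1, h2, h3, h4⟩, hP'' _ h5 h6⟩) hA.2 hp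
  rcases h.isClassified with h1 | h1 | h1
  · rcases isAffineMinimizer_or_isConstantMechanism_of_type hp h1 with h2 | h2
    · exact Or.inl (Or.inl h2)
    · exact Or.inr (Or.inr h2)
  · exact Or.inl (Or.inr (isAffineMinimizerWithTail_of_type hp h h1))
  · exact Or.inr (Or.inl (isOneDimensional_of_type hp h h1))
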